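/- Let $F$ be a nonarchimedean local field of characteristic zero with algebraic closure $\bar F$, and let $m\ge 0$, $n\in\{2m,2m+1\}$. Let $w_k$ be the $k\times k$ matrix with ones on the antidiagonal and zeros elsewhere, $g_\theta=\operatorname{diag}(-1,1,-1,\dots)\in GL_n$ and $u_n=g_\theta w_n$. Put $\varepsilon(g)=w_n\,{}^tg^{-1}w_n^{-1}$ and $\theta^*(g)=u_n\,{}^tg^{-1}u_n^{-1}$ on $GL_n$, so that $\theta^*=\operatorname{Int}(g_\theta)\circ\varepsilon$, and let $G=SO_{2m+1}$ be defined by the form $w_{2m+1}$. *Norm correspondence.* For $X\in M_{n\times(2m+1)}$ put $X'=-w_{2m+1}\,{}^tX\,w_n$, and consider the equation (E): $Y+w_n\,{}^tY\,w_n=XX'$. Let $\mathcal N$ be the set of $\varepsilon$-conjugacy classes $\{Y^{-1}\}$ ($Y\in GL_n$) for which (E) has a solution $(X,Y)$, and let $N_\varepsilon(\{Y^{-1}\})$ be the set of conjugacy classes in $G$ of the elements $(-1)^n(I-X_1'Y_1^{-1}X_1)$, over all solutions $(X_1,Y_1)$ of (E) with $Y_1^{-1}\in\{Y^{-1}\}$.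 (This is used over $F$ and over $\bar F$.) *Twisted classes.* For $\theta\in\{\varepsilon,\theta^*\}$, elements $\delta$ and $g\delta\theta(g)^{-1}$ are $\theta$-conjugate; $\delta$ is $\theta$-semisimple if $\operatorname{Int}(\delta)\circ\theta$ preserves a pair (Borel subgroup, maximal torus in it) of $GL_n$ over $\bar F$; $\operatorname{Cent}_\theta(\delta)=\{g\mid g\delta\theta(g)^{-1}=\delta\}$; and $\delta$ is strongly $\theta$-regular if $\operatorname{Cent}_\theta(\delta)$ over $\bar F$ is abelian. For a $\theta^*$-stable maximal torus $T'$ of $GL_n$ put $T'_{\theta^*}=T'/(1-\theta^*)T'$, where $(1-\theta^*)T'=\{s\,\theta^*(s)^{-1}\mid s\in T'\}$. *Kottwitz–Shelstad norm.* For the diagonal tori $T'_0\subset GL_n$ and $T_0\subset G$ let $(T'_0)_{\theta^*}\simeq T_0$ be the standard isomorphism induced by $\operatorname{diag}(a_1,\dots,a_n)\mapsto\operatorname{diag}(a_1/a_n,\dots,a_m/a_{n+1-m},1,a_{n+1-m}/a_m,\dots,a_n/a_1)$. The image map $\mathcal A$ takes a semisimple conjugacy class of $G(\bar F)$ to the $\theta^*$-conjugacy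 class in $GL_n(\bar F)$ that corresponds to it through this isomorphism. An element $\gamma\in G(F)$ is a Kottwitz–Shelstad norm of $\delta\in GL_n(F)$ with respect to $\theta^*$ if $\mathcal A$ takes the class of $\gamma$ to the $\theta^*$-class of $\delta$ over $\bar F$; it is a norm of $\gamma'$ with respect to $\varepsilon$ if it is a norm of $\gamma'g_\theta^{-1}$ with respect to $\theta^*$. Two elements of $G(F)$ are stably conjugate if they are conjugate in $G(\bar F)$. Let $\varphi$ be the embedding $\begin{pmatrix}A_{11}&A_{12}\\A_{21}&A_{22}\end{pmatrix}\mapsto\begin{pmatrix}A_{11}&0&A_{12}\\0&1&0\\A_{21}&0&A_{22}\end{pmatrix}$ ($A_{ij}\in M_m$), and $N_{\theta^*}(\delta)=\delta\,\theta^*(\delta)$. Then: 1. Let $n=2m+1$ and let $\gamma'\in GL_n(F)$ be $\varepsilon$-semisimple and strongly $\varepsilon$-regular with class in $\mathcal N$. Then $N_\varepsilon(\{\gamma'\})$ is non-empty, and for every $\gamma_1$ in a class of $N_\varepsilon(\{\gamma'\})$ the set of Kottwitz–Shelstad norms of $\gamma'$ with respect to $\varepsilon$ is exactly the stable conjugacy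 class of $\gamma_1$. In other words, the Kottwitz–Shelstad norm is the stable class of the negative $-(I-X'Y^{-1}X)$ of $I-X'Y^{-1}X$. 2. Let $n=2m$ and let $\delta\in GL_n(F)$ be $\theta^*$-semisimple (for example also strongly $\theta^*$-regular). Then $\gamma\in G(F)$ is a Kottwitz–Shelstad norm of $\delta$ if and only if $\gamma$ is conjugate to $\varphi(N_{\theta^*}(\delta))$ in $GL_{2m+1}(\bar F)$. 3. Let $n=2m$ or $n=2m+1$, and let $T$ be a Cartan subgroup of $G$ defined over $F$. There are a $\theta^*$-stable Cartan subgroup $T'$ of $GL_n$ defined over $F$, contained in a $\theta^*$-stable Borel subgroup over $\bar F$, and an isomorphism $e:T'_{\theta^*}\simeq T$ defined over $F$, obtained from the standard isomorphism $(T'_0)_{\theta^*}\simeq T_0$ by conjugating pairs containing $T'$ and $T$ to the standard pairs, such that, with $e(t)$ the image of $t\in T'$ in $T$: (a) for $t\in T'(\bar F)$, $e(t)$ is conjugate in $GL_{2m+1}(\bar F)$ to $\varphi(N_{\theta^*}(t))$ if $n=2m$, and to $N_{\theta^*}(t)$ if $n=2m+1$; (b) the diagram $T'\xrightarrow{t\mapsto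 tg_\theta}T'g_\theta\xrightarrow{N_\varepsilon}T$, $T'\xrightarrow{e}T$ commutes: for every strongly $\theta^*$-regular $t\in T'(\bar F)$, $N_\varepsilon(\{tg_\theta\})$ over $\bar F$ consists of the conjugacy class of $e(t)$ alone; and for every strongly $\theta^*$-regular $\delta\in T'(F)$, $e(\delta)\in T(F)$ and every element of every class of $N_\varepsilon(\{\delta g_\theta\})$ over $F$ is stably conjugate to $e(\delta)$; (c) $e$ induces the image map: for $t\in T'(\bar F)$, $\mathcal A$ takes the class of $e(t)$ to the $\theta^*$-conjugacy class of $t$; (d) for every strongly $\theta^*$-regular $\delta^*\in T'(\bar F)$, $\operatorname{Cent}_{\theta^*}(\delta^*)=(T')^{\theta^*}=\{t\in T'\mid\theta^*(t)=t\}$. -/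

import Mathlib

open Matrix

noncomputable section

namespace TwistedNorm

section Groups

variable {n : ℕ} {K : Type*} [Field K]

/-- The diagonal matrix `diag(a_1, …, a_n)`. -/
def diagGL (a : Fin n → Kˣ) : GL (Fin n) K where
  val := diagonal fun i => (a i : K)
  inv := diagonal fun i => ((a i)⁻¹ : Kˣ)
  val_inv := by simp [diagonal_mul_diagonal]
  inv_val := by simp [diagonal_mul_diagonal]

variable (n K) in
/-- The matrix `w_n`, with ones on the antidiagonal. -/
def wMat : Matrix (Fin n) (Fin n) K := of fun i j => if j = i.rev then 1 else 0

theorem wMat_mul_self : wMat n K * wMat n K = 1 := by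
  ext i j
  simp only [wMat, mul_apply, of_apply, one_apply, ite_mul, one_mul, zero_mul]
  rw [Finset.sum_ite_eq' Finset.univ i.rev]
  simp [eq_comm]

variable (n K) in
/-- `w_n` as an element of `GL_n`. -/
def wGL : GL (Fin n) K where
  val := wMat n K
  inv := wMat n K
  val_inv := wMat_mul_self
  inv_val := wMat_mul_self

variable (n K) in
/-- `g_θ = diag(-1, 1, -1, …)`. -/
def gTheta : GL (Fin n) K := diagGL fun i => (-1) ^ (i.val + 1)

variable (n K) in
/-- `u_n = g_θ w_n`, the antidiagonal matrix with entries `-1, 1, -1, …` from the top row down. -/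
def uGL : GL (Fin n) K := gTheta n K * wGL n K

/-- `ᵗg⁻¹`. -/
def transposeInv (g : GL (Fin n) K) : GL (Fin n) K where
  val := ((g⁻¹ : GL (Fin n) K) : Matrix (Fin n) (Fin n) K)ᵀ
  inv := (g : Matrix (Fin n) (Fin n) K)ᵀ
  val_inv := by rw [← transpose_mul, ← GeneralLinearGroup.coe_mul]; simp
  inv_val := by rw [← transpose_mul, ← GeneralLinearGroup.coe_mul]; simp

theorem transposeInv_mul (g h : GL (Fin n) K) :
    transposeInv (g * h) = transposeInv g * transposeInv h := by
  apply Units.ext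
  change (((g * h)⁻¹ : GL (Fin n) K) : Matrix (Fin n) (Fin n) K)ᵀ =
    ((g⁻¹ : GL (Fin n) K) : Matrix (Fin n) (Fin n) K)ᵀ *
      ((h⁻¹ : GL (Fin n) K) : Matrix (Fin n) (Fin n) K)ᵀ
  rw [← transpose_mul, ← GeneralLinearGroup.coe_mul, _root_.mul_inv_rev]

/-- The automorphism `g ↦ J ᵗg⁻¹ J⁻¹` of `GL_n`. -/
def contragredient (J : GL (Fin n) K) : GL (Fin n) K →* GL (Fin n) K :=
  MonoidHom.mk' (fun g => J * transposeInv g * J⁻¹) fun g h => by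
    rw [transposeInv_mul]; group

variable (n K) in
/-- `ε(g) = w_n ᵗg⁻¹ w_n⁻¹`. -/
def epsilon : GL (Fin n) K →* GL (Fin n) K := contragredient (wGL n K)

variable (n K) in
/-- `θ*(g) = u_n ᵗg⁻¹ u_n⁻¹`. -/
def thetaStar : GL (Fin n) K →* GL (Fin n) K := contragredient (uGL n K)

variable (n K) in
/-- The diagonal torus of `GL_n`. -/
def diagTorus : Subgroup (GL (Fin n) K) :=
  (MonoidHom.mk' (fun a : Fin n → Kˣ => diagGL a) fun a b => by
    apply Units.ext
    simp [diagGL, diagonal_mul_diagonal]).range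

variable (n K) in
/-- The upper triangular Borel subgroup of `GL_n`. -/
def upperBorel : Subgroup (GL (Fin n) K) where
  carrier := {g | (g : Matrix (Fin n) (Fin n) K).BlockTriangular id}
  one_mem' := by simpa using blockTriangular_one
  mul_mem' {a b} ha hb := by
    simpa using BlockTriangular.mul (show (a : Matrix (Fin n) (Fin n) K).BlockTriangular id from ha)
      (show (b : Matrix (Fin n) (Fin n) K).BlockTriangular id from hb)
  inv_mem' {a} ha := by
    have : Invertible (a : Matrix (Fin n) (Fin n) K) := a.invertible
    simpa using blockTriangular_inv_of_blockTriangular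
      (show (a : Matrix (Fin n) (Fin n) K).BlockTriangular id from ha)

/-- The conjugate `g H g⁻¹`. -/
def conjSubgroup {G : Type*} [Group G] (g : G) (H : Subgroup G) : Subgroup G :=
  H.map (MulAut.conj g).toMonoidHom

/-- `(g B₀ g⁻¹, g T₀ g⁻¹)`, where `(B₀, T₀)` is the standard pair of `GL_n`, is stable under `θ`.
Over an algebraically closed field every pair (Borel subgroup, maximal torus in it) has this
form. -/
def PairStable (θ : GL (Fin n) K →* GL (Fin n) K) (g : GL (Fin n) K) : Prop :=
  (conjSubgroup g (upperBorel n K)).map θ = conjSubgroup g (upperBorel n K) ∧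
    (conjSubgroup g (diagTorus n K)).map θ = conjSubgroup g (diagTorus n K)

/-- `δ` and `δ'` are `θ`-conjugate: `δ' = g δ θ(g)⁻¹` for some `g`. -/
def TwistedConj (θ : GL (Fin n) K →* GL (Fin n) K) (δ δ' : GL (Fin n) K) : Prop :=
  ∃ g : GL (Fin n) K, δ' = g * δ * (θ g)⁻¹

/-- The `θ`-twisted centralizer `Cent_θ(δ) = {g | g δ θ(g)⁻¹ = δ}`. -/
def twistedCentralizer (θ : GL (Fin n) K →* GL (Fin n) K) (δ : GL (Fin n) K) :
    Subgroup (GL (Fin n) K) where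
  carrier := {g | g * δ * (θ g)⁻¹ = δ}
  one_mem' := by simp
  mul_mem' {a b} ha hb := by
    simp only [Set.mem_ofPred_eq, map_mul, _root_.mul_inv_rev] at *
    calc a * b * δ * ((θ b)⁻¹ * (θ a)⁻¹) = a * (b * δ * (θ b)⁻¹) * (θ a)⁻¹ := by group
      _ = δ := by rw [hb, ha]
  inv_mem' {a} ha := by
    simp only [Set.mem_ofPred_eq, map_inv, inv_inv] at *
    calc a⁻¹ * δ * θ a = a⁻¹ * (a * δ * (θ a)⁻¹) * θ a := by rw [ha]
      _ = δ := by group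

/-- `δ` is `θ`-semisimple: `Int(δ) ∘ θ` preserves a pair (Borel subgroup, maximal torus in it).
Used over an algebraically closed field. -/
def TwistedSemisimple (θ : GL (Fin n) K →* GL (Fin n) K) (δ : GL (Fin n) K) : Prop :=
  ∃ g : GL (Fin n) K, PairStable ((MulAut.conj δ).toMonoidHom.comp θ) g

/-- A (`θ`-semisimple) element `δ` is strongly `θ`-regular if its twisted centralizer is abelian.
Used over an algebraically closed field. -/
def StronglyRegular (θ : GL (Fin n) K →* GL (Fin n) K) (δ : GL (Fin n) K) : Prop :=
  ∀ x ∈ twistedCentralizer θ δ, ∀ y ∈ twistedCentralizer θ δ, x * y = y * x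

/-- The quotient `T_θ = T / (1 - θ) T` (for a `θ`-stable torus `T`); as `T` is commutative, the
normal closure of `{s θ(s)⁻¹ | s ∈ T}` is that set itself. -/
abbrev Coinvariants (θ : GL (Fin n) K →* GL (Fin n) K) (T : Subgroup (GL (Fin n) K)) : Type _ :=
  T ⧸ Subgroup.normalClosure
    {x : T | ∃ s : T, (x : GL (Fin n) K) = (s : GL (Fin n) K) * (θ s)⁻¹}

end Groups

section Orthogonal

variable (m : ℕ) (K : Type*) [Field K]

/-- `SO_{2m+1}`, with respect to the symmetric form `w_{2m+1}`. -/
def SO : Subgroup (GL (Fin (2 * m + 1)) K) where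
  carrier := {g | g.valᵀ * wMat (2 * m + 1) K * g.val = wMat (2 * m + 1) K ∧ g.val.det = 1}
  one_mem' := ⟨by simp, by simp⟩
  mul_mem' {a b} ha hb := by
    obtain ⟨ha, ha'⟩ := ha
    obtain ⟨hb, hb'⟩ := hb
    refine ⟨?_, by rw [Units.val_mul, det_mul, ha', hb', one_mul]⟩
    rw [Units.val_mul, transpose_mul]
    calc _ = b.valᵀ * (a.valᵀ * wMat (2 * m + 1) K * a.val) * b.val := by
          simp only [Matrix.mul_assoc]
      _ = _ := by rw [ha, hb]
  inv_mem' {a} ha := by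
    obtain ⟨ha, ha'⟩ := ha
    have h1 : a.val * (a⁻¹).val = 1 := a.mul_inv
    refine ⟨?_, ?_⟩
    · calc (a⁻¹).valᵀ * wMat (2 * m + 1) K * (a⁻¹).val
          = (a⁻¹).valᵀ * (a.valᵀ * wMat (2 * m + 1) K * a.val) * (a⁻¹).val := by rw [ha]
        _ = (a.val * (a⁻¹).val)ᵀ * wMat (2 * m + 1) K * (a.val * (a⁻¹).val) := by
              rw [transpose_mul]; simp only [Matrix.mul_assoc]
        _ = _ := by rw [h1]; simp
    · have := congrArg Matrix.det h1
      rwa [det_mul, ha', one_mul, det_one] at this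

variable {m K}

theorem map_mem_SO {L : Type*} [Field L] (f : K →+* L) {g : GL (Fin (2 * m + 1)) K}
    (hg : g ∈ SO m K) : GeneralLinearGroup.map f g ∈ SO m L := by
  have h1 : g.valᵀ * wMat (2 * m + 1) K * g.val = wMat (2 * m + 1) K := hg.1
  have h2 : g.val.det = 1 := hg.2
  have hw : (wMat (2 * m + 1) K).map f = wMat (2 * m + 1) L := by
    ext i j
    simp [wMat, apply_ite f]
  have hv : (GeneralLinearGroup.map f g).val = g.val.map f := rfl
  refine ⟨?_, ?_⟩
  · rw [hv, ← hw, ← transpose_map, ← Matrix.map_mul, ← Matrix.map_mul, h1]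
  · rw [hv, show g.val.map f = f.mapMatrix g.val from rfl,
      ← RingHom.map_det, h2, map_one]

/-- The map `SO_{2m+1}(K) → SO_{2m+1}(L)` given by a homomorphism of fields `K → L`. -/
def soMap {L : Type*} [Field L] (f : K →+* L) (g : SO m K) : SO m L :=
  ⟨GeneralLinearGroup.map f g, map_mem_SO f g.2⟩

variable (m K) in
/-- The maximal split torus of diagonal elements of `SO_{2m+1}`. -/
def soDiagTorus : Subgroup (SO m K) := (diagTorus (2 * m + 1) K).comap (SO m K).subtype

/-- The embedding `φ` of `2m × 2m` matrices in `(2m+1) × (2m+1)` matrices: with blocks in `M_m`,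
`[A₁₁ A₁₂; A₂₁ A₂₂] ↦ [A₁₁ 0 A₁₂; 0 1 0; A₂₁ 0 A₂₂]`. -/
def phi (A : Matrix (Fin (2 * m)) (Fin (2 * m)) K) :
    Matrix (Fin (2 * m + 1)) (Fin (2 * m + 1)) K :=
  of fun i j =>
    match finSuccEquiv' (⟨m, by omega⟩ : Fin (2 * m + 1)) i,
      finSuccEquiv' (⟨m, by omega⟩ : Fin (2 * m + 1)) j with
    | some a, some b => A a b
    | none, none => 1
    | _, _ => 0

end Orthogonal

section NormCorrespondence

variable {m n : ℕ} {K : Type*} [Field K]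

/-- `X' = - w_{2m+1} ᵗX w_n`. -/
def primed (X : Matrix (Fin n) (Fin (2 * m + 1)) K) : Matrix (Fin (2 * m + 1)) (Fin n) K :=
  -(wMat (2 * m + 1) K * Xᵀ * wMat n K)

/-- The equation `Y + w_n ᵗY w_n = X X'`. -/
def IsSolution (X : Matrix (Fin n) (Fin (2 * m + 1)) K) (Y : Matrix (Fin n) (Fin n) K) : Prop :=
  Y + wMat n K * Yᵀ * wMat n K = X * primed X

variable (m) in
/-- The (elements of the) collection `𝒩` of `ε`-conjugacy classes `{Y⁻¹}` for which the equation
has a solution `(X, Y)`. -/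
def InN (γ' : GL (Fin n) K) : Prop :=
  ∃ X : Matrix (Fin n) (Fin (2 * m + 1)) K,
    IsSolution X ((γ'⁻¹ : GL (Fin n) K) : Matrix (Fin n) (Fin n) K)

variable (m) in
/-- The norm correspondence `N_ε`: the set of conjugacy classes in `SO_{2m+1}(K)` of the elements
`(-1)^n (I - X₁' Y₁⁻¹ X₁)`, for all solutions `(X₁, Y₁)` with `Y₁⁻¹` in the `ε`-conjugacy class of
`γ'`. -/
def normCorr (γ' : GL (Fin n) K) : Set (ConjClasses (SO m K)) :=
  {c | ∃ (X : Matrix (Fin n) (Fin (2 * m + 1)) K) (Y : GL (Fin n) K) (Z : SO m K),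
    IsSolution X (Y : Matrix (Fin n) (Fin n) K) ∧ TwistedConj (epsilon n K) γ' Y⁻¹ ∧
    ((Z : GL (Fin (2 * m + 1)) K) : Matrix _ _ K) =
      (-1 : K) ^ n • (1 - primed X * ((Y⁻¹ : GL (Fin n) K) : Matrix (Fin n) (Fin n) K) * X) ∧
    c = ConjClasses.mk Z}

end NormCorrespondence

section KottwitzShelstad

variable {m n : ℕ} {K : Type*} [Field K]

/-- The isomorphism `(T'₀)_{θ*} ≃ T₀` attached to the standard pairs of `GL_n` and of `SO_{2m+1}`,
for `n = 2m` or `n = 2m+1`, as a map on `T'₀`: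
`diag(a_1, …, a_n) ↦ diag(a_1/a_n, …, a_m/a_{n+1-m}, 1, a_{n+1-m}/a_m, …, a_n/a_1)`.
It is dual to the embedding `diag(x_1, …, x_m, x_m⁻¹, …, x_1⁻¹) ↦
diag(x_1, …, x_m, (1,) x_m⁻¹, …, x_1⁻¹)` of the torus of the dual group `Sp_{2m}(ℂ)` of `SO_{2m+1}`
in `GL_n(ℂ)`. -/
def stdTorusMap (hn : 2 * m ≤ n) (a : Fin n → Kˣ) (i : Fin (2 * m + 1)) : Kˣ :=
  if h : i.val < m then
    a ⟨i.val, by omega⟩ / a (Fin.rev ⟨i.val, by omega⟩)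
  else if h' : m < i.val then
    a (Fin.rev ⟨2 * m - i.val, by omega⟩) / a ⟨2 * m - i.val, by omega⟩
  else 1

/-- The image map `𝒜` of Kottwitz and Shelstad, from semisimple conjugacy classes of `SO_{2m+1}` to
`θ*`-conjugacy classes of `θ*`-semisimple elements of `GL_n`, over an algebraically closed field:
a conjugate of `γ` in the diagonal torus is lifted through the standard isomorphism
`(T'₀)_{θ*} ≃ T₀` to an element of `T'₀`, whose `θ*`-conjugacy class is `𝒜(γ)`. -/
def imageMap (hn : 2 * m ≤ n) (γ : SO m K) : Set (GL (Fin n) K) :=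
  {δ | ∃ a : Fin n → Kˣ,
    (∃ h : SO m K, ((h * γ * h⁻¹ : SO m K) : GL (Fin (2 * m + 1)) K) =
      diagGL (stdTorusMap hn a)) ∧
    TwistedConj (thetaStar n K) (diagGL a) δ}

end KottwitzShelstad

section Rational

variable {F : Type*} [Field F] {m n : ℕ}

/-- `GL_n(F) → GL_n(F̄)`. -/
def barGL (g : GL (Fin n) F) : GL (Fin n) (AlgebraicClosure F) :=
  GeneralLinearGroup.map (algebraMap F (AlgebraicClosure F)) g

/-- `SO_{2m+1}(F) → SO_{2m+1}(F̄)`. -/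
def barSO (g : SO m F) : SO m (AlgebraicClosure F) :=
  soMap (algebraMap F (AlgebraicClosure F)) g

/-- The action of the Galois group on `GL_n(F̄)`. -/
def galGL (σ : AlgebraicClosure F ≃ₐ[F] AlgebraicClosure F)
    (g : GL (Fin n) (AlgebraicClosure F)) : GL (Fin n) (AlgebraicClosure F) :=
  GeneralLinearGroup.map (σ : AlgebraicClosure F →+* AlgebraicClosure F) g

/-- The action of the Galois group on `SO_{2m+1}(F̄)`. -/
def galSO (σ : AlgebraicClosure F ≃ₐ[F] AlgebraicClosure F)
    (g : SO m (AlgebraicClosure F)) : SO m (AlgebraicClosure F) :=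
  soMap (σ : AlgebraicClosure F →+* AlgebraicClosure F) g

/-- The stable conjugacy class of `γ` in `SO_{2m+1}(F)`: the elements of `SO_{2m+1}(F)` that are
conjugate to `γ` in `SO_{2m+1}(F̄)`. -/
def stableClass (γ : SO m F) : Set (SO m F) := {γ₁ | IsConj (barSO γ) (barSO γ₁)}

/-- The norm map of Kottwitz and Shelstad for `(GL_n, θ*)` and `SO_{2m+1}`: the elements `γ` of
`SO_{2m+1}(F)` (a stable conjugacy class, for `δ` strongly `θ*`-regular) such that `𝒜(γ)` is the
`θ*`-conjugacy class of `δ` over `F̄`. -/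
def ksNorm (hn : 2 * m ≤ n) (δ : GL (Fin n) F) : Set (SO m F) :=
  {γ | barGL δ ∈ imageMap hn (barSO γ)}

/-- The norm map of Kottwitz and Shelstad for `(GL_n, ε)`: as `θ* = Int(g_θ) ∘ ε`, the map
`m(γ') = γ' g_θ⁻¹` takes `ε`-conjugacy classes to `θ*`-conjugacy classes, and the norm of `γ'` is
that of `m(γ')`. -/
def ksNormEpsilon (hn : 2 * m ≤ n) (γ' : GL (Fin n) F) : Set (SO m F) :=
  ksNorm hn (γ' * (gTheta n F)⁻¹)

/-- `T` is (the group of `F̄`-points of) a Cartan subgroup of `SO_{2m+1}` defined over `F`: a maximal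
torus, stable under the Galois group. -/
def IsCartanSO (T : Subgroup (SO m (AlgebraicClosure F))) : Prop :=
  (∃ h, T = conjSubgroup h (soDiagTorus m (AlgebraicClosure F))) ∧
    ∀ σ : AlgebraicClosure F ≃ₐ[F] AlgebraicClosure F, ∀ t ∈ T, galSO σ t ∈ T

/-- `T'` is (the group of `F̄`-points of) a Cartan subgroup of `GL_n` defined over `F`. -/
def IsCartanGL (T' : Subgroup (GL (Fin n) (AlgebraicClosure F))) : Prop :=
  (∃ g, T' = conjSubgroup g (diagTorus n (AlgebraicClosure F))) ∧
    ∀ σ : AlgebraicClosure F ≃ₐ[F] AlgebraicClosure F, ∀ t ∈ T', galGL σ t ∈ T'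

/-- `e : T'_{θ*} ≃ T` is an isomorphism defined over `F`, attached to a `θ*`-stable pair `(B', T')`
of `GL_n` and a pair `(B, T)` of `SO_{2m+1}`: it is obtained from the standard isomorphism
`(T'₀)_{θ*} ≃ T₀` by conjugating these pairs to the standard ones, and it commutes with the action
of the Galois group. -/
def IsAdmissible (hn : 2 * m ≤ n) (T : Subgroup (SO m (AlgebraicClosure F)))
    (T' : Subgroup (GL (Fin n) (AlgebraicClosure F)))
    (e : Coinvariants (thetaStar n (AlgebraicClosure F)) T' ≃* T) : Prop :=
  (∃ (g : GL (Fin n) (AlgebraicClosure F)) (h : SO m (AlgebraicClosure F)),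
    PairStable (thetaStar n (AlgebraicClosure F)) g ∧
    T' = conjSubgroup g (diagTorus n (AlgebraicClosure F)) ∧
    T = conjSubgroup h (soDiagTorus m (AlgebraicClosure F)) ∧
    ∀ (a : Fin n → (AlgebraicClosure F)ˣ) (t : T'),
      (t : GL (Fin n) (AlgebraicClosure F)) = g * diagGL a * g⁻¹ →
      ((h⁻¹ * (e (QuotientGroup.mk t) : SO m (AlgebraicClosure F)) * h :
        SO m (AlgebraicClosure F)) : GL (Fin (2 * m + 1)) (AlgebraicClosure F)) =
          diagGL (stdTorusMap hn a)) ∧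
  ∀ (σ : AlgebraicClosure F ≃ₐ[F] AlgebraicClosure F) (t t' : T'),
    (t' : GL (Fin n) (AlgebraicClosure F)) = galGL σ t →
    (e (QuotientGroup.mk t') : SO m (AlgebraicClosure F)) = galSO σ (e (QuotientGroup.mk t))

/-- What a Cartan subgroup `T'` of `GL_n` with an isomorphism `e : T'_{θ*} ≃ T` is to satisfy with
respect to a Cartan subgroup `T` of `SO_{2m+1}`. Here `ψ` is the map from `n × n` matrices to
`(2m+1) × (2m+1)` matrices used to compare (`φ` for `n = 2m`, the identity for `n = 2m+1`). -/
structure NormDiagram (hn : 2 * m ≤ n)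
    (ψ : Matrix (Fin n) (Fin n) (AlgebraicClosure F) →
      Matrix (Fin (2 * m + 1)) (Fin (2 * m + 1)) (AlgebraicClosure F))
    (T : Subgroup (SO m (AlgebraicClosure F)))
    (T' : Subgroup (GL (Fin n) (AlgebraicClosure F)))
    (e : Coinvariants (thetaStar n (AlgebraicClosure F)) T' ≃* T) : Prop where
  /-- `T'` is a Cartan subgroup of `GL_n` defined over `F`. -/
  cartan : IsCartanGL T'
  /-- `T'` is `θ*`-stable. -/
  stable : T'.map (thetaStar n (AlgebraicClosure F)) = T'
  /-- `e` is an isomorphism over `F`, attached to pairs containing `T'` and `T`. -/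
  admissible : IsAdmissible hn T T' e
  /-- The arrow `T' → T'_{θ*} ≃ T` is given by `N_{θ*}(t) = t θ*(t)`, up to conjugacy. -/
  norm_conj : ∀ t : T', ∃ P : GL (Fin (2 * m + 1)) (AlgebraicClosure F),
    (P : Matrix _ _ (AlgebraicClosure F)) *
        ((e (QuotientGroup.mk t) : SO m (AlgebraicClosure F)) : GL _ (AlgebraicClosure F)).val *
        ((P⁻¹ : GL _ (AlgebraicClosure F)) : Matrix _ _ (AlgebraicClosure F)) =
      ψ ((t : GL (Fin n) (AlgebraicClosure F)) * thetaStar n (AlgebraicClosure F) t :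
        GL (Fin n) (AlgebraicClosure F)).val
  /-- The diagram `N_ε ∘ m⁻¹ = N_{θ*}`, with `m⁻¹(t) = t g_θ`, commutes over `F̄`. -/
  commutes : ∀ t : T', StronglyRegular (thetaStar n (AlgebraicClosure F)) t →
    normCorr m ((t : GL (Fin n) (AlgebraicClosure F)) * gTheta n (AlgebraicClosure F)) =
      {ConjClasses.mk (e (QuotientGroup.mk t) : SO m (AlgebraicClosure F))}
  /-- The diagram commutes on `T'(F)`: the image of `δ` in `T` is in `T(F)`, and every class in
  `N_ε(δ g_θ)`, with `N_ε` taken over `F`, is stably conjugate to it. -/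
  commutes_rational : ∀ (δ : GL (Fin n) F) (t : T'),
    (t : GL (Fin n) (AlgebraicClosure F)) = barGL δ →
    StronglyRegular (thetaStar n (AlgebraicClosure F)) t →
    ∃ γ : SO m F, barSO γ = (e (QuotientGroup.mk t) : SO m (AlgebraicClosure F)) ∧
      ∀ γ₁ : SO m F, ConjClasses.mk γ₁ ∈ normCorr m (δ * gTheta n F) → γ₁ ∈ stableClass γ
  /-- `e` induces the image map: `𝒜` takes the class of `e(t)` to the `θ*`-class of `t`. -/
  induces : ∀ t : T', imageMap hn (e (QuotientGroup.mk t) : SO m (AlgebraicClosure F)) =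
    {δ | TwistedConj (thetaStar n (AlgebraicClosure F)) t δ}
  /-- `Cent_{θ*}(δ*) = (T')^{θ*}` for strongly `θ*`-regular `δ*` in `T'`. -/
  centralizer : ∀ t : T', StronglyRegular (thetaStar n (AlgebraicClosure F)) t →
    twistedCentralizer (thetaStar n (AlgebraicClosure F)) (t : GL (Fin n) (AlgebraicClosure F)) =
      T' ⊓ (thetaStar n (AlgebraicClosure F)).eqLocus (MonoidHom.id _)

end Rational

end TwistedNorm

end

/-! Everything reduces to linear algebra of the bilinear form B = δ u_n. Since θ*(g)⁻¹ u_n = u_n ᵗg,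
θ*-conjugacy of δ is congruence of B, and N(δ) = δ θ*(δ) is, up to the sign (-1)^(n+1), the
asymmetry B ᵗB⁻¹. Over an algebraically closed field of characteristic zero, forms with similar
asymmetries are congruent (`exists_congruence_of_isConj`), and elements of SO_{2m+1} that are
similar are conjugate in SO_{2m+1} (`SO_isConj_of_isConj`). Both facts come from a square root that
is a polynomial in the given matrix. Thus N(δ) up to similarity determines the θ*-class of δ.

A θ*-semisimple δ is θ*-conjugate to a diagonal element, where N and the standard isomorphism of
tori are compared entry by entry. Hence 𝒜 takes γ to the class of δ exactly when γ is similar to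
ψ(N(δ)), with ψ = φ or the identity (`Comparison.mem_imageMap_iff`); this is the second claim.

For the norm correspondence, put B = Y⁻¹ w_n and U = Y⁻¹ X. The equation (E) becomes B + ᵗB = -U w
ᵗU, and with C = w ᵗU ᵗB⁻¹ the element Z = (-1)^n (1 + C U) satisfies Z C = C N, where N =
(-1)^(n+1) B ᵗB⁻¹ (`cayley_mul`). Strong regularity makes B + ᵗB, hence U C, invertible, so that C
is injective. For n = 2m+1 it follows that Z is similar to N; for n = 2m a vector of ker U supplies
the extra eigenvalue 1 and Z is similar to φ(N). This yields the first claim and the commutative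
diagram.

For a Cartan subgroup T = h T₀ h⁻¹ one needs a θ*-fixed g whose Galois cocycle matches that of h. It
is enough to find a rational matrix r for which the columns of r h (the middle one vanishing if n =
2m) form a basis in which u_n is antidiagonal (`Comparison.exists_normDiagram_of_rational`): such an
r intertwines e(t) with N(t), and its rationality forces e to commute with Galois. For odd n a
diagonal r works. For even n, u_n is alternating; Galois descent provides a rational x in the Lie
algebra of T whose only zero eigenvalue is the middle one, and the skew matrix w x, of rank 2m, is
the pull-back of u_{2m} by a rational r. -/

noncomputable section

namespace TwistedNorm

/-! ### Square roots that are polynomials in the matrix -/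

section SquareRoots

open Polynomial

/-- An invertible matrix over an algebraically closed field of characteristic zero has a square
root that is a polynomial in it. -/
theorem exists_polynomial_sq {K ι : Type*} [Field K] [IsAlgClosed K] [CharZero K] [Fintype ι]
    [DecidableEq ι] (A : Matrix ι ι K) (hA : IsUnit A) :
    ∃ p : K[X], aeval A p * aeval A p = A := by
  classical
  obtain ⟨sq, hsq⟩ : ∃ sq : K → K, ∀ x, sq x * sq x = x :=
    ⟨fun x => (IsAlgClosed.exists_pow_nat_eq x two_pos).choose, fun x => by
      rw [← pow_two]; exact (IsAlgClosed.exists_pow_nat_eq x two_pos).choose_spec⟩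
  set q := Lagrange.interpolate A.charpoly.roots.toFinset id sq with hq
  have hqe : ∀ x ∈ A.charpoly.roots, q.eval x = sq x := fun x hx =>
    Lagrange.eval_interpolate_at_node (v := id) sq (Function.injective_id.injOn)
      (Multiset.mem_toFinset.2 hx)
  have hsplit : A.charpoly = (A.charpoly.roots.map fun a => X - C a).prod := by
    have := (IsAlgClosed.splits A.charpoly).eq_prod_roots
    rwa [A.charpoly_monic.leadingCoeff, C_1, one_mul] at this
  -- the polynomial `q ^ 2 - X` vanishes at the eigenvalues
  have hnil : IsNilpotent (aeval A (q ^ 2 - X)) := by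
    -- Raising to the number of roots, with multiplicity, gives each linear factor of the
    -- characteristic polynomial its own copy of q ^ 2 - X to divide.
    have hdvd : A.charpoly ∣ (q ^ 2 - X) ^ Multiset.card A.charpoly.roots := by
      nth_rw 1 [hsplit]
      rw [← Multiset.prod_replicate, ← Multiset.map_const']
      refine Multiset.prod_dvd_prod_of_dvd _ _ fun a ha => ?_
      rw [dvd_iff_isRoot, IsRoot, eval_sub, eval_pow, eval_X, hqe a ha, pow_two, hsq, sub_self]
    obtain ⟨r, hr⟩ := hdvd
    refine ⟨Multiset.card A.charpoly.roots, ?_⟩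
    rw [← map_pow, hr, map_mul, aeval_self_charpoly, zero_mul]
  -- Newton iteration needs a commutative ring, so q(A) is corrected to an exact square root inside
  -- K[A]; membership in K[A] is what makes the root a polynomial in A.
  let R := Algebra.adjoin K {A}
  let a : R := ⟨A, Algebra.self_mem_adjoin_singleton K A⟩
  have hinj : Function.Injective (Subalgebra.val R) := Subtype.val_injective
  let P : R[X] := X ^ 2 - C a
  have hnil' : IsNilpotent (aeval (aeval a q) P) := by
    rw [← IsNilpotent.map_iff hinj]
    have hcoe : R.val (aeval a q) = aeval A q := aeval_subalgebra_coe q R a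
    have h1 : R.val (aeval (aeval a q) P) = aeval A (q ^ 2 - X) := by
      have h2 : aeval (aeval a q) P = aeval a q ^ 2 - a := by simp [P]
      rw [h2, map_sub, map_pow, hcoe, map_sub, map_pow, aeval_X]
      rfl
    rw [h1]
    exact hnil
  have ha : IsUnit a := by
    have : IsArtinianRing R := IsArtinianRing.of_finite K R
    refine IsArtinianRing.isUnit_of_mem_nonZeroDivisors (mem_nonZeroDivisors_iff_right.2 ?_)
    intro x hx
    have hx' : (x : Matrix ι ι K) * A = 0 := congrArg Subtype.val hx
    exact Subtype.ext (hA.mul_left_eq_zero.1 hx')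
  -- The derivative of X ^ 2 - a at q(a) is 2 q(a), and q(a) ^ 2 is the unit a plus a nilpotent
  -- element.
  have hu : IsUnit (aeval (aeval a q) (derivative P)) := by
    have h1 : IsUnit (aeval a q ^ 2) := by
      have h2 : aeval a q ^ 2 = a + aeval (aeval a q) P := by simp [P]
      rw [h2]
      exact hnil'.isUnit_add_left_of_commute ha (Commute.all _ _)
    have h2 : aeval (aeval a q) (derivative P) = algebraMap K R 2 * aeval a q := by
      rw [map_ofNat]
      simp [P, one_add_one_eq_two]
    rw [h2]
    exact ((isUnit_iff_ne_zero.2 two_ne_zero).map (algebraMap K R)).mul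
      ((isUnit_pow_iff two_ne_zero).1 h1)
  obtain ⟨r, ⟨-, hr⟩, -⟩ := existsUnique_nilpotent_sub_and_aeval_eq_zero hnil' hu
  have hr2 : r * r = a := by
    simpa [P, sub_eq_zero, pow_two] using hr
  have hmem : (r : Matrix ι ι K) ∈ (aeval A : K[X] →ₐ[K] Matrix ι ι K).range := by
    rw [← Algebra.adjoin_singleton_eq_range_aeval]; exact r.2
  obtain ⟨p, hp⟩ := hmem
  refine ⟨p, ?_⟩
  have : aeval A p = (r : Matrix ι ι K) := hp
  rw [this]
  exact congrArg Subtype.val hr2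

end SquareRoots

/-! ### Congruence of bilinear forms and asymmetries -/

section Congruence

open Polynomial

theorem mul_aeval_eq_of_mul_eq {K R : Type*} [CommSemiring K] [Semiring R] [Algebra K R]
    {b x y : R} (h : b * x = y * b) (p : K[X]) : b * aeval x p = aeval y p * b := by
  induction p using Polynomial.induction_on' with
  | add p q hp hq => rw [map_add, map_add, mul_add, add_mul, hp, hq]
  | monomial k c =>
    have hk : b * x ^ k = y ^ k * b := SemiconjBy.pow_right (show SemiconjBy b x y from h) k
    rw [aeval_monomial, aeval_monomial, ← mul_assoc, ← Algebra.commutes, mul_assoc, hk, mul_assoc]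

theorem transpose_aeval {K ι : Type*} [CommRing K] [Fintype ι] [DecidableEq ι]
    (A : Matrix ι ι K) (p : K[X]) : (aeval A p)ᵀ = aeval Aᵀ p := by
  induction p using Polynomial.induction_on' with
  | add p q hp hq => rw [map_add, map_add, transpose_add, hp, hq]
  | monomial k c =>
    rw [aeval_monomial, aeval_monomial, transpose_mul, transpose_pow, Algebra.commutes,
      Matrix.algebraMap_eq_diagonal, diagonal_transpose]

variable {K ι : Type*} [Field K] [IsAlgClosed K] [CharZero K] [Fintype ι] [DecidableEq ι]

theorem isUnit_of_mul_self_isUnit {M : Type*} [Monoid M] {x y : M} (h : x * x = y)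
    (hy : IsUnit y) : IsUnit x := by
  rw [← h, ← pow_two] at hy
  exact (isUnit_pow_iff two_ne_zero).1 hy

/-- Invertible bilinear forms with the same asymmetry `A = B ᵗB⁻¹` are congruent. -/
theorem exists_congruence_of_asymmetry_eq {A B B' : Matrix ι ι K} (hB : IsUnit B)
    (hB' : IsUnit B') (h : B = A * Bᵀ) (h' : B' = A * B'ᵀ) :
    ∃ S : GL ι K, S.val * B * S.valᵀ = B' := by
  obtain ⟨b, rfl⟩ := hB
  obtain ⟨D, hD⟩ : ∃ D : Matrix ι ι K, D * b.val = B' := ⟨B' * (b⁻¹).val, by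
    rw [mul_assoc, b.inv_mul, mul_one]⟩
  have hDu : IsUnit D := by
    have : D = B' * (b⁻¹).val := by rw [← hD, mul_assoc, b.mul_inv, mul_one]
    rw [this]; exact hB'.mul (b⁻¹).isUnit
  obtain ⟨p, hp⟩ := exists_polynomial_sq D hDu
  -- Equality of the asymmetries says that D = B' B⁻¹ is self-adjoint for B. A polynomial square
  -- root S of D inherits this, so S B ᵗS = S S B = D B = B'.
  have hs : b.val * Dᵀ = D * b.val := by
    calc b.val * Dᵀ = A * (b.valᵀ * Dᵀ) := by nth_rw 1 [h]; rw [mul_assoc]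
      _ = A * B'ᵀ := by rw [← transpose_mul, hD]
      _ = D * b.val := by rw [← h', hD]
  obtain ⟨S, hS⟩ := isUnit_of_mul_self_isUnit hp hDu
  refine ⟨S, ?_⟩
  rw [hS, transpose_aeval, mul_assoc, mul_aeval_eq_of_mul_eq hs, ← mul_assoc, hp, hD]

/-- Invertible bilinear forms with similar asymmetries are congruent. -/
theorem exists_congruence_of_isConj (B B' : GL ι K)
    (h : IsConj (B.val * (B⁻¹).valᵀ) (B'.val * (B'⁻¹).valᵀ)) :
    ∃ S : GL ι K, S.val * B.val * S.valᵀ = B'.val := by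
  obtain ⟨P, hP⟩ := h
  have hP' : P.val * (B.val * (B⁻¹).valᵀ) = B'.val * (B'⁻¹).valᵀ * P.val := hP
  have hT : ∀ C : GL ι K, (C⁻¹).valᵀ * C.valᵀ = 1 := fun C => by
    rw [← transpose_mul, C.mul_inv, transpose_one]
  obtain ⟨S, hS⟩ := exists_congruence_of_asymmetry_eq (A := B'.val * (B'⁻¹).valᵀ)
    (B := P.val * B.val * P.valᵀ) (B' := B'.val)
    ((P.isUnit.mul B.isUnit).mul (by rw [Matrix.isUnit_transpose]; exact P.isUnit)) B'.isUnit
    (by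
      rw [transpose_mul, transpose_mul, transpose_transpose, ← mul_assoc, ← hP']
      calc P.val * B.val * P.valᵀ
          = P.val * B.val * ((B⁻¹).valᵀ * B.valᵀ) * P.valᵀ := by rw [hT, mul_one]
        _ = _ := by simp only [mul_assoc])
    (by rw [mul_assoc, hT, mul_one])
  refine ⟨S * P, ?_⟩
  rw [← hS, Units.val_mul, transpose_mul]
  simp only [mul_assoc]

end Congruence

/-! ### Conjugacy in the odd orthogonal group -/

section OrthogonalConjugacy

variable {K : Type*} [Field K] {m : ℕ}

theorem wMat_transpose {n : ℕ} : (wMat n K)ᵀ = wMat n K := by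
  ext i j
  simp only [wMat, transpose_apply, of_apply]
  congr 1
  rw [eq_iff_iff, ← Fin.rev_eq_iff, eq_comm]

theorem SO_val_mul_w {g : GL (Fin (2 * m + 1)) K} (hg : g ∈ SO m K) :
    g.val * wMat _ K * g.valᵀ = wMat _ K := by
  have h1 : g.valᵀ * wMat _ K * g.val = wMat _ K := hg.1
  have h2 : wMat _ K * g.valᵀ * wMat _ K * g.val = 1 := by
    rw [mul_assoc, mul_assoc, ← mul_assoc g.valᵀ, h1, wMat_mul_self]
  have h3 := mul_eq_one_comm.1 h2
  calc g.val * wMat _ K * g.valᵀ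
      = g.val * (wMat _ K * g.valᵀ * wMat _ K) * wMat _ K := by
        simp only [mul_assoc, wMat_mul_self, mul_one]
    _ = wMat _ K := by rw [h3, one_mul]

/-- An element of the orthogonal group, up to sign, is in `SO`, as the dimension is odd. -/
theorem exists_smul_mem_SO {g : Matrix (Fin (2 * m + 1)) (Fin (2 * m + 1)) K}
    (hg : gᵀ * wMat _ K * g = wMat _ K) :
    ∃ (z : SO m K) (c : K), c ≠ 0 ∧ z.1.val = c • g := by
  have hdet : g.det * g.det = 1 := by
    have h1 : (wMat (2 * m + 1) K).det * (wMat (2 * m + 1) K).det = 1 := by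
      rw [← det_mul, wMat_mul_self, det_one]
    have h2 := congrArg det hg
    rw [det_mul, det_mul, det_transpose] at h2
    have h3 : (wMat (2 * m + 1) K).det ≠ 0 := left_ne_zero_of_mul_eq_one h1
    apply mul_right_cancel₀ h3
    linear_combination h2
  have hne : g.det ≠ 0 := left_ne_zero_of_mul_eq_one hdet
  -- In odd dimension scaling by det g = ±1 changes the determinant to (det g) ^ (2m+2) = 1.
  have hd : (g.det • g).det = 1 := by
    rw [det_smul, Fintype.card_fin, pow_succ, pow_mul, pow_two, hdet, one_pow, one_mul, hdet]
  let z := GeneralLinearGroup.mkOfDetNeZero (g.det • g) (by rw [hd]; exact one_ne_zero)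
  refine ⟨⟨z, ?_, hd⟩, g.det, hne, rfl⟩
  change (g.det • g)ᵀ * wMat _ K * (g.det • g) = wMat _ K
  rw [transpose_smul, Matrix.smul_mul, Matrix.smul_mul, Matrix.mul_smul, smul_smul, hdet, one_smul,
    hg]

/-- Elements of `SO_{2m+1}` over an algebraically closed field that are conjugate in `GL_{2m+1}`
are conjugate in `SO_{2m+1}`. -/
theorem SO_isConj_of_isConj [IsAlgClosed K] [CharZero K] {x y : SO m K}
    (h : IsConj x.1.val y.1.val) : IsConj x y := by
  obtain ⟨P, hP⟩ := h
  have hP : P.val * x.1.val = y.1.val * P.val := hP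
  set w := wMat (2 * m + 1) K with hw
  have hww : w * w = 1 := wMat_mul_self
  have hwT : wᵀ = w := wMat_transpose
  have hx := SO_val_mul_w x.2
  have hy : y.1.valᵀ * w * y.1.val = w := y.2.1
  have hwu : IsUnit w := (wGL (2 * m + 1) K).isUnit
  -- Polar decomposition: A = P* P, with P* the adjoint for the form w. It commutes with x and is
  -- self-adjoint, hence so is its polynomial square root S, and O = P S⁻¹ is an isometry that still
  -- takes x to y.
  set A := w * P.valᵀ * w * P.val with hA
  have hAu : IsUnit A := ((hwu.mul (by
    rw [Matrix.isUnit_transpose]; exact P.isUnit)).mul hwu).mul P.isUnit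
  have hAx : A * x.1.val = x.1.val * A := by
    have h1 : P.valᵀ * w * y.1.val = w * x.1.val * w * P.valᵀ * w := by
      have h3 : x.1.valᵀ * P.valᵀ = P.valᵀ * y.1.valᵀ := by
        rw [← transpose_mul, hP, transpose_mul]
      calc P.valᵀ * w * y.1.val
          = w * (x.1.val * w * x.1.valᵀ) * P.valᵀ * w * y.1.val := by rw [hx, ← hw, hww, one_mul]
        _ = w * x.1.val * w * (x.1.valᵀ * P.valᵀ) * w * y.1.val := by simp only [mul_assoc]
        _ = w * x.1.val * w * P.valᵀ * (y.1.valᵀ * w * y.1.val) := by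
          rw [h3]; simp only [mul_assoc]
        _ = _ := by rw [hy]
    calc A * x.1.val = w * (P.valᵀ * w * (P.val * x.1.val)) := by simp only [hA, mul_assoc]
      _ = w * (P.valᵀ * w * y.1.val) * P.val := by rw [hP]; simp only [mul_assoc]
      _ = w * w * x.1.val * w * P.valᵀ * w * P.val := by rw [h1]; simp only [mul_assoc]
      _ = x.1.val * A := by rw [hww, one_mul, hA]; simp only [mul_assoc]
  have hAw : w * Aᵀ = A * w := by
    simp only [hA, transpose_mul, transpose_transpose, hwT, mul_assoc]
  obtain ⟨p, hp⟩ := exists_polynomial_sq A hAu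
  obtain ⟨S, hS⟩ := isUnit_of_mul_self_isUnit hp hAu
  have hSx : S.val * x.1.val = x.1.val * S.val := by
    rw [hS]; exact (mul_aeval_eq_of_mul_eq hAx.symm p).symm
  have hSw : w * S.valᵀ = S.val * w := by
    rw [hS, transpose_aeval, mul_aeval_eq_of_mul_eq hAw]
  rw [← hS] at hp
  set O := P.val * (S⁻¹).val with hO
  have hSi : (S⁻¹).val * S.val = 1 := S.inv_mul
  have hSi' : S.val * (S⁻¹).val = 1 := S.mul_inv
  have hOS : O * S.val = P.val := by rw [hO, mul_assoc, hSi, mul_one]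
  have hOx : O * x.1.val = y.1.val * O := by
    have h1 : x.1.val * (S⁻¹).val = (S⁻¹).val * x.1.val := by
      calc x.1.val * (S⁻¹).val = (S⁻¹).val * (S.val * x.1.val) * (S⁻¹).val := by
            rw [← mul_assoc (S⁻¹).val, hSi, one_mul]
        _ = (S⁻¹).val * x.1.val * (S.val * (S⁻¹).val) := by rw [hSx]; simp only [mul_assoc]
        _ = _ := by rw [hSi', mul_one]
    rw [hO, mul_assoc, ← h1, ← mul_assoc, hP, mul_assoc]
  have hOo : Oᵀ * w * O = w := by
    have h1 : S.valᵀ * (Oᵀ * w * O) * S.val = S.valᵀ * w * S.val := by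
      calc S.valᵀ * (Oᵀ * w * O) * S.val = (O * S.val)ᵀ * w * (O * S.val) := by
            rw [transpose_mul O S.val]; simp only [mul_assoc]
        _ = w * A := by
            rw [hOS, hA, ← mul_assoc, ← mul_assoc, ← mul_assoc, hww, one_mul]
        _ = w * S.val * S.val := by rw [mul_assoc, hp]
        _ = S.valᵀ * w * S.val := by
            congr 1
            calc w * S.val = w * (S.val * w) * w := by simp only [mul_assoc, hww, mul_one]
              _ = S.valᵀ * w := by rw [← hSw, ← mul_assoc, hww, one_mul]
    have hSt : IsUnit S.valᵀ := by rw [Matrix.isUnit_transpose]; exact S.isUnit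
    exact hSt.mul_left_cancel (S.isUnit.mul_right_cancel h1)
  obtain ⟨z, c, hc, hz⟩ := exists_smul_mem_SO hOo
  refine isConj_iff.2 ⟨z, mul_inv_eq_iff_eq_mul.2 (Subtype.ext (Units.ext ?_))⟩
  change z.1.val * x.1.val = y.1.val * z.1.val
  rw [hz, Matrix.smul_mul, hOx, Matrix.mul_smul]

end OrthogonalConjugacy

/-! ### Diagonal and antidiagonal matrices -/

section Diagonal

variable {n : ℕ} {K : Type*} [Field K]

theorem diagGL_val (a : Fin n → Kˣ) : (diagGL a).val = diagonal fun i => (a i : K) := rfl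

theorem diagGL_mul (a b : Fin n → Kˣ) : diagGL (a * b) = diagGL a * diagGL b := by
  apply Units.ext
  simp [diagGL, diagonal_mul_diagonal]

theorem diagGL_one : diagGL (1 : Fin n → Kˣ) = 1 := by
  apply Units.ext
  simp [diagGL]

theorem diagGL_inv (a : Fin n → Kˣ) : diagGL a⁻¹ = (diagGL a)⁻¹ :=
  eq_inv_of_mul_eq_one_left (by rw [← diagGL_mul, inv_mul_cancel, diagGL_one])

theorem diagGL_injective : Function.Injective (diagGL : (Fin n → Kˣ) → GL (Fin n) K) := by
  intro a b h
  funext i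
  have := congrFun (diagonal_injective (congrArg Units.val h)) i
  exact Units.ext this

/-- An invertible diagonal matrix lies in the diagonal torus. -/
theorem exists_diagGL_of_isDiag {x : GL (Fin n) K} (h : ∀ i j, i ≠ j → x.val i j = 0) :
    ∃ a, x = diagGL a := by
  have hx : x.val = diagonal fun i => x.val i i := by
    ext i j
    by_cases hij : i = j
    · subst hij; simp
    · rw [diagonal_apply_ne _ hij, h i j hij]
  have hne : ∀ i, x.val i i ≠ 0 := fun i hi => by
    have h1 := congrArg det (show x.val * (x⁻¹).val = 1 from x.mul_inv)
    rw [det_mul, hx, det_diagonal,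
      Finset.prod_eq_zero (f := fun i => x.val i i) (Finset.mem_univ i) hi, zero_mul, det_one] at h1
    exact zero_ne_one h1
  exact ⟨fun i => Units.mk0 _ (hne i), Units.ext (by rw [diagGL_val]; exact hx)⟩

theorem diagonal_mul_wMat_apply (f : Fin n → K) (i j : Fin n) :
    (diagonal f * wMat n K) i j = if j = i.rev then f i else 0 := by
  rw [diagonal_mul]; simp [wMat]

theorem wMat_mul_apply {o : Type*} (A : Matrix (Fin n) o K) (i : Fin n) (j : o) :
    (wMat n K * A) i j = A i.rev j := by
  simp [wMat, mul_apply]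

theorem mul_wMat_apply {o : Type*} (A : Matrix o (Fin n) K) (i : o) (j : Fin n) :
    (A * wMat n K) i j = A i j.rev := by
  have h : A * wMat n K = (wMat n K * Aᵀ)ᵀ := by
    rw [transpose_mul, transpose_transpose, wMat_transpose]
  rw [h, transpose_apply, wMat_mul_apply, transpose_apply]

theorem wMat_mul_diagonal_mul_wMat (f : Fin n → K) :
    wMat n K * diagonal f * wMat n K = diagonal fun i => f i.rev := by
  ext i j
  rw [mul_wMat_apply, wMat_mul_apply]
  by_cases h : i = j
  · subst h; simp
  · rw [diagonal_apply_ne _ h, diagonal_apply_ne _ fun h' => h (Fin.rev_injective h')]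

end Diagonal

/-! ### The involution θ*, its norm and twisted conjugacy -/

section ThetaStar

variable {n : ℕ} {K : Type*} [Field K]

/-- The sign `(-1) ^ (i + 1)`, the `i`-th diagonal entry of `g_θ`. -/
abbrev signTheta (K : Type*) [Field K] (i : Fin n) : K := (-1) ^ (i.val + 1)

theorem gTheta_val : (gTheta n K).val = diagonal (signTheta K) := by
  rw [gTheta, diagGL_val]
  congr 1

theorem signTheta_rev (i : Fin n) : signTheta K i.rev = (-1) ^ (n + 1) * signTheta K i := by
  have h : i.rev.val + 1 = n - i.val := by rw [Fin.val_rev]; omega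
  rw [signTheta, signTheta, h, ← pow_add]
  have h2 : n + 1 + (i.val + 1) = (n - i.val) + 2 * (i.val + 1) := by omega
  rw [h2, pow_add, pow_mul]
  simp

theorem signTheta_mul_self (i : Fin n) : signTheta K i * signTheta K i = 1 := by
  rw [signTheta, ← mul_pow]; simp

theorem uGL_val : (uGL n K).val = diagonal (signTheta K) * wMat n K := by
  rw [← gTheta_val]; rfl

theorem uGL_transpose : (uGL n K).valᵀ = (-1 : K) ^ (n + 1) • (uGL n K).val := by
  rw [uGL_val, transpose_mul, diagonal_transpose, wMat_transpose]
  ext i j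
  rw [wMat_mul_apply, Matrix.smul_apply, diagonal_mul_wMat_apply, smul_eq_mul]
  by_cases h : j = i.rev
  · rw [if_pos h, h, diagonal_apply_eq, signTheta_rev]
  · rw [if_neg h, diagonal_apply_ne _ fun h' => h h'.symm, mul_zero]

theorem neg_one_pow_mul_self (k : ℕ) : (-1 : K) ^ k * (-1) ^ k = 1 := by
  rw [← mul_pow]; simp

theorem uGL_mul_self : (uGL n K).val * (uGL n K).val = (-1 : K) ^ (n + 1) • 1 := by
  rw [uGL_val]
  have h : diagonal (signTheta K) * wMat n K * (diagonal (signTheta K) * wMat n K) =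
      diagonal (signTheta K) * (wMat n K * diagonal (signTheta K) * wMat n K) := by
    simp only [Matrix.mul_assoc]
  rw [h, wMat_mul_diagonal_mul_wMat, diagonal_mul_diagonal, ← diagonal_one, ← diagonal_smul]
  congr 1
  funext i
  rw [signTheta_rev, mul_left_comm, signTheta_mul_self]
  simp

theorem uGL_inv_val : ((uGL n K)⁻¹).val = (uGL n K).valᵀ := by
  have h : (uGL n K).val * (uGL n K).valᵀ = 1 := by
    rw [uGL_transpose, Matrix.mul_smul, uGL_mul_self, smul_smul, neg_one_pow_mul_self, one_smul]
  rw [← Matrix.one_mul (uGL n K).valᵀ, ← (uGL n K).inv_mul, Matrix.mul_assoc, h, Matrix.mul_one]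

theorem transposeInv_val (g : GL (Fin n) K) : (transposeInv g).val = (g⁻¹).valᵀ := rfl

theorem transposeInv_inv_val (g : GL (Fin n) K) : ((transposeInv g)⁻¹).val = g.valᵀ := rfl

theorem thetaStar_apply (g : GL (Fin n) K) :
    thetaStar n K g = uGL n K * transposeInv g * (uGL n K)⁻¹ := rfl

theorem epsilon_apply (g : GL (Fin n) K) :
    epsilon n K g = wGL n K * transposeInv g * (wGL n K)⁻¹ := rfl

theorem thetaStar_eq (g : GL (Fin n) K) :
    thetaStar n K g = gTheta n K * epsilon n K g * (gTheta n K)⁻¹ := by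
  rw [thetaStar_apply, epsilon_apply, uGL]; group

/-- This inverse-free form of θ* turns every statement on twisted conjugacy into one on the form δ
u_n. -/
theorem thetaStar_inv_mul_uGL (g : GL (Fin n) K) :
    ((thetaStar n K g)⁻¹).val * (uGL n K).val = (uGL n K).val * g.valᵀ := by
  have h : (thetaStar n K g)⁻¹ * uGL n K = uGL n K * (transposeInv g)⁻¹ := by
    rw [thetaStar_apply]; group
  have := congrArg Units.val h
  rwa [Units.val_mul, Units.val_mul, transposeInv_inv_val] at this

/-- `θ*(h) = g` amounts to an identity of matrices without inverses. -/
theorem thetaStar_eq_of_mul {g h : GL (Fin n) K}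
    (H : h.val * (uGL n K).val = (uGL n K).val * g.valᵀ) : thetaStar n K g = h⁻¹ := by
  rw [← _root_.inv_inj, inv_inv]
  apply Units.ext
  apply (uGL n K).isUnit.mul_right_cancel
  rw [H, thetaStar_inv_mul_uGL]

theorem thetaStar_thetaStar (g : GL (Fin n) K) : thetaStar n K (thetaStar n K g) = g := by
  rw [← inv_inv (thetaStar n K g), map_inv, inv_eq_iff_eq_inv]
  apply thetaStar_eq_of_mul
  have h := congrArg transpose (thetaStar_inv_mul_uGL g)
  rw [transpose_mul, transpose_mul, transpose_transpose, uGL_transpose] at h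
  simp only [Matrix.smul_mul, Matrix.mul_smul] at h
  have := congrArg (fun A => (-1 : K) ^ (n + 1) • A) h
  simp only [smul_smul, neg_one_pow_mul_self, one_smul] at this
  exact this.symm

theorem diagonal_mul_uGL_apply (f : Fin n → K) (i j : Fin n) :
    (diagonal f * (uGL n K).val) i j = if j = i.rev then f i * signTheta K i else 0 := by
  rw [uGL_val, ← Matrix.mul_assoc, diagonal_mul_diagonal, diagonal_mul_wMat_apply]

theorem thetaStar_diagGL (a : Fin n → Kˣ) :
    thetaStar n K (diagGL a) = diagGL fun i => (a i.rev)⁻¹ := by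
  have h : thetaStar n K (diagGL a) = (diagGL fun i => a i.rev)⁻¹ := by
    apply thetaStar_eq_of_mul
    ext i j
    rw [diagGL_val, diagGL_val, diagonal_transpose, diagonal_mul_uGL_apply, mul_diagonal, uGL_val,
      diagonal_mul_wMat_apply]
    split_ifs with h
    · rw [h, mul_comm]
    · rw [zero_mul]
  rw [h, ← diagGL_inv]; rfl

/-- `N_{θ*}(δ) = δ θ*(δ)`. -/
def normTheta (δ : GL (Fin n) K) : GL (Fin n) K := δ * thetaStar n K δ

theorem normTheta_diagGL (a : Fin n → Kˣ) :
    normTheta (diagGL a) = diagGL fun i => a i / a i.rev := by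
  rw [normTheta, thetaStar_diagGL, ← diagGL_mul]
  simp only [div_eq_mul_inv]
  rfl

/-- As θ* is an involution, the factor θ*(g)⁻¹ cancels against θ*(g) in the second half of the norm.
-/
theorem normTheta_mul_twist (g δ : GL (Fin n) K) :
    normTheta (g * δ * (thetaStar n K g)⁻¹) = g * normTheta δ * g⁻¹ := by
  simp only [normTheta, map_mul, map_inv, thetaStar_thetaStar]; group

/-- The norm of `δ` is the asymmetry of the form `δ u_n`, up to sign. -/
theorem normTheta_val (δ : GL (Fin n) K) :
    (normTheta δ).val =
      (-1 : K) ^ (n + 1) • ((δ * uGL n K).val * ((δ * uGL n K)⁻¹).valᵀ) := by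
  have h : ((δ * uGL n K)⁻¹).valᵀ = (-1 : K) ^ (n + 1) • ((δ⁻¹).valᵀ * ((uGL n K)⁻¹).val) := by
    rw [_root_.mul_inv_rev, Units.val_mul, transpose_mul, uGL_inv_val, uGL_transpose,
      transpose_smul, uGL_transpose, smul_smul, neg_one_pow_mul_self, one_smul, Matrix.mul_smul,
      smul_smul, neg_one_pow_mul_self, one_smul]
  rw [h, Matrix.mul_smul, smul_smul, neg_one_pow_mul_self, one_smul, normTheta, thetaStar_apply]
  simp only [Units.val_mul, transposeInv_val, Matrix.mul_assoc]

/-- Multiply on the right by u_n and move u_n past θ*(g)⁻¹, which becomes ᵗg. -/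
theorem twistedConj_iff_congruence {δ δ' : GL (Fin n) K} :
    TwistedConj (thetaStar n K) δ δ' ↔
      ∃ g : GL (Fin n) K, g.val * (δ * uGL n K).val * g.valᵀ = (δ' * uGL n K).val := by
  refine exists_congr fun g => ?_
  rw [← Units.val_inj, ← (uGL n K).isUnit.mul_left_inj]
  simp only [Units.val_mul, Matrix.mul_assoc, thetaStar_inv_mul_uGL]
  exact eq_comm

/-- Elements with similar norms are `θ*`-conjugate. -/
theorem twistedConj_of_isConj_normTheta [IsAlgClosed K] [CharZero K] {δ δ' : GL (Fin n) K}
    (h : IsConj (normTheta δ).val (normTheta δ').val) : TwistedConj (thetaStar n K) δ δ' := by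
  rw [twistedConj_iff_congruence]
  refine exists_congruence_of_isConj _ _ ?_
  obtain ⟨P, hP⟩ := h
  have hP : P.val * _ = _ * P.val := hP
  refine ⟨P, ?_⟩
  change P.val * _ = _ * P.val
  rw [normTheta_val, normTheta_val, Matrix.mul_smul, Matrix.smul_mul] at hP
  have := congrArg (fun A => (-1 : K) ^ (n + 1) • A) hP
  simp only [smul_smul, neg_one_pow_mul_self, one_smul] at this
  exact this

theorem TwistedConj.refl (θ : GL (Fin n) K →* GL (Fin n) K) (δ : GL (Fin n) K) :
    TwistedConj θ δ δ := ⟨1, by simp⟩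

theorem TwistedConj.symm {θ : GL (Fin n) K →* GL (Fin n) K} {δ δ' : GL (Fin n) K}
    (h : TwistedConj θ δ δ') : TwistedConj θ δ' δ := by
  obtain ⟨g, rfl⟩ := h
  exact ⟨g⁻¹, by rw [map_inv]; group⟩

theorem TwistedConj.trans {θ : GL (Fin n) K →* GL (Fin n) K} {δ δ' δ'' : GL (Fin n) K}
    (h : TwistedConj θ δ δ') (h' : TwistedConj θ δ' δ'') : TwistedConj θ δ δ'' := by
  obtain ⟨g, rfl⟩ := h
  obtain ⟨g', rfl⟩ := h'
  exact ⟨g' * g, by rw [map_mul]; group⟩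

theorem TwistedConj.isConj_normTheta {δ δ' : GL (Fin n) K}
    (h : TwistedConj (thetaStar n K) δ δ') : IsConj (normTheta δ).val (normTheta δ').val := by
  obtain ⟨g, rfl⟩ := h
  rw [normTheta_mul_twist]
  refine ⟨g, ?_⟩
  change g.val * _ = _ * g.val
  rw [← Units.val_mul, ← Units.val_mul, inv_mul_cancel_right]

/-- Because θ* = Int(g_θ) ∘ ε, the same g serves on both sides. -/
theorem twistedConj_epsilon_iff {γ γ' : GL (Fin n) K} :
    TwistedConj (epsilon n K) γ γ' ↔
      TwistedConj (thetaStar n K) (γ * (gTheta n K)⁻¹) (γ' * (gTheta n K)⁻¹) := by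
  refine exists_congr fun g => ?_
  rw [thetaStar_eq, ← mul_left_inj (gTheta n K)⁻¹]
  apply iff_of_eq
  congr 1
  group

theorem mem_twistedCentralizer {θ : GL (Fin n) K →* GL (Fin n) K} {δ x : GL (Fin n) K} :
    x ∈ twistedCentralizer θ δ ↔ x * δ * (θ x)⁻¹ = δ := Iff.rfl

theorem stronglyRegular_epsilon_iff {γ : GL (Fin n) K} :
    StronglyRegular (epsilon n K) γ ↔ StronglyRegular (thetaStar n K) (γ * (gTheta n K)⁻¹) := by
  have h : twistedCentralizer (epsilon n K) γ =
      twistedCentralizer (thetaStar n K) (γ * (gTheta n K)⁻¹) := by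
    ext g
    rw [mem_twistedCentralizer, mem_twistedCentralizer, thetaStar_eq,
      ← mul_left_inj (gTheta n K)⁻¹]
    apply iff_of_eq
    congr 1
    group
  rw [StronglyRegular, StronglyRegular, h]

theorem mem_twistedCentralizer_twist {θ : GL (Fin n) K →* GL (Fin n) K} {δ g x : GL (Fin n) K} :
    x ∈ twistedCentralizer θ (g * δ * (θ g)⁻¹) ↔ g⁻¹ * x * g ∈ twistedCentralizer θ δ := by
  rw [mem_twistedCentralizer, mem_twistedCentralizer, map_mul, map_mul, map_inv]
  constructor
  · intro h
    calc g⁻¹ * x * g * δ * ((θ g)⁻¹ * θ x * θ g)⁻¹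
        = g⁻¹ * (x * (g * δ * (θ g)⁻¹) * (θ x)⁻¹) * θ g := by group
      _ = δ := by rw [h]; group
  · intro h
    calc x * (g * δ * (θ g)⁻¹) * (θ x)⁻¹
        = g * (g⁻¹ * x * g * δ * ((θ g)⁻¹ * θ x * θ g)⁻¹) * (θ g)⁻¹ := by group
      _ = _ := by rw [h]

theorem StronglyRegular.of_twistedConj {θ : GL (Fin n) K →* GL (Fin n) K} {δ δ' : GL (Fin n) K}
    (h : StronglyRegular θ δ) (hc : TwistedConj θ δ δ') : StronglyRegular θ δ' := by
  obtain ⟨g, rfl⟩ := hc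
  intro x hx y hy
  rw [mem_twistedCentralizer_twist] at hx hy
  have := h _ hx _ hy
  have h2 : g * (g⁻¹ * x * g * (g⁻¹ * y * g)) * g⁻¹ = g * (g⁻¹ * y * g * (g⁻¹ * x * g)) * g⁻¹ := by
    rw [this]
  calc x * y = g * (g⁻¹ * x * g * (g⁻¹ * y * g)) * g⁻¹ := by group
    _ = _ := h2
    _ = y * x := by group

end ThetaStar

/-! ### Compatibility with field homomorphisms -/

section BaseChange

variable {n : ℕ} {K L : Type*} [Field K] [Field L] (f : K →+* L)

theorem map_wMat : (wMat n K).map f = wMat n L := by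
  ext i j
  simp [wMat, apply_ite f]

theorem mapGL_val (g : GL (Fin n) K) : (GeneralLinearGroup.map f g).val = g.val.map f := rfl

theorem map_gTheta : GeneralLinearGroup.map f (gTheta n K) = gTheta n L := by
  apply Units.ext
  rw [mapGL_val, gTheta_val, gTheta_val, diagonal_map (map_zero f)]
  congr 1
  funext i
  simp [signTheta]

theorem map_uGL : GeneralLinearGroup.map f (uGL n K) = uGL n L := by
  rw [uGL, map_mul, map_gTheta, uGL]
  congr 1
  apply Units.ext
  rw [mapGL_val]
  exact map_wMat f

theorem map_thetaStar (g : GL (Fin n) K) :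
    GeneralLinearGroup.map f (thetaStar n K g) = thetaStar n L (GeneralLinearGroup.map f g) := by
  rw [thetaStar_apply, thetaStar_apply, map_mul, map_mul, map_inv, map_uGL]
  congr 2

theorem map_normTheta (g : GL (Fin n) K) :
    GeneralLinearGroup.map f (normTheta g) = normTheta (GeneralLinearGroup.map f g) := by
  rw [normTheta, normTheta, map_mul, map_thetaStar]

theorem map_diagGL (a : Fin n → Kˣ) :
    GeneralLinearGroup.map f (diagGL a) = diagGL fun i => Units.map f.toMonoidHom (a i) := by
  apply Units.ext
  rw [mapGL_val, diagGL_val, diagGL_val, diagonal_map (map_zero f)]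
  rfl

end BaseChange

/-! ### Monomial matrices and a regular θ*-fixed diagonal element -/

section Monomial

variable {n : ℕ} {K : Type*} [Field K]

/-- Each row has at most one non-zero entry. -/
def IsRowMonomial {p q : Type*} (A : Matrix p q K) : Prop :=
  ∀ i j k, A i j ≠ 0 → A i k ≠ 0 → j = k

/-- A non-zero entry at (i, j) forces t j = t' i, and distinct entries of t leave one such j. -/
theorem isRowMonomial_of_mul_diagonal {p q : Type*} [Fintype p] [Fintype q] [DecidableEq p]
    [DecidableEq q] {A : Matrix p q K} {t : q → K} {t' : p → K}
    (h : A * diagonal t = diagonal t' * A) (ht : Function.Injective t) : IsRowMonomial A := by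
  have key : ∀ i j, A i j ≠ 0 → t j = t' i := fun i j hij => by
    have := congrFun (congrFun h i) j
    rw [mul_diagonal, diagonal_mul, mul_comm] at this
    exact mul_right_cancel₀ hij this
  intro i j k hj hk
  exact ht ((key i j hj).trans (key i k hk).symm)

theorem exists_row_ne_zero (x : GL (Fin n) K) (i : Fin n) : ∃ j, x.val i j ≠ 0 := by
  by_contra! h
  have h1 := congrFun (congrFun (show x.val * (x⁻¹).val = 1 from x.mul_inv) i) i
  rw [mul_apply, Finset.sum_eq_zero (fun j _ => by rw [h j, zero_mul]), one_apply_eq] at h1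
  exact zero_ne_one h1

theorem exists_col_ne_zero (x : GL (Fin n) K) (j : Fin n) : ∃ i, x.val i j ≠ 0 := by
  by_contra! h
  have h1 := congrFun (congrFun (show (x⁻¹).val * x.val = 1 from x.inv_mul) j) j
  rw [mul_apply, Finset.sum_eq_zero (fun i _ => by rw [h i, mul_zero]), one_apply_eq] at h1
  exact zero_ne_one h1

/-- An invertible row-monomial matrix normalizes the diagonal matrices. -/
theorem IsRowMonomial.exists_perm {x : GL (Fin n) K} (hx : IsRowMonomial x.val) :
    ∃ τ : Equiv.Perm (Fin n), (∀ i j, x.val i j ≠ 0 ↔ τ i = j) ∧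
      ∀ f : Fin n → K, x.val * diagonal f = (diagonal fun i => f (τ i)) * x.val := by
  choose τ hτ using exists_row_ne_zero x
  have h1 : ∀ i j, x.val i j ≠ 0 ↔ τ i = j :=
    fun i j => ⟨fun h => hx i _ _ (hτ i) h, fun h => h ▸ hτ i⟩
  have hs : Function.Surjective τ := fun j => by
    obtain ⟨i, hi⟩ := exists_col_ne_zero x j
    exact ⟨i, (h1 i j).1 hi⟩
  refine ⟨Equiv.ofBijective τ (Finite.surjective_iff_bijective.1 hs), h1, fun f => ?_⟩
  ext i j
  rw [mul_diagonal, diagonal_mul, mul_comm]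
  by_cases h : x.val i j = 0
  · rw [h, mul_zero, mul_zero]
  · rw [Equiv.ofBijective_apply, (h1 i j).1 h]

theorem IsRowMonomial.exists_mul_diagGL {x : GL (Fin n) K} (hx : IsRowMonomial x.val)
    (a : Fin n → Kˣ) : ∃ a', x * diagGL a * x⁻¹ = diagGL a' := by
  obtain ⟨τ, -, h⟩ := hx.exists_perm
  refine ⟨fun i => a (τ i), mul_inv_eq_iff_eq_mul.2 (Units.ext ?_)⟩
  exact h _

variable (n K) in
/-- An element of the diagonal torus with distinct entries that is fixed by `θ*`. -/
def regularDiag [CharZero K] : Fin n → Kˣ :=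
  fun i => Units.mk0 (2 : K) two_ne_zero ^ ((n : ℤ) - 1 - 2 * i.val)

variable [CharZero K]

theorem regularDiag_injective : Function.Injective fun i => (regularDiag n K i : K) := by
  intro i j h
  have h1 : (((2 : ℚ) ^ ((n : ℤ) - 1 - 2 * i.val) : ℚ) : K) =
      (((2 : ℚ) ^ ((n : ℤ) - 1 - 2 * j.val) : ℚ) : K) := by
    simpa [regularDiag] using h
  have h2 := zpow_right_injective₀ (by norm_num : (0 : ℚ) < 2) (by norm_num)
    (Rat.cast_injective h1)
  apply Fin.ext
  omega

theorem regularDiag_rev (i : Fin n) : regularDiag n K i.rev = (regularDiag n K i)⁻¹ := by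
  rw [regularDiag, regularDiag, ← _root_.zpow_neg]
  congr 1
  rw [Fin.val_rev]
  omega

theorem thetaStar_regularDiag :
    thetaStar n K (diagGL (regularDiag n K)) = diagGL (regularDiag n K) := by
  rw [thetaStar_diagGL]
  congr 1
  funext i
  rw [regularDiag_rev, inv_inv]

theorem map_regularDiag {L : Type*} [Field L] [CharZero L] (f : K →+* L) :
    GeneralLinearGroup.map f (diagGL (regularDiag n K)) = diagGL (regularDiag n L) := by
  rw [map_diagGL]
  congr 1
  funext i
  apply Units.ext
  simp [regularDiag, map_ofNat f]

/-- A matrix that commutes with a diagonal matrix with distinct entries is diagonal. -/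
theorem exists_diagGL_of_commute_regularDiag {x : GL (Fin n) K}
    (h : x * diagGL (regularDiag n K) = diagGL (regularDiag n K) * x) : ∃ a, x = diagGL a := by
  refine exists_diagGL_of_isDiag fun i j hij => ?_
  by_contra hx
  have h1 := congrArg Units.val h
  have := congrFun (congrFun h1 i) j
  rw [Units.val_mul, Units.val_mul, diagGL_val, mul_diagonal, diagonal_mul, mul_comm] at this
  exact hij (regularDiag_injective (mul_right_cancel₀ hx this)).symm

end Monomial

/-! ### θ*-semisimple elements are θ*-conjugate to diagonal ones -/

section Semisimple

variable {n : ℕ} {K : Type*} [Field K]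

theorem thetaStar_apply_mul (g : GL (Fin n) K) (i k : Fin n) :
    (thetaStar n K g).val i k * signTheta K k = signTheta K i * (g⁻¹).val k.rev i.rev := by
  have h : (thetaStar n K g).val * (uGL n K).val = (uGL n K).val * (g⁻¹).valᵀ := by
    rw [← thetaStar_inv_mul_uGL, map_inv, inv_inv]
  have := congrFun (congrFun h i) k.rev
  rwa [uGL_val, ← Matrix.mul_assoc, mul_wMat_apply, Fin.rev_rev, mul_diagonal, Matrix.mul_assoc,
    diagonal_mul, wMat_mul_apply, transpose_apply] at this

theorem thetaStar_mem_upperBorel {b : GL (Fin n) K} (hb : b ∈ upperBorel n K) :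
    thetaStar n K b ∈ upperBorel n K := by
  intro i j hij
  have hb' : (b⁻¹).val.BlockTriangular id := (upperBorel n K).inv_mem hb
  have h := thetaStar_apply_mul b i j
  rw [hb' (show id i.rev < id j.rev from Fin.rev_lt_rev.2 hij), mul_zero] at h
  exact (mul_eq_zero.1 h).resolve_right
    (left_ne_zero_of_mul_eq_one (signTheta_mul_self j))

/-- The transvection `1 + E_{ij}`. -/
def transvectionGL (i j : Fin n) (h : i ≠ j) : GL (Fin n) K :=
  GeneralLinearGroup.mkOfDetNeZero (transvection i j 1)
    (by rw [det_transvection_of_ne i j h]; exact one_ne_zero)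

theorem transvectionGL_val (i j : Fin n) (h : i ≠ j) :
    (transvectionGL i j h : GL (Fin n) K).val = transvection i j 1 := rfl

theorem mem_conjSubgroup {G : Type*} [Group G] {g x : G} {H : Subgroup G} :
    x ∈ conjSubgroup g H ↔ g⁻¹ * x * g ∈ H := by
  constructor
  · rintro ⟨y, hy, rfl⟩
    simpa [mul_assoc] using hy
  · intro h
    exact ⟨_, h, by simp [mul_assoc]⟩

/-- Transports stability of the conjugate g H g⁻¹ under Int(δ) ∘ θ to the standard subgroup H, at
the cost of replacing δ by g⁻¹ δ θ(g). -/
theorem conj_mem_of_map_eq {G : Type*} [Group G] {δ g x : G} {θ : G →* G} {H : Subgroup G}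
    (h : (conjSubgroup g H).map ((MulAut.conj δ).toMonoidHom.comp θ) = conjSubgroup g H)
    (hx : x ∈ H) : (g⁻¹ * δ * θ g) * θ x * (g⁻¹ * δ * θ g)⁻¹ ∈ H := by
  have h1 : ((MulAut.conj δ).toMonoidHom.comp θ) (g * x * g⁻¹) ∈ conjSubgroup g H := by
    rw [← h]
    exact Subgroup.mem_map_of_mem _ ⟨x, hx, rfl⟩
  rw [mem_conjSubgroup] at h1
  convert h1 using 1
  simp [mul_assoc]

/-- A `θ*`-semisimple element is `θ*`-conjugate to an element of the diagonal torus. -/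
theorem exists_diagGL_of_twistedSemisimple [CharZero K] {δ : GL (Fin n) K}
    (h : TwistedSemisimple (thetaStar n K) δ) :
    ∃ a, TwistedConj (thetaStar n K) (diagGL a) δ := by
  obtain ⟨g, hB, hT⟩ := h
  set x := g⁻¹ * δ * thetaStar n K g with hx
  have hxδ : δ = g * x * (thetaStar n K g)⁻¹ := by rw [hx]; group
  suffices ∃ a, x = diagGL a by
    obtain ⟨a, ha⟩ := this
    exact ⟨a, g, by rw [← ha, hxδ]⟩
  -- Stability of the torus is tested on a single element, fixed by θ* and with distinct entries.
  have hmono : IsRowMonomial x.val := by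
    obtain ⟨a, ha⟩ := conj_mem_of_map_eq hT ⟨regularDiag n K, rfl⟩
    have ha : diagGL a = _ := ha
    refine isRowMonomial_of_mul_diagonal (t' := fun i => (a i : K)) ?_ regularDiag_injective
    have h1 : x * diagGL (regularDiag n K) = diagGL a * x := by
      rw [ha, ← hx, inv_mul_cancel_right]
      congr 1
      exact thetaStar_regularDiag.symm
    exact congrArg Units.val h1
  -- Every b in the Borel subgroup is θ* of an element of it, so conjugation by x alone preserves
  -- the Borel subgroup.
  have hborel : ∀ b ∈ upperBorel n K, x * b * x⁻¹ ∈ upperBorel n K := fun b hb => by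
    have := conj_mem_of_map_eq hB (thetaStar_mem_upperBorel hb)
    rwa [thetaStar_thetaStar] at this
  obtain ⟨τ, hτ, -⟩ := hmono.exists_perm
  -- The Weyl element of x must be trivial: if τ⁻¹ reversed j < k, conjugating 1 + E_{jk} by x would
  -- produce a non-zero entry below the diagonal.
  have hlt : StrictMono τ.symm := by
    intro j k hjk
    refine lt_of_le_of_ne ?_ fun h => hjk.ne (τ.symm.injective h)
    have hb : transvectionGL j k hjk.ne ∈ upperBorel n K := by
      intro p q hpq
      have hpq : q < p := hpq
      rw [transvectionGL_val, transvection, Matrix.add_apply, one_apply_ne hpq.ne', zero_add,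
        single_apply_of_ne]
      rintro ⟨rfl, rfl⟩
      exact absurd hpq hjk.asymm
    have hc := hborel _ hb
    set c := x * transvectionGL j k hjk.ne * x⁻¹ with hcdef
    have hcx : c.val * x.val = x.val * transvection j k 1 := by
      rw [← transvectionGL_val j k hjk.ne, ← Units.val_mul, ← Units.val_mul, hcdef,
        inv_mul_cancel_right]
    have h1 := congrFun (congrFun hcx (τ.symm j)) k
    rw [mul_transvection_apply_same, one_mul] at h1
    by_contra! hlt
    have h2 : (c.val * x.val) (τ.symm j) k = 0 := by
      rw [mul_apply]
      refine Finset.sum_eq_zero fun l _ => ?_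
      by_cases hl : x.val l k = 0
      · rw [hl, mul_zero]
      · have : l = τ.symm k := by rw [← (hτ l k).1 hl, Equiv.symm_apply_apply]
        rw [this, hc hlt, zero_mul]
    have h3 : x.val (τ.symm j) k = 0 := by
      by_contra h
      have := (hτ _ _).1 h
      rw [Equiv.apply_symm_apply] at this
      exact hjk.ne this
    rw [h2, h3, zero_add] at h1
    exact (hτ (τ.symm j) j).2 (Equiv.apply_symm_apply _ _) h1.symm
  have hid : ⇑τ.symm = id := (hlt.range_inj strictMono_id).1 (by simp)
  refine exists_diagGL_of_isDiag fun i j hij => ?_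
  by_contra h
  have := (hτ i j).1 h
  rw [← Equiv.eq_symm_apply, hid] at this
  exact hij this

theorem conj_comp_epsilon (γ : GL (Fin n) K) :
    (MulAut.conj γ).toMonoidHom.comp (epsilon n K) =
      (MulAut.conj (γ * (gTheta n K)⁻¹)).toMonoidHom.comp (thetaStar n K) := by
  ext1 g
  simp [thetaStar_eq, mul_assoc]

theorem twistedSemisimple_epsilon_iff {γ : GL (Fin n) K} :
    TwistedSemisimple (epsilon n K) γ ↔
      TwistedSemisimple (thetaStar n K) (γ * (gTheta n K)⁻¹) := by
  rw [TwistedSemisimple, TwistedSemisimple, conj_comp_epsilon]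

end Semisimple

/-! ### Strong regularity and the symmetric part of the form -/

section Regular

variable {n : ℕ} {K : Type*} [Field K]

theorem mem_twistedCentralizer_of_congruence {δ x : GL (Fin n) K}
    (h : x.val * (δ * uGL n K).val * x.valᵀ = (δ * uGL n K).val) :
    x ∈ twistedCentralizer (thetaStar n K) δ := by
  rw [mem_twistedCentralizer]
  apply Units.ext
  apply (uGL n K).isUnit.mul_right_cancel
  rw [← Units.val_mul δ, ← h]
  simp only [Units.val_mul, Matrix.mul_assoc, thetaStar_inv_mul_uGL]

theorem diagGL_mul_uGL_val (a : Fin n → Kˣ) :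
    (diagGL a * uGL n K).val = of fun i j => if j = i.rev then a i * signTheta K i else 0 := by
  ext i j
  rw [Units.val_mul, diagGL_val, diagonal_mul_uGL_apply]
  rfl

variable [CharZero K]

/-- The twisted centralizer of a strongly regular element of the diagonal torus is diagonal. -/
theorem StronglyRegular.exists_diagGL {a : Fin n → Kˣ}
    (h : StronglyRegular (thetaStar n K) (diagGL a)) {x : GL (Fin n) K}
    (hx : x ∈ twistedCentralizer (thetaStar n K) (diagGL a)) : ∃ b, x = diagGL b := by
  refine exists_diagGL_of_commute_regularDiag (h x hx _ ?_)
  rw [mem_twistedCentralizer, thetaStar_regularDiag, ← diagGL_mul, mul_comm, diagGL_mul,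
    mul_inv_cancel_right]

/-- The form attached to a strongly regular element of the diagonal torus has a nondegenerate
symmetric part: otherwise it would have an alternating block, with isometry group `SL_2`. -/
theorem StronglyRegular.isUnit_form_add_transpose_of_diagGL {a : Fin n → Kˣ}
    (h : StronglyRegular (thetaStar n K) (diagGL a)) :
    IsUnit ((diagGL a * uGL n K).val + (diagGL a * uGL n K).valᵀ) := by
  have hs : ∀ i : Fin n, (a i : K) * signTheta K i ≠ 0 := fun i =>
    mul_ne_zero (a i).ne_zero (left_ne_zero_of_mul_eq_one (signTheta_mul_self i))
  have hne : ∀ i : Fin n, (a i : K) * signTheta K i + a i.rev * signTheta K i.rev ≠ 0 := by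
    intro i hi
    -- At a middle index the sum is 2 a_i times a sign, non-zero in characteristic zero. Elsewhere
    -- its vanishing makes the form alternating on the plane of i and its reversal.
    by_cases hir : i = i.rev
    · rw [← hir, ← two_mul] at hi
      exact (mul_ne_zero two_ne_zero (hs i)) hi
    -- A transvection in that plane is an isometry of the form, hence lies in the twisted
    -- centralizer, but it is not diagonal.
    have hx : transvectionGL i i.rev hir ∈ twistedCentralizer (thetaStar n K) (diagGL a) := by
      apply mem_twistedCentralizer_of_congruence
      rw [transvectionGL_val, diagGL_mul_uGL_val]
      have ht : (transvection i i.rev (1 : K))ᵀ = transvection i.rev i 1 := by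
        rw [transvection, transvection, transpose_add, transpose_one, transpose_single]
      rw [ht]
      ext p q
      by_cases hq : q = i
      · subst hq
        rw [mul_transvection_apply_same]
        by_cases hp : p = q
        · subst hp
          rw [transvection_mul_apply_same, transvection_mul_apply_same]
          simp [hir, Ne.symm hir]
          linear_combination hi
        · rw [transvection_mul_apply_of_ne _ _ _ _ hp, transvection_mul_apply_of_ne _ _ _ _ hp]
          simp [Fin.rev_inj, Ne.symm hp]
      · rw [mul_transvection_apply_of_ne _ _ _ _ hq]
        by_cases hp : p = i
        · subst hp
          rw [transvection_mul_apply_same]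
          simp [hq]
        · rw [transvection_mul_apply_of_ne _ _ _ _ hp]
    obtain ⟨b, hb⟩ := h.exists_diagGL hx
    have h1 := congrArg Units.val hb
    have := congrFun (congrFun h1 i) i.rev
    rw [transvectionGL_val, diagGL_val, diagonal_apply_ne _ hir, transvection, Matrix.add_apply,
      one_apply_ne hir, single_apply_same, zero_add] at this
    exact one_ne_zero this
  have heq : (diagGL a * uGL n K).val + (diagGL a * uGL n K).valᵀ =
      (diagGL fun i => Units.mk0 _ (hne i)).val * (wGL n K).val := by
    ext i j
    rw [diagGL_val, show (wGL n K).val = wMat n K from rfl, diagonal_mul_wMat_apply,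
      diagGL_mul_uGL_val, Matrix.add_apply, transpose_apply, of_apply,
      of_apply]
    by_cases hj : j = i.rev
    · subst hj
      simp
    · have hj' : i ≠ j.rev := fun h => hj (by rw [h, Fin.rev_rev])
      simp [hj, hj']
  rw [heq]
  exact (Units.isUnit _).mul (Units.isUnit _)

/-- The symmetric part is carried along by congruence, so the diagonal case suffices. -/
theorem isUnit_form_add_transpose {a : Fin n → Kˣ} {δ : GL (Fin n) K}
    (h : StronglyRegular (thetaStar n K) δ)
    (hc : TwistedConj (thetaStar n K) (diagGL a) δ) :
    IsUnit ((δ * uGL n K).val + (δ * uGL n K).valᵀ) := by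
  obtain ⟨g, hg⟩ := twistedConj_iff_congruence.1 hc
  have h1 : (δ * uGL n K).val + (δ * uGL n K).valᵀ =
      g.val * ((diagGL a * uGL n K).val + (diagGL a * uGL n K).valᵀ) * g.valᵀ := by
    rw [← hg, transpose_mul, transpose_mul, transpose_transpose, mul_add, add_mul]
    simp only [Matrix.mul_assoc]
  rw [h1]
  refine (g.isUnit.mul (h.of_twistedConj hc.symm).isUnit_form_add_transpose_of_diagGL).mul ?_
  rw [Matrix.isUnit_transpose]
  exact g.isUnit

end Regular

/-! ### Similarity of diagonal matrices -/

section DiagonalSimilarity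

open Polynomial

/-- Equal multisets of values have fibres of equal size, and bijections of the fibres glue. -/
theorem exists_perm_of_map_eq {α β : Type*} [Fintype α] {f g : α → β}
    (h : (Finset.univ.val : Multiset α).map f = Finset.univ.val.map g) :
    ∃ σ : Equiv.Perm α, ∀ a, g (σ a) = f a := by
  classical
  have hc : ∀ c, Fintype.card {a // f a = c} = Fintype.card {a // g a = c} := fun c => by
    have := congrArg (Multiset.count c) h
    rw [Multiset.count_map, Multiset.count_map] at this
    rw [Fintype.card_subtype, Fintype.card_subtype]
    simp only [eq_comm (a := c)] at this
    exact this
  exact ⟨Equiv.ofFiberEquiv fun c => Fintype.equivOfCardEq (hc c),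
    fun a => Equiv.ofFiberEquiv_map _ a⟩

variable {K : Type*} [Field K]

theorem charpoly_eq_of_isConj {ι : Type*} [Fintype ι] [DecidableEq ι] {A B : Matrix ι ι K}
    (h : IsConj A B) : A.charpoly = B.charpoly := by
  obtain ⟨P, hP⟩ := h
  have hP : P.val * A = B * P.val := hP
  have h1 : A = (P⁻¹).val * (B * P.val) := by rw [← hP, ← mul_assoc, P.inv_mul, one_mul]
  rw [h1, charpoly_mul_comm, mul_assoc, P.mul_inv, mul_one]

/-- Diagonal matrices with the same characteristic polynomial are similar. -/
theorem isConj_diagonal_of_prod_eq {ι : Type*} [Fintype ι] [DecidableEq ι] {f g : ι → K}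
    (h : ∏ i, (X - C (f i)) = ∏ i, (X - C (g i))) : IsConj (diagonal f) (diagonal g) := by
  have hr : ∀ f : ι → K, ((Finset.univ.val : Multiset ι).map f) = (∏ i, (X - C (f i))).roots :=
    fun f => by
      rw [← roots_multiset_prod_X_sub_C ((Finset.univ.val : Multiset ι).map f), Multiset.map_map]
      rfl
  obtain ⟨σ, hσ⟩ := exists_perm_of_map_eq (f := f) (g := g) (by rw [hr, hr, h])
  have hu : IsUnit (Equiv.Perm.permMatrix K σ.symm) := by
    rw [Matrix.isUnit_iff_isUnit_det, det_permutation]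
    exact ((Units.isUnit _).map (Int.castRingHom K))
  obtain ⟨P, hP⟩ := hu
  refine ⟨P, ?_⟩
  change P.val * _ = _ * P.val
  rw [hP]
  ext i j
  rw [mul_diagonal, diagonal_mul, Equiv.Perm.permMatrix, PEquiv.toMatrix_apply]
  split_ifs with h1
  · have : σ.symm i = j := by simpa using h1
    rw [← this, ← hσ, Equiv.apply_symm_apply, mul_comm]
  · simp

end DiagonalSimilarity

/-! ### Comparing n × n with (2m+1) × (2m+1) matrices -/

section Comparison

variable {m n : ℕ} {K : Type*} [Field K]

/-- The data that compare `n × n` matrices with `(2m+1) × (2m+1)` matrices: a multiplicative map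
`ψ` and an embedding `ι` of the indices, compatible with the standard isomorphism of tori and with
the norm correspondence. -/
structure Comparison (hn : 2 * m ≤ n)
    (ψ : Matrix (Fin n) (Fin n) K → Matrix (Fin (2 * m + 1)) (Fin (2 * m + 1)) K)
    (ι : Fin n → Fin (2 * m + 1)) : Prop where
  inj : Function.Injective ι
  rev : ∀ i, ι i.rev = (ι i).rev
  range : ∀ j : Fin (2 * m + 1), j.val ≠ m → ∃ i, ι i = j
  std : ∀ (a : Fin n → Kˣ) i, stdTorusMap hn a (ι i) = a i / a i.rev
  map_one : ψ 1 = 1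
  map_mul : ∀ A B, ψ (A * B) = ψ A * ψ B
  map_diagonal : ∀ a : Fin n → Kˣ, ψ (diagonal fun i => ((a i / a i.rev : Kˣ) : K)) =
    diagonal fun i => (stdTorusMap hn a i : K)
  similar : ∀ f f' : Fin n → K, IsConj (ψ (diagonal f)) (ψ (diagonal f')) →
    IsConj (diagonal f) (diagonal f')
  norm : ∀ (U : Matrix (Fin n) (Fin (2 * m + 1)) K) (B : GL (Fin n) K),
    B.val + B.valᵀ = -(U * wMat (2 * m + 1) K * Uᵀ) → IsUnit (B.val + B.valᵀ) →
    IsConj ((-1 : K) ^ n • (1 + wMat (2 * m + 1) K * Uᵀ * (B⁻¹).valᵀ * U))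
      (ψ ((-1 : K) ^ (n + 1) • (B.val * (B⁻¹).valᵀ)))

/-- With C = w ᵗU ᵗB⁻¹, the hypothesis gives U C = -(B ᵗB⁻¹ + 1), so (1 + C U) C = C (1 + U C) = -C
B ᵗB⁻¹. Thus C intertwines the element of the norm correspondence with the norm. -/
theorem cayley_mul {U : Matrix (Fin n) (Fin (2 * m + 1)) K} {B : GL (Fin n) K}
    (h : B.val + B.valᵀ = -(U * wMat (2 * m + 1) K * Uᵀ)) :
    ((-1 : K) ^ n • (1 + wMat (2 * m + 1) K * Uᵀ * (B⁻¹).valᵀ * U)) * (wMat (2 * m + 1) K * Uᵀ *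
        (B⁻¹).valᵀ) =
      wMat (2 * m + 1) K * Uᵀ * (B⁻¹).valᵀ * ((-1 : K) ^ (n + 1) • (B.val * (B⁻¹).valᵀ)) := by
  have hT : B.valᵀ * (B⁻¹).valᵀ = 1 := by rw [← transpose_mul, B.inv_mul, transpose_one]
  have h1 : U * wMat (2 * m + 1) K * Uᵀ * (B⁻¹).valᵀ = -(B.val * (B⁻¹).valᵀ + 1) := by
    rw [← neg_eq_iff_eq_neg.2 h, Matrix.neg_mul, Matrix.add_mul, hT]
  have h2 : wMat (2 * m + 1) K * Uᵀ * (B⁻¹).valᵀ * U * (wMat (2 * m + 1) K * Uᵀ * (B⁻¹).valᵀ) =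
      wMat (2 * m + 1) K * Uᵀ * (B⁻¹).valᵀ * -(B.val * (B⁻¹).valᵀ + 1) := by
    rw [← h1]; simp only [Matrix.mul_assoc]
  rw [Matrix.smul_mul, Matrix.add_mul, h2, Matrix.mul_smul, Matrix.one_mul, Matrix.mul_neg,
    Matrix.mul_add, Matrix.mul_one, pow_succ]
  simp only [mul_neg, mul_one, neg_smul, ← smul_neg]
  congr 1
  abel

/-- U C is -(B + ᵗB) ᵗB⁻¹. This is where strong regularity enters, and it makes C injective. -/
theorem isUnit_mul_cayley {U : Matrix (Fin n) (Fin (2 * m + 1)) K} {B : GL (Fin n) K}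
    (h : B.val + B.valᵀ = -(U * wMat (2 * m + 1) K * Uᵀ)) (hu : IsUnit (B.val + B.valᵀ)) :
    IsUnit (U * (wMat (2 * m + 1) K * Uᵀ * (B⁻¹).valᵀ)) := by
  have h1 : U * (wMat (2 * m + 1) K * Uᵀ * (B⁻¹).valᵀ) = -(B.val + B.valᵀ) * (B⁻¹).valᵀ := by
    rw [h, neg_neg]; simp only [Matrix.mul_assoc]
  rw [h1]
  refine hu.neg.mul ?_
  rw [Matrix.isUnit_transpose]
  exact (B⁻¹).isUnit

theorem stdTorusMap_eq_div (a : Fin (2 * m + 1) → Kˣ) (i : Fin (2 * m + 1)) :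
    stdTorusMap (m := m) (Nat.le_succ (2 * m)) a i = a i / a i.rev := by
  rw [stdTorusMap]
  split_ifs with h h'
  · rfl
  · have h1 : (⟨2 * m - i.val, by omega⟩ : Fin (2 * m + 1)) = i.rev :=
      Fin.ext (by rw [Fin.val_rev]; simp)
    have h2 : Fin.rev (⟨2 * m - i.val, by omega⟩ : Fin (2 * m + 1)) = i := by
      rw [h1, Fin.rev_rev]
    exact congrArg₂ (· / ·) (congrArg a h2) (congrArg a h1)
  · have h1 : i.rev = i := Fin.ext (by rw [Fin.val_rev]; omega)
    rw [h1, div_self']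

theorem comparison_id (m : ℕ) (K : Type*) [Field K] :
    Comparison (m := m) (Nat.le_succ (2 * m))
      (id : Matrix _ _ K → Matrix (Fin (2 * m + 1)) (Fin (2 * m + 1)) K) id where
  inj := Function.injective_id
  rev _ := rfl
  range j _ := ⟨j, rfl⟩
  std := stdTorusMap_eq_div
  map_one := rfl
  map_mul _ _ := rfl
  map_diagonal a := by
    simp only [id, stdTorusMap_eq_div]
  similar _ _ h := h
  norm U B h hu := by
    -- For n = 2m+1 the intertwiner C is square, so injectivity makes it a similarity.
    have hC : IsUnit (wMat (2 * m + 1) K * Uᵀ * (B⁻¹).valᵀ) := by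
      have h1 := isUnit_mul_cayley h hu
      rw [Matrix.isUnit_iff_isUnit_det, det_mul] at h1
      rw [Matrix.isUnit_iff_isUnit_det]
      exact isUnit_of_mul_isUnit_right h1
    obtain ⟨P, hP⟩ := hC
    refine IsConj.symm ⟨P, ?_⟩
    change P.val * _ = _ * P.val
    rw [hP]
    exact (cayley_mul h).symm

/-- The middle index. -/
def mid (m : ℕ) : Fin (2 * m + 1) := ⟨m, by omega⟩

theorem phi_succAbove (A : Matrix (Fin (2 * m)) (Fin (2 * m)) K) (i j : Fin (2 * m)) :
    phi A ((mid m).succAbove i) ((mid m).succAbove j) = A i j := by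
  simp only [phi, of_apply]
  rw [show (⟨m, by omega⟩ : Fin (2 * m + 1)) = mid m from rfl, finSuccEquiv'_succAbove,
    finSuccEquiv'_succAbove]

theorem phi_mid_mid (A : Matrix (Fin (2 * m)) (Fin (2 * m)) K) :
    phi A (mid m) (mid m) = 1 := by
  simp only [phi, of_apply]
  rw [show (⟨m, by omega⟩ : Fin (2 * m + 1)) = mid m from rfl, finSuccEquiv'_at]

theorem phi_mid_succAbove (A : Matrix (Fin (2 * m)) (Fin (2 * m)) K) (j : Fin (2 * m)) :
    phi A (mid m) ((mid m).succAbove j) = 0 := by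
  simp only [phi, of_apply]
  rw [show (⟨m, by omega⟩ : Fin (2 * m + 1)) = mid m from rfl, finSuccEquiv'_at,
    finSuccEquiv'_succAbove]

theorem phi_succAbove_mid (A : Matrix (Fin (2 * m)) (Fin (2 * m)) K) (i : Fin (2 * m)) :
    phi A ((mid m).succAbove i) (mid m) = 0 := by
  simp only [phi, of_apply]
  rw [show (⟨m, by omega⟩ : Fin (2 * m + 1)) = mid m from rfl, finSuccEquiv'_at,
    finSuccEquiv'_succAbove]

theorem ext_succAbove {o R : Type*} {A B : Matrix (Fin (2 * m + 1)) o R}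
    (h : ∀ j, A (mid m) j = B (mid m) j)
    (h' : ∀ i j, A ((mid m).succAbove i) j = B ((mid m).succAbove i) j) : A = B := by
  ext i j
  obtain rfl | ⟨i, rfl⟩ := Fin.eq_self_or_eq_succAbove (mid m) i
  exacts [h j, h' i j]

theorem phi_diagonal (f : Fin (2 * m) → K) (F : Fin (2 * m + 1) → K) (h : F (mid m) = 1)
    (h' : ∀ i, F ((mid m).succAbove i) = f i) : phi (diagonal f) = diagonal F := by
  refine ext_succAbove (fun j => ?_) fun i j => ?_ <;>
    obtain rfl | ⟨j, rfl⟩ := Fin.eq_self_or_eq_succAbove (mid m) j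
  · rw [phi_mid_mid, diagonal_apply_eq, h]
  · rw [phi_mid_succAbove, diagonal_apply_ne _ (Fin.ne_succAbove _ _)]
  · rw [phi_succAbove_mid, diagonal_apply_ne _ (Fin.succAbove_ne _ _)]
  · rw [phi_succAbove]
    by_cases hij : i = j
    · rw [hij, diagonal_apply_eq, diagonal_apply_eq, h']
    · rw [diagonal_apply_ne _ hij,
        diagonal_apply_ne _ fun e => hij (Fin.succAbove_right_injective e)]

theorem phi_mul (A B : Matrix (Fin (2 * m)) (Fin (2 * m)) K) :
    phi (A * B) = phi A * phi B := by
  refine ext_succAbove (fun j => ?_) fun i j => ?_ <;>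
    obtain rfl | ⟨j, rfl⟩ := Fin.eq_self_or_eq_succAbove (mid m) j <;>
    rw [mul_apply, Fin.sum_univ_succAbove _ (mid m)] <;>
    simp [phi_mid_mid, phi_mid_succAbove, phi_succAbove_mid, phi_succAbove, mul_apply]

theorem succAbove_mid_rev (i : Fin (2 * m)) :
    (mid m).succAbove i.rev = ((mid m).succAbove i).rev := by
  rw [Fin.rev_succAbove]
  congr 1
  exact Fin.ext (by rw [Fin.val_rev]; simp [mid]; omega)

theorem stdTorusMap_succAbove (a : Fin (2 * m) → Kˣ) (i : Fin (2 * m)) :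
    stdTorusMap (m := m) le_rfl a ((mid m).succAbove i) = a i / a i.rev := by
  rw [stdTorusMap]
  by_cases h : i.val < m
  · have h1 : ((mid m).succAbove i).val = i.val := by
      rw [Fin.succAbove_of_castSucc_lt _ _ (by simpa [Fin.lt_def, mid] using h)]; rfl
    have h2 : (⟨((mid m).succAbove i).val, by omega⟩ : Fin (2 * m)) = i := Fin.ext h1
    rw [dif_pos (h1 ▸ h), h2]
  · have h1 : ((mid m).succAbove i).val = i.val + 1 := by
      rw [Fin.succAbove_of_le_castSucc _ _ (by simpa [Fin.le_def, mid] using h)]; rfl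
    have h2 : (⟨2 * m - ((mid m).succAbove i).val, by omega⟩ : Fin (2 * m)) = i.rev :=
      Fin.ext (by rw [Fin.val_rev]; simp only [h1])
    rw [dif_neg (by omega), dif_pos (by omega), h2, Fin.rev_rev]

theorem stdTorusMap_mid (hn : 2 * m ≤ n) (a : Fin n → Kˣ) {i : Fin (2 * m + 1)} (h : i.val = m) :
    stdTorusMap hn a i = 1 := by
  rw [stdTorusMap, dif_neg (by omega), dif_neg (by omega)]

/-- The characteristic polynomials differ from those of the blocks by the same factor X - 1, which
cancels. -/
theorem phi_similar (f f' : Fin (2 * m) → K) (h : IsConj (phi (diagonal f)) (phi (diagonal f'))) :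
    IsConj (diagonal f) (diagonal f') := by
  open Polynomial in
  have key : ∀ f : Fin (2 * m) → K,
      (phi (diagonal f)).charpoly = (X - C 1) * ∏ i, (X - C (f i)) := by
    intro f
    rw [phi_diagonal f ((mid m).insertNth (1 : K) f) (by simp) (by simp), charpoly_diagonal,
      Fin.prod_univ_succAbove _ (mid m)]
    simp
  apply isConj_diagonal_of_prod_eq
  have h1 := charpoly_eq_of_isConj h
  rw [key, key] at h1
  exact mul_left_cancel₀ (Polynomial.X_sub_C_ne_zero 1) h1

/-- For n = 2m the image of C has codimension one. A non-zero vector of ker U, fixed by Z, completes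
the columns of C to a basis in which Z becomes φ of the norm. -/
theorem phi_norm (U : Matrix (Fin (2 * m)) (Fin (2 * m + 1)) K) (B : GL (Fin (2 * m)) K)
    (h : B.val + B.valᵀ = -(U * wMat (2 * m + 1) K * Uᵀ)) (hu : IsUnit (B.val + B.valᵀ)) :
    IsConj ((-1 : K) ^ (2 * m) • (1 + wMat (2 * m + 1) K * Uᵀ * (B⁻¹).valᵀ * U))
      (phi ((-1 : K) ^ (2 * m + 1) • (B.val * (B⁻¹).valᵀ))) := by
  have hZC := cayley_mul h
  have hUC := isUnit_mul_cayley h hu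
  set C := wMat (2 * m + 1) K * Uᵀ * (B⁻¹).valᵀ
  set N := (-1 : K) ^ (2 * m + 1) • (B.val * (B⁻¹).valᵀ)
  set Z := (-1 : K) ^ (2 * m) • (1 + C * U) with hZ
  obtain ⟨v, hv, hv0⟩ : ∃ v : Fin (2 * m + 1) → K, U *ᵥ v = 0 ∧ v ≠ 0 := by
    have := LinearMap.ker_ne_bot_of_finrank_lt (f := U.mulVecLin) (by simp)
    obtain ⟨v, hv, hv0⟩ := Submodule.exists_mem_ne_zero_of_ne_bot this
    exact ⟨v, hv, hv0⟩
  have hZv : Z *ᵥ v = v := by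
    rw [hZ, pow_mul]
    simp [Matrix.add_mulVec, ← Matrix.mulVec_mulVec, hv]
  -- The change of basis has v as its middle column, matching the middle 1 of φ, and the columns of
  -- C elsewhere.
  let M : Matrix (Fin (2 * m + 1)) (Fin (2 * m + 1)) K :=
    of fun p => (mid m).insertNth (v p) (C p)
  have hM1 : ∀ p, M p (mid m) = v p := fun p => by simp [M]
  have hM2 : ∀ p j, M p ((mid m).succAbove j) = C p j := fun p j => by simp [M]
  have hMu : IsUnit M := by
    rw [← mulVec_injective_iff_isUnit]
    refine (injective_iff_map_eq_zero M.mulVecLin).2 fun x hx => ?_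
    have hx : M *ᵥ x = 0 := hx
    have hx' : x (mid m) • v + C *ᵥ (fun i => x ((mid m).succAbove i)) = 0 := by
      rw [← hx]
      ext p
      simp only [Pi.add_apply, Pi.smul_apply, smul_eq_mul, mulVec, dotProduct]
      rw [Fin.sum_univ_succAbove _ (mid m), hM1, mul_comm]
      simp only [hM2]
    -- Applying U kills the v-component, and U C is invertible, so the other coordinates vanish
    -- first.
    have h1 : (U * C) *ᵥ (fun i => x ((mid m).succAbove i)) = 0 := by
      have := congrArg (fun y => U *ᵥ y) hx'
      simpa [Matrix.mulVec_add, Matrix.mulVec_smul, hv, Matrix.mulVec_mulVec] using this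
    have h2 : (fun i => x ((mid m).succAbove i)) = 0 := by
      have hinj := mulVec_injective_iff_isUnit.2 hUC
      exact hinj (by rw [h1, Matrix.mulVec_zero])
    rw [h2, Matrix.mulVec_zero, add_zero] at hx'
    have h3 := (smul_eq_zero.1 hx').resolve_right hv0
    ext p
    obtain rfl | ⟨p, rfl⟩ := Fin.eq_self_or_eq_succAbove (mid m) p
    exacts [h3, congrFun h2 p]
  obtain ⟨P, hP⟩ := hMu
  refine IsConj.symm ⟨P, ?_⟩
  change P.val * _ = _ * P.val
  rw [hP]
  ext p q
  obtain rfl | ⟨q, rfl⟩ := Fin.eq_self_or_eq_succAbove (mid m) q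
  · rw [mul_apply, mul_apply, Fin.sum_univ_succAbove _ (mid m), phi_mid_mid, hM1]
    simp only [phi_succAbove_mid, hM1, mul_zero, Finset.sum_const_zero, add_zero, mul_one]
    exact (congrFun hZv p).symm
  · rw [mul_apply, mul_apply, Fin.sum_univ_succAbove _ (mid m), phi_mid_succAbove]
    simp only [phi_succAbove, hM2, mul_zero, zero_add]
    exact (congrFun (congrFun hZC p) q).symm

theorem comparison_phi (m : ℕ) (K : Type*) [Field K] :
    Comparison (le_refl (2 * m))
      (phi : Matrix _ _ K → Matrix (Fin (2 * m + 1)) (Fin (2 * m + 1)) K) (mid m).succAbove where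
  inj := Fin.succAbove_right_injective
  rev := succAbove_mid_rev
  range j hj := by
    obtain rfl | ⟨j, rfl⟩ := Fin.eq_self_or_eq_succAbove (mid m) j
    exacts [absurd rfl hj, ⟨j, rfl⟩]
  std := stdTorusMap_succAbove
  map_one := by
    rw [← diagonal_one, ← diagonal_one]
    exact phi_diagonal _ _ rfl fun _ => rfl
  map_mul := phi_mul
  map_diagonal a := phi_diagonal _ _
    (by rw [stdTorusMap_mid le_rfl a (i := mid m) rfl, Units.val_one])
    fun i => by rw [stdTorusMap_succAbove]
  similar := phi_similar
  norm := phi_norm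

end Comparison

/-! ### The diagonal torus of SO_{2m+1} -/

section DiagonalSO

variable {m n : ℕ} {K : Type*} [Field K]

theorem rev_mid : (mid m).rev = mid m := Fin.ext (by rw [Fin.val_rev]; simp [mid]; omega)

theorem eq_mid_of_rev_eq {i : Fin (2 * m + 1)} (h : i.rev = i) : i = mid m := by
  have := congrArg Fin.val h
  rw [Fin.val_rev] at this
  exact Fin.ext (by simp [mid]; omega)

theorem prod_eq_mid {y : Fin (2 * m + 1) → Kˣ} (h : ∀ i, y i * y i.rev = 1) :
    ∏ i, y i = y (mid m) := by
  classical
  rw [← Finset.mul_prod_erase _ _ (Finset.mem_univ (mid m)), mul_eq_left]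
  refine Finset.prod_involution (fun i _ => i.rev) (fun i _ => h i) (fun i hi _ he => ?_)
    (fun i hi => ?_) (fun i _ => Fin.rev_rev i)
  · exact (Finset.mem_erase.1 hi).1 (eq_mid_of_rev_eq he)
  · refine Finset.mem_erase.2 ⟨fun he => (Finset.mem_erase.1 hi).1 ?_, Finset.mem_univ _⟩
    rw [← Fin.rev_rev i, he, rev_mid]

/-- Isometry pairs off the entries at i and its reversal; in the determinant these cancel and only
the middle entry remains. -/
theorem diagGL_mem_SO_iff {y : Fin (2 * m + 1) → Kˣ} :
    diagGL y ∈ SO m K ↔ (∀ i, y i * y i.rev = 1) ∧ y (mid m) = 1 := by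
  have h1 : (diagGL y).valᵀ * wMat (2 * m + 1) K * (diagGL y).val = wMat (2 * m + 1) K ↔
      ∀ i, y i * y i.rev = 1 := by
    have key : ∀ i j, ((diagGL y).valᵀ * wMat (2 * m + 1) K * (diagGL y).val) i j =
        if j = i.rev then (y i : K) * y i.rev else 0 := fun i j => by
      rw [diagGL_val, diagonal_transpose, mul_diagonal, diagonal_mul_wMat_apply]
      split_ifs with h
      · rw [h]
      · rw [zero_mul]
    constructor
    · intro h i
      have h2 := key i i.rev
      rw [h, if_pos rfl, wMat, of_apply, if_pos rfl] at h2
      exact Units.ext h2.symm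
    · intro h
      ext i j
      rw [key, ← Units.val_mul, h, Units.val_one]
      rfl
  have h2 : (diagGL y).val.det = ((∏ i, y i : Kˣ) : K) := by
    rw [diagGL_val, det_diagonal, Units.coe_prod]
  change (diagGL y).valᵀ * wMat (2 * m + 1) K * (diagGL y).val = wMat (2 * m + 1) K ∧
    (diagGL y).val.det = 1 ↔ _
  rw [h1, h2]
  refine and_congr_right fun h => ?_
  rw [prod_eq_mid h, Units.val_eq_one]

variable {hn : 2 * m ≤ n} {ψ : Matrix (Fin n) (Fin n) K →
  Matrix (Fin (2 * m + 1)) (Fin (2 * m + 1)) K} {ι : Fin n → Fin (2 * m + 1)}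

theorem Comparison.stdTorusMap_mul_rev (C : Comparison hn ψ ι) (a : Fin n → Kˣ)
    (i : Fin (2 * m + 1)) : stdTorusMap hn a i * stdTorusMap hn a i.rev = 1 := by
  by_cases hi : i.val = m
  · have : i = mid m := Fin.ext hi
    rw [this, rev_mid, stdTorusMap_mid hn a (i := mid m) rfl, one_mul]
  · obtain ⟨k, rfl⟩ := C.range i hi
    rw [← C.rev, C.std, C.std, Fin.rev_rev, div_mul_div_cancel, div_self']

/-- The element of the diagonal torus of `SO_{2m+1}` attached to an element of that of `GL_n`. -/
def Comparison.stdSO (C : Comparison hn ψ ι) (a : Fin n → Kˣ) : SO m K :=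
  ⟨diagGL (stdTorusMap hn a), diagGL_mem_SO_iff.2
    ⟨C.stdTorusMap_mul_rev a, stdTorusMap_mid hn a rfl⟩⟩

theorem Comparison.stdSO_val (C : Comparison hn ψ ι) (a : Fin n → Kˣ) :
    (C.stdSO a).1 = diagGL (stdTorusMap hn a) := rfl

theorem Comparison.map_isConj (C : Comparison hn ψ ι) {A B : Matrix (Fin n) (Fin n) K}
    (h : IsConj A B) : IsConj (ψ A) (ψ B) := by
  let f : Matrix (Fin n) (Fin n) K →* Matrix (Fin (2 * m + 1)) (Fin (2 * m + 1)) K :=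
    { toFun := ψ, map_one' := C.map_one, map_mul' := C.map_mul }
  exact f.map_isConj h

theorem Comparison.map_normTheta_diagGL (C : Comparison hn ψ ι) (a : Fin n → Kˣ) :
    ψ (normTheta (diagGL a)).val = (C.stdSO a).1.val := by
  rw [normTheta_diagGL, diagGL_val, C.map_diagonal]
  rfl

end DiagonalSO

/-! ### The image map in terms of norms -/

section ImageMap

variable {m n : ℕ} {K : Type*} [Field K]

theorem isConj_val {x y : SO m K} (h : IsConj x y) : IsConj x.1.val y.1.val :=
  ((Units.coeHom _).comp (SO m K).subtype).map_isConj h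

variable [IsAlgClosed K] [CharZero K] {hn : 2 * m ≤ n} {ψ : Matrix (Fin n) (Fin n) K →
  Matrix (Fin (2 * m + 1)) (Fin (2 * m + 1)) K} {ι : Fin n → Fin (2 * m + 1)}

/-- On the diagonal torus ψ ∘ N is the standard map of tori, and both sides depend only on classes.
The converse uses that similarity in GL_{2m+1} implies conjugacy in SO_{2m+1}. -/
theorem Comparison.mem_imageMap_iff (C : Comparison hn ψ ι) {γ : SO m K} {δ : GL (Fin n) K}
    {a : Fin n → Kˣ} (ha : TwistedConj (thetaStar n K) (diagGL a) δ) :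
    δ ∈ imageMap hn γ ↔ IsConj γ.1.val (ψ (normTheta δ).val) := by
  constructor
  · rintro ⟨a', ⟨h, hh⟩, ha'⟩
    have h1 : IsConj γ (C.stdSO a') := isConj_iff.2 ⟨h, Subtype.ext hh⟩
    refine (isConj_val h1).trans ?_
    rw [← C.map_normTheta_diagGL]
    exact C.map_isConj ha'.isConj_normTheta
  · intro h
    have h1 : IsConj γ.1.val (C.stdSO a).1.val := by
      refine h.trans ?_
      rw [← C.map_normTheta_diagGL]
      exact C.map_isConj ha.symm.isConj_normTheta
    obtain ⟨c, hc⟩ := isConj_iff.1 (SO_isConj_of_isConj h1)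
    exact ⟨a, ⟨c, congrArg Subtype.val hc⟩, ha⟩

/-- For diagonal representatives ψ reflects similarity, and similar norms imply θ*-conjugacy. This
makes 𝒜(γ) a single class. -/
theorem Comparison.twistedConj_of_isConj (C : Comparison hn ψ ι) {δ δ' : GL (Fin n) K}
    {a a' : Fin n → Kˣ} (ha : TwistedConj (thetaStar n K) (diagGL a) δ)
    (ha' : TwistedConj (thetaStar n K) (diagGL a') δ')
    (h : IsConj (ψ (normTheta δ).val) (ψ (normTheta δ').val)) :
    TwistedConj (thetaStar n K) δ δ' := by
  have h1 := (C.map_isConj ha.isConj_normTheta).trans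
    (h.trans (C.map_isConj ha'.symm.isConj_normTheta))
  rw [normTheta_diagGL, normTheta_diagGL, diagGL_val, diagGL_val] at h1
  have h2 := C.similar _ _ h1
  rw [← diagGL_val, ← diagGL_val, ← normTheta_diagGL, ← normTheta_diagGL] at h2
  exact ha.symm.trans ((twistedConj_of_isConj_normTheta h2).trans ha')

theorem Comparison.imageMap_eq (C : Comparison hn ψ ι) {γ : SO m K} {δ : GL (Fin n) K}
    {a : Fin n → Kˣ} (ha : TwistedConj (thetaStar n K) (diagGL a) δ)
    (h : IsConj γ.1.val (ψ (normTheta δ).val)) :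
    imageMap hn γ = {δ' | TwistedConj (thetaStar n K) δ δ'} := by
  ext δ'
  constructor
  · intro hδ'
    have ⟨a', _, ha'⟩ := hδ'
    exact C.twistedConj_of_isConj ha ha' (h.symm.trans ((C.mem_imageMap_iff ha').1 hδ'))
  · intro hδ'
    have hδ' : TwistedConj (thetaStar n K) δ δ' := hδ'
    rw [C.mem_imageMap_iff (ha.trans hδ')]
    exact h.trans (C.map_isConj hδ'.isConj_normTheta)

end ImageMap

/-! ### Solutions of (E) and the norm correspondence -/

section Solutions

variable {m n : ℕ} {K : Type*} [Field K]

theorem mul_gTheta_inv_mul_uGL (γ : GL (Fin n) K) :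
    γ * (gTheta n K)⁻¹ * uGL n K = γ * wGL n K := by
  rw [uGL]; group

/-- A solution `(X, Y)` of the equation, in terms of the form `B = Y⁻¹ w_n` and of `U = Y⁻¹ X`. -/
theorem form_add_transpose_of_isSolution {X : Matrix (Fin n) (Fin (2 * m + 1)) K}
    {Y : GL (Fin n) K} (h : IsSolution X Y.val) :
    (Y⁻¹ * wGL n K).val + (Y⁻¹ * wGL n K).valᵀ =
      -((Y⁻¹).val * X * wMat (2 * m + 1) K * ((Y⁻¹).val * X)ᵀ) := by
  have hw : (wGL n K).val = wMat n K := rfl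
  have hww : wMat n K * wMat n K = 1 := wMat_mul_self
  have hYT : Y.valᵀ * (Y⁻¹).valᵀ = 1 := by rw [← transpose_mul, Y.inv_mul, transpose_one]
  have h1 : (Y⁻¹).val * (Y.val + wMat n K * Y.valᵀ * wMat n K) * (wMat n K * (Y⁻¹).valᵀ) =
      (Y⁻¹).val * (X * primed X) * (wMat n K * (Y⁻¹).valᵀ) := by rw [← h]
  have h2 : (Y⁻¹).val * (Y.val + wMat n K * Y.valᵀ * wMat n K) * (wMat n K * (Y⁻¹).valᵀ) =
      (Y⁻¹ * wGL n K).valᵀ + (Y⁻¹ * wGL n K).val := by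
    rw [Units.val_mul, hw, transpose_mul, wMat_transpose, Matrix.mul_add, Matrix.add_mul,
      Y.inv_mul, Matrix.one_mul]
    congr 1
    calc _ = (Y⁻¹).val * wMat n K * (Y.valᵀ * ((wMat n K * wMat n K) * (Y⁻¹).valᵀ)) := by
          simp only [Matrix.mul_assoc]
      _ = _ := by rw [hww, Matrix.one_mul, hYT, Matrix.mul_one]
  rw [add_comm, ← h2, h1, primed, transpose_mul]
  simp only [Matrix.mul_neg, Matrix.neg_mul, Matrix.mul_assoc]
  rw [← Matrix.mul_assoc (wMat n K) (wMat n K), hww, Matrix.one_mul]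

/-- The factor Y of ᵗB⁻¹ cancels the Y⁻¹ in ᵗU, leaving ᵗX w_n; the sign in X' turns the difference
into a sum. -/
theorem one_sub_eq_cayley (X : Matrix (Fin n) (Fin (2 * m + 1)) K) (Y : GL (Fin n) K) :
    1 - primed X * (Y⁻¹).val * X =
      1 + wMat (2 * m + 1) K * ((Y⁻¹).val * X)ᵀ * ((Y⁻¹ * wGL n K)⁻¹).valᵀ *
        ((Y⁻¹).val * X) := by
  have h1 : ((Y⁻¹).val * X)ᵀ * ((Y⁻¹ * wGL n K)⁻¹).valᵀ = Xᵀ * wMat n K := by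
    rw [← transpose_mul, _root_.mul_inv_rev, inv_inv, Units.val_mul,
      show ((wGL n K)⁻¹).val = wMat n K from rfl, Matrix.mul_assoc, ← Matrix.mul_assoc Y.val,
      Y.mul_inv, Matrix.one_mul, transpose_mul, wMat_transpose]
  rw [sub_eq_add_neg, Matrix.mul_assoc (wMat (2 * m + 1) K), h1, primed]
  simp only [Matrix.neg_mul, neg_neg, Matrix.mul_assoc]

theorem cayley_mem_SO {U : Matrix (Fin n) (Fin (2 * m + 1)) K} {B : GL (Fin n) K}
    (h : B.val + B.valᵀ = -(U * wMat (2 * m + 1) K * Uᵀ)) :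
    ∃ Z : SO m K, Z.1.val =
      (-1 : K) ^ n • (1 + wMat (2 * m + 1) K * Uᵀ * (B⁻¹).valᵀ * U) := by
  set w := wMat (2 * m + 1) K with hw
  have hww : w * w = 1 := wMat_mul_self
  have hwT : wᵀ = w := wMat_transpose
  have hT : B.valᵀ * (B⁻¹).valᵀ = 1 := by rw [← transpose_mul, B.inv_mul, transpose_one]
  have hi : (B⁻¹).val * B.val = 1 := B.inv_mul
  have h1 : U * (w * Uᵀ * (B⁻¹).valᵀ) = -(B.val * (B⁻¹).valᵀ + 1) := by
    rw [← Matrix.mul_assoc, ← Matrix.mul_assoc, ← neg_eq_iff_eq_neg.2 h, Matrix.neg_mul,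
      Matrix.add_mul, hT]
  -- Sylvester's identity gives det(1 + C U) = det(1 + U C) = det(-B ᵗB⁻¹) = (-1)^n; the scalar
  -- contributes (-1)^n to the odd power 2m+1, which cancels it.
  have hdet : ((-1 : K) ^ n • (1 + w * Uᵀ * (B⁻¹).valᵀ * U)).det = 1 := by
    have h2 : (1 + -(B.val * (B⁻¹).valᵀ + 1)) = -(B.val * (B⁻¹).valᵀ) := by abel
    have h3 : B.val.det * (B⁻¹).val.det = 1 := by rw [← det_mul, B.mul_inv, det_one]
    rw [det_smul, det_one_add_mul_comm, h1, h2, det_neg, det_mul, det_transpose, h3, mul_one,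
      Fintype.card_fin, Fintype.card_fin, pow_succ, pow_mul, pow_two, neg_one_pow_mul_self,
      one_pow, one_mul, neg_one_pow_mul_self]
  refine ⟨⟨GeneralLinearGroup.mkOfDetNeZero _ (by rw [hdet]; exact one_ne_zero), ?_, hdet⟩, rfl⟩
  change ((-1 : K) ^ n • (1 + w * Uᵀ * (B⁻¹).valᵀ * U))ᵀ * w *
    ((-1 : K) ^ n • (1 + w * Uᵀ * (B⁻¹).valᵀ * U)) = w
  rw [transpose_smul, Matrix.smul_mul, Matrix.smul_mul, Matrix.mul_smul, smul_smul,
    neg_one_pow_mul_self, one_smul]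
  set A := Uᵀ * (B⁻¹).valᵀ * U with hA
  have h4 : w * Uᵀ * (B⁻¹).valᵀ * U = w * A := by simp only [hA, Matrix.mul_assoc]
  -- With Z = ±(1 + w A), this quadratic relation is exactly what ᵗZ w Z = w requires.
  have h5 : Aᵀ * w * A = -(A + Aᵀ) := by
    have h6 : Aᵀ * w * A = Uᵀ * (B⁻¹).val * (U * (w * Uᵀ * (B⁻¹).valᵀ)) * U := by
      simp only [hA, transpose_mul, transpose_transpose, Matrix.mul_assoc]
    have h7 : Aᵀ = Uᵀ * (B⁻¹).val * U := by
      simp only [hA, transpose_mul, transpose_transpose, Matrix.mul_assoc]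
    rw [h6, h1, h7, Matrix.mul_neg, Matrix.neg_mul, Matrix.mul_add, Matrix.mul_one,
      Matrix.add_mul, hA]
    congr 2
    rw [Matrix.mul_assoc, Matrix.mul_assoc, ← Matrix.mul_assoc (B⁻¹).val,
      ← Matrix.mul_assoc (B⁻¹).val, hi, Matrix.one_mul, Matrix.mul_assoc]
  rw [h4, transpose_add, transpose_one, transpose_mul, hwT]
  have h8 : (1 + Aᵀ * w) * w * (1 + w * A) = w + A + Aᵀ + Aᵀ * w * A := by
    have h9 : w * (w * A) = A := by rw [← Matrix.mul_assoc, hww, Matrix.one_mul]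
    have h10 : Aᵀ * w * w = Aᵀ := by rw [Matrix.mul_assoc, hww, Matrix.mul_one]
    simp only [Matrix.add_mul, Matrix.mul_add, Matrix.one_mul, Matrix.mul_one, h9, h10]
    rw [← Matrix.mul_assoc]
    abel
  rw [h8, h5]
  abel

/-- The norm correspondence is non-empty on `𝒩`. -/
theorem normCorr_nonempty {γ : GL (Fin n) K} (h : InN m γ) : (normCorr m γ).Nonempty := by
  obtain ⟨X, hX⟩ := h
  have hX : IsSolution X (γ⁻¹).val := hX
  obtain ⟨Z, hZ⟩ := cayley_mem_SO (form_add_transpose_of_isSolution hX)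
  refine ⟨ConjClasses.mk Z, X, γ⁻¹, Z, hX, ?_, ?_, rfl⟩
  · rw [inv_inv]; exact TwistedConj.refl _ _
  · rw [one_sub_eq_cayley]; exact hZ

theorem normCorr_eq_of_twistedConj {γ γ' : GL (Fin n) K} (h : TwistedConj (epsilon n K) γ γ') :
    normCorr m γ = normCorr m γ' := by
  ext c
  constructor
  · rintro ⟨X, Y, Z, h1, h2, h3⟩
    exact ⟨X, Y, Z, h1, h.symm.trans h2, h3⟩
  · rintro ⟨X, Y, Z, h1, h2, h3⟩
    exact ⟨X, Y, Z, h1, h.trans h2, h3⟩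

variable {hn : 2 * m ≤ n} {ψ : Matrix (Fin n) (Fin n) K →
  Matrix (Fin (2 * m + 1)) (Fin (2 * m + 1)) K} {ι : Fin n → Fin (2 * m + 1)}

/-- The classes in `N_ε(γ)` are those of `ψ (N_{θ*}(γ g_θ⁻¹))`. -/
theorem Comparison.isConj_of_mem_normCorr [CharZero K] (C : Comparison hn ψ ι) {γ : GL (Fin n) K}
    {a : Fin n → Kˣ} (hr : StronglyRegular (thetaStar n K) (γ * (gTheta n K)⁻¹))
    (ha : TwistedConj (thetaStar n K) (diagGL a) (γ * (gTheta n K)⁻¹)) {Z : SO m K}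
    (hZ : ConjClasses.mk Z ∈ normCorr m γ) :
    IsConj Z.1.val (ψ (normTheta (γ * (gTheta n K)⁻¹)).val) := by
  obtain ⟨X, Y, Z', hX, hY, hZ', he⟩ := hZ
  have hY := twistedConj_epsilon_iff.1 hY
  have h1 : IsConj Z.1.val Z'.1.val := isConj_val (ConjClasses.mk_eq_mk_iff_isConj.1 he)
  refine h1.trans (IsConj.trans ?_ (C.map_isConj hY.symm.isConj_normTheta))
  have hu := isUnit_form_add_transpose (hr.of_twistedConj hY) (ha.trans hY)
  rw [normTheta_val, mul_gTheta_inv_mul_uGL, hZ', one_sub_eq_cayley]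
  -- The form of Y⁻¹ g_θ⁻¹ is Y⁻¹ w_n, the form B attached to a solution.
  rw [mul_gTheta_inv_mul_uGL] at hu
  exact C.norm _ _ (form_add_transpose_of_isSolution hX) hu

/-- The equation has solutions for elements of the diagonal torus over an algebraically closed
field. -/
theorem Comparison.inN_diagGL [IsAlgClosed K] (C : Comparison hn ψ ι) (a : Fin n → Kˣ) :
    InN m (diagGL a) := by
  obtain ⟨sq, hsq⟩ : ∃ sq : K → K, ∀ x, sq x * sq x = x :=
    ⟨fun x => (IsAlgClosed.exists_pow_nat_eq x two_pos).choose, fun x => by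
      rw [← pow_two]; exact (IsAlgClosed.exists_pow_nat_eq x two_pos).choose_spec⟩
  -- For diagonal Y the equation reads X w ᵗX = diag(q) w. Placing a square root of q_i in row i and
  -- column ι i solves it, because q is invariant under reversal.
  let q : Fin n → K := fun i => -(((a i)⁻¹ : Kˣ) + ((a i.rev)⁻¹ : Kˣ))
  have hq : ∀ i, q i.rev = q i := fun i => by simp only [q, Fin.rev_rev, add_comm]
  let X : Matrix (Fin n) (Fin (2 * m + 1)) K := of fun i j => if j = ι i then sq (q i) else 0
  have hXw : X * wMat (2 * m + 1) K * Xᵀ = diagonal q * wMat n K := by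
    ext i j
    rw [diagonal_mul_wMat_apply, mul_apply, Finset.sum_eq_single (ι i.rev)]
    · rw [mul_wMat_apply, transpose_apply, C.rev, Fin.rev_rev]
      simp only [X, of_apply, if_true]
      by_cases hj : j = i.rev
      · rw [hj, if_pos rfl, if_pos (C.rev i).symm, hq, hsq]
      · rw [if_neg hj, if_neg, mul_zero]
        rw [← C.rev]
        exact fun h => hj (C.inj h).symm
    · intro k _ hk
      rw [mul_wMat_apply]
      simp only [X, of_apply]
      rw [if_neg, zero_mul]
      intro h
      exact hk (by rw [C.rev, ← h, Fin.rev_rev])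
    · simp
  refine ⟨X, ?_⟩
  rw [IsSolution, primed, Matrix.mul_neg, ← Matrix.mul_assoc, ← Matrix.mul_assoc, hXw,
    Matrix.mul_assoc (diagonal q), wMat_mul_self, Matrix.mul_one, ← diagGL_inv, diagGL_val,
        diagonal_transpose,
    wMat_mul_diagonal_mul_wMat, diagonal_add, ← diagonal_neg]
  funext i
  simp

theorem mem_normCorr_map {L : Type*} [Field L] (f : K →+* L) {γ : GL (Fin n) K} {Z : SO m K}
    (h : ConjClasses.mk Z ∈ normCorr m γ) :
    ConjClasses.mk (soMap f Z) ∈ normCorr m (GeneralLinearGroup.map f γ) := by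
  obtain ⟨X, Y, Z', hX, ⟨g, hg⟩, hZ', he⟩ := h
  have hp : (primed X).map f = primed (X.map f) := by
    rw [primed, primed, Matrix.map_neg f (map_neg f), Matrix.map_mul, Matrix.map_mul, map_wMat,
      map_wMat, transpose_map]
  have hinv : ((GeneralLinearGroup.map f Y)⁻¹).val = ((Y⁻¹).val).map f := by
    rw [← map_inv]; rfl
  refine ⟨X.map f, GeneralLinearGroup.map f Y, soMap f Z', ?_, ⟨GeneralLinearGroup.map f g, ?_⟩,
    ?_, ?_⟩
  · have h1 := congrArg (fun A => A.map f) (show _ + _ = _ from hX)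
    simp only [Matrix.map_add f (map_add f), Matrix.map_mul, map_wMat, hp] at h1
    rw [IsSolution, mapGL_val, ← transpose_map]
    exact h1
  · rw [← map_inv, hg, map_mul, map_mul, map_inv]
    congr 2
    rw [epsilon_apply, epsilon_apply, map_mul, map_mul, map_inv]
    have : GeneralLinearGroup.map f (wGL n K) = wGL n L := Units.ext (map_wMat f)
    rw [this]
    congr 2
  · change Z'.1.val.map f = _
    rw [hZ', hinv, ← hp, Matrix.map_smul' f _ _ (map_mul f), Matrix.map_sub f (map_sub f),
        Matrix.map_mul,
      Matrix.map_mul, Matrix.map_one f (map_zero f) (map_one f)]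
    simp
  · have h1 := ConjClasses.mk_eq_mk_iff_isConj.1 he
    obtain ⟨c, hc⟩ := isConj_iff.1 h1
    refine ConjClasses.mk_eq_mk_iff_isConj.2 (isConj_iff.2 ⟨soMap f c, ?_⟩)
    rw [← hc]
    apply Subtype.ext
    change _ = GeneralLinearGroup.map f (c.1 * Z.1 * c.1⁻¹)
    rw [map_mul, map_mul, map_inv]
    rfl

end Solutions

/-! ### The isomorphism from coinvariants onto T -/

section Coinvariants

variable {m n : ℕ} {K : Type*} [Field K] {hn : 2 * m ≤ n}
  {ψ : Matrix (Fin n) (Fin n) K → Matrix (Fin (2 * m + 1)) (Fin (2 * m + 1)) K}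
  {ι : Fin n → Fin (2 * m + 1)}

theorem exists_units_sqrt [IsAlgClosed K] : ∃ sq : Kˣ → Kˣ, ∀ x, sq x * sq x = x := by
  refine Classical.axiomOfChoice (r := fun x y : Kˣ => y * y = x) fun x => ?_
  obtain ⟨y, hy⟩ := IsAlgClosed.exists_pow_nat_eq (x : K) two_pos
  have hy0 : y ≠ 0 := by
    rintro rfl
    exact x.ne_zero (by rw [← hy]; simp)
  exact ⟨Units.mk0 y hy0, Units.ext (by rw [← hy, pow_two]; rfl)⟩

theorem stdTorusMap_mul (hn : 2 * m ≤ n) (a b : Fin n → Kˣ) :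
    stdTorusMap hn (a * b) = stdTorusMap hn a * stdTorusMap hn b := by
  funext i
  simp only [stdTorusMap, Pi.mul_apply]
  split_ifs
  · rw [mul_div_mul_comm]
  · rw [mul_div_mul_comm]
  · rw [one_mul]

theorem Comparison.stdSO_mul (C : Comparison hn ψ ι) (a b : Fin n → Kˣ) :
    C.stdSO (a * b) = C.stdSO a * C.stdSO b := by
  apply Subtype.ext
  change diagGL _ = diagGL _ * diagGL _
  rw [stdTorusMap_mul, diagGL_mul]

theorem Comparison.stdSO_eq_one_iff (C : Comparison hn ψ ι) (a : Fin n → Kˣ) :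
    C.stdSO a = 1 ↔ ∀ i, a i = a i.rev := by
  have h1 : C.stdSO a = 1 ↔ stdTorusMap hn a = 1 := by
    rw [← Subtype.val_inj, C.stdSO_val, OneMemClass.coe_one, ← diagGL_one,
      diagGL_injective.eq_iff]
  rw [h1, funext_iff]
  constructor
  · intro h i
    have := h (ι i)
    rw [C.std] at this
    exact div_eq_one.1 this
  · intro h j
    by_cases hj : j.val = m
    · exact stdTorusMap_mid hn a hj
    · obtain ⟨i, rfl⟩ := C.range j hj
      rw [C.std, ← h, div_self']
      rfl

theorem Comparison.exists_stdSO_eq (C : Comparison hn ψ ι) {y : SO m K}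
    (hy : y ∈ soDiagTorus m K) : ∃ a, C.stdSO a = y := by
  obtain ⟨b, hb⟩ : ∃ b, diagGL b = y.1 := hy
  have hbS : diagGL b ∈ SO m K := hb ▸ y.2
  rw [diagGL_mem_SO_iff] at hbS
  -- In the quotients a_i / a_{rev i} each pair needs only one entry: b on the first half, 1 on the
  -- rest, including a middle index.
  let a : Fin n → Kˣ := fun k => if (ι k).val < m then b (ι k) else 1
  refine ⟨a, Subtype.ext ?_⟩
  rw [← hb, C.stdSO_val]
  congr 1
  funext j
  by_cases hj : j.val = m
  · rw [stdTorusMap_mid hn a hj, show j = mid m from Fin.ext hj, hbS.2]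
  · obtain ⟨k, rfl⟩ := C.range j hj
    rw [C.std]
    simp only [a, C.rev]
    have hr : (ι k).rev.val = 2 * m - (ι k).val := by rw [Fin.val_rev]; omega
    by_cases hk : (ι k).val < m
    · rw [if_pos hk, if_neg (by omega), div_one]
    · rw [if_neg hk, if_pos (by omega), one_div, inv_eq_iff_mul_eq_one, mul_comm]
      exact hbS.1 _

/-- The isomorphism `T'_{θ*} ≃ T` obtained from the standard one by conjugation. -/
theorem Comparison.exists_mulEquiv [IsAlgClosed K] (C : Comparison hn ψ ι) {g : GL (Fin n) K}
    (hg : thetaStar n K g = g) (h : SO m K) :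
    ∃ e : Coinvariants (thetaStar n K) (conjSubgroup g (diagTorus n K)) ≃*
        conjSubgroup h (soDiagTorus m K),
      ∀ (a : Fin n → Kˣ) (t : conjSubgroup g (diagTorus n K)), t.1 = g * diagGL a * g⁻¹ →
        (e (QuotientGroup.mk t)).1 = h * C.stdSO a * h⁻¹ := by
  let E₀ : (Fin n → Kˣ) →* conjSubgroup g (diagTorus n K) :=
    MonoidHom.mk' (fun a => ⟨g * diagGL a * g⁻¹, ⟨diagGL a, ⟨a, rfl⟩, rfl⟩⟩) fun a b => by
      apply Subtype.ext
      change g * diagGL (a * b) * g⁻¹ = g * diagGL a * g⁻¹ * (g * diagGL b * g⁻¹)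
      rw [diagGL_mul]; group
  have hE₀ : Function.Bijective E₀ := by
    constructor
    · intro a b hab
      have h1 : g * diagGL a * g⁻¹ = g * diagGL b * g⁻¹ := congrArg Subtype.val hab
      exact diagGL_injective (mul_left_cancel (mul_right_cancel h1))
    · rintro ⟨_, _, ⟨a, rfl⟩, rfl⟩
      exact ⟨a, rfl⟩
  let E : (Fin n → Kˣ) ≃* conjSubgroup g (diagTorus n K) := MulEquiv.ofBijective E₀ hE₀
  have hE : ∀ a, (E a).1 = g * diagGL a * g⁻¹ := fun a => rfl
  let Φ : (Fin n → Kˣ) →* conjSubgroup h (soDiagTorus m K) :=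
    MonoidHom.mk' (fun a => ⟨h * C.stdSO a * h⁻¹, ⟨C.stdSO a, ⟨_, rfl⟩, rfl⟩⟩) fun a b => by
      apply Subtype.ext
      change h * C.stdSO (a * b) * h⁻¹ = h * C.stdSO a * h⁻¹ * (h * C.stdSO b * h⁻¹)
      rw [C.stdSO_mul]; group
  have hΦ : ∀ a, (Φ a).1 = h * C.stdSO a * h⁻¹ := fun a => rfl
  have hΦs : Function.Surjective Φ := by
    rintro ⟨_, y, hy, rfl⟩
    obtain ⟨a, rfl⟩ := C.exists_stdSO_eq hy
    exact ⟨a, rfl⟩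
  have hΦ1 : ∀ a, Φ a = 1 ↔ ∀ i, a i = a i.rev := fun a => by
    rw [← C.stdSO_eq_one_iff, ← Subtype.val_inj, hΦ, OneMemClass.coe_one, mul_inv_eq_one,
      mul_eq_left]
  let φ : conjSubgroup g (diagTorus n K) →* conjSubgroup h (soDiagTorus m K) :=
    Φ.comp E.symm.toMonoidHom
  have hφE : ∀ a, φ (E a) = Φ a := fun a => congrArg Φ (E.symm_apply_apply a)
  have hφs : Function.Surjective φ := hΦs.comp E.symm.surjective
  have hcomm : ∀ a b : Fin n → Kˣ, (E b).1 = (E a).1 * (thetaStar n K (E a).1)⁻¹ ↔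
      ∀ i, b i = a i * a i.rev := fun a b => by
    have h1 : (E a).1 * (thetaStar n K (E a).1)⁻¹ =
        g * diagGL (fun i => a i * a i.rev) * g⁻¹ := by
      have h2 : (diagGL fun i => a i * a i.rev) = diagGL a * (thetaStar n K (diagGL a))⁻¹ := by
        rw [thetaStar_diagGL, ← diagGL_inv, ← diagGL_mul]
        congr 1
      rw [hE, _root_.map_mul, _root_.map_mul, map_inv, hg, h2]
      group
    rw [h1, hE, mul_left_inj, mul_right_inj, diagGL_injective.eq_iff, funext_iff]
  -- The kernel consists of the a invariant under reversal, and (1 - θ*)T' of the products s_i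
  -- s_{rev i}. They agree because an invariant a is s_i s_{rev i} with s_i a square root of a_i.
  have hker : Subgroup.normalClosure {x : conjSubgroup g (diagTorus n K) |
      ∃ s : conjSubgroup g (diagTorus n K), (x : GL (Fin n) K) =
        (s : GL (Fin n) K) * (thetaStar n K s)⁻¹} = φ.ker := by
    apply le_antisymm
    · apply Subgroup.normalClosure_le_normal
      rintro x ⟨s, hs⟩
      obtain ⟨b, rfl⟩ := E.surjective x
      obtain ⟨a, rfl⟩ := E.surjective s
      change φ (E b) = 1
      rw [hφE, hΦ1]
      intro i
      rw [(hcomm a b).1 hs, (hcomm a b).1 hs, Fin.rev_rev, mul_comm]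
    · intro x hx
      apply Subgroup.subset_normalClosure
      obtain ⟨b, rfl⟩ := E.surjective x
      have hb : φ (E b) = 1 := hx
      rw [hφE, hΦ1] at hb
      obtain ⟨sq, hsq⟩ := exists_units_sqrt (K := K)
      refine ⟨E fun i => sq (b i), (hcomm _ _).2 fun i => ?_⟩
      rw [← hb, hsq]
  refine ⟨(QuotientGroup.quotientMulEquivOfEq hker).trans
    (QuotientGroup.quotientKerEquivOfSurjective φ hφs), fun a t ht => ?_⟩
  have h1 : t = E a := Subtype.ext ht
  rw [h1, ← hΦ, ← hφE]
  rfl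

theorem map_conjSubgroup_eq {G : Type*} [Group G] {θ : G →* G} (hθ : ∀ x, θ (θ x) = x) {g : G}
    (hg : θ g = g) {H : Subgroup G} (hH : ∀ x ∈ H, θ x ∈ H) :
    (conjSubgroup g H).map θ = conjSubgroup g H := by
  have h1 : ∀ x ∈ conjSubgroup g H, θ x ∈ conjSubgroup g H := fun x hx => by
    rw [mem_conjSubgroup] at hx ⊢
    simpa [hg] using hH _ hx
  apply le_antisymm
  · rintro _ ⟨x, hx, rfl⟩
    exact h1 x hx
  · intro x hx
    exact ⟨θ x, h1 x hx, hθ x⟩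

theorem thetaStar_mem_diagTorus {x : GL (Fin n) K} (hx : x ∈ diagTorus n K) :
    thetaStar n K x ∈ diagTorus n K := by
  obtain ⟨a, rfl⟩ := hx
  exact ⟨_, (thetaStar_diagGL a).symm⟩

end Coinvariants

/-! ### Norm diagrams from Galois-compatible pairs (g, h) -/

section NormDiagrams

variable {F : Type*} [Field F] [CharZero F] {m n : ℕ}

theorem exists_matrix_of_galois_fixed {p q : Type*} {A : Matrix p q (AlgebraicClosure F)}
    (h : ∀ σ : AlgebraicClosure F ≃ₐ[F] AlgebraicClosure F, A.map σ = A) :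
    ∃ A₀ : Matrix p q F, A₀.map (algebraMap F (AlgebraicClosure F)) = A := by
  have h1 : ∀ i j, ∃ x : F, algebraMap F (AlgebraicClosure F) x = A i j := fun i j =>
    (InfiniteGalois.mem_range_algebraMap_iff_fixed _).2 fun σ => congrFun (congrFun (h σ) i) j
  choose A₀ hA₀ using h1
  exact ⟨of A₀, by ext i j; exact hA₀ i j⟩

theorem exists_barSO_eq {z : SO m (AlgebraicClosure F)}
    (h : ∀ σ : AlgebraicClosure F ≃ₐ[F] AlgebraicClosure F, galSO σ z = z) :
    ∃ γ : SO m F, barSO γ = z := by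
  obtain ⟨A, hA⟩ := exists_matrix_of_galois_fixed (A := z.1.val)
    fun σ => congrArg (fun y : SO m (AlgebraicClosure F) => y.1.val) (h σ)
  have hinj := (algebraMap F (AlgebraicClosure F)).injective
  have hdet : A.det = 1 := by
    apply hinj
    rw [RingHom.map_det, RingHom.mapMatrix_apply, hA, map_one]
    exact z.2.2
  have hort : Aᵀ * wMat (2 * m + 1) F * A = wMat (2 * m + 1) F := by
    apply Matrix.map_injective hinj
    beta_reduce
    rw [Matrix.map_mul, Matrix.map_mul, transpose_map, map_wMat, hA]
    exact z.2.1
  refine ⟨⟨GeneralLinearGroup.mkOfDetNeZero A (by rw [hdet]; exact one_ne_zero), hort, hdet⟩, ?_⟩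
  exact Subtype.ext (Units.ext hA)

variable {hn : 2 * m ≤ n}
  {ψ : Matrix (Fin n) (Fin n) (AlgebraicClosure F) →
    Matrix (Fin (2 * m + 1)) (Fin (2 * m + 1)) (AlgebraicClosure F)}
  {ι : Fin n → Fin (2 * m + 1)}

theorem exists_conj_eq_of_isConj {K : Type*} [Field K] {k : ℕ} {A B : Matrix (Fin k) (Fin k) K}
    (h : IsConj A B) : ∃ P : GL (Fin k) K, P.val * A * (P⁻¹).val = B := by
  obtain ⟨P, hP⟩ := h
  have hP : P.val * A = B * P.val := hP
  exact ⟨P, by rw [hP, mul_assoc, P.mul_inv, mul_one]⟩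

/-- A `θ*`-fixed `g`, with `(g, h)` compatible with the Galois action, gives a norm diagram. -/
theorem Comparison.exists_normDiagram (C : Comparison hn ψ ι)
    {g : GL (Fin n) (AlgebraicClosure F)} (hg : thetaStar n (AlgebraicClosure F) g = g)
    (h : SO m (AlgebraicClosure F))
    (hgal : ∀ (σ : AlgebraicClosure F ≃ₐ[F] AlgebraicClosure F)
      (a : Fin n → (AlgebraicClosure F)ˣ), ∃ a',
        galGL σ (g * diagGL a * g⁻¹) = g * diagGL a' * g⁻¹ ∧
        galSO σ (h * C.stdSO a * h⁻¹) = h * C.stdSO a' * h⁻¹) :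
    ∃ (T' : Subgroup (GL (Fin n) (AlgebraicClosure F)))
      (e : Coinvariants (thetaStar n (AlgebraicClosure F)) T' ≃*
        conjSubgroup h (soDiagTorus m (AlgebraicClosure F))),
      NormDiagram hn ψ (conjSubgroup h (soDiagTorus m (AlgebraicClosure F))) T' e := by
  obtain ⟨e, he⟩ := C.exists_mulEquiv hg h
  refine ⟨_, e, ?_⟩
  have hmem : ∀ t : conjSubgroup g (diagTorus n (AlgebraicClosure F)),
      ∃ a, t.1 = g * diagGL a * g⁻¹ := by
    rintro ⟨_, _, ⟨a, rfl⟩, rfl⟩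
    exact ⟨a, rfl⟩
  have hmem' : ∀ a, g * diagGL a * g⁻¹ ∈ conjSubgroup g (diagTorus n (AlgebraicClosure F)) :=
    fun a => ⟨diagGL a, ⟨a, rfl⟩, rfl⟩
  -- As θ* fixes g, ordinary conjugation by g is θ*-conjugation, so all questions on T' move to the
  -- diagonal torus.
  have htw : ∀ a, TwistedConj (thetaStar n (AlgebraicClosure F)) (diagGL a)
      (g * diagGL a * g⁻¹) := fun a => ⟨g, by rw [hg]⟩
  have hconj : ∀ a (t : conjSubgroup g (diagTorus n (AlgebraicClosure F))),
      t.1 = g * diagGL a * g⁻¹ →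
      IsConj (e (QuotientGroup.mk t)).1.1.val (ψ (normTheta t.1).val) := fun a t ht => by
    rw [he a t ht]
    have h1 : IsConj (h * C.stdSO a * h⁻¹) (C.stdSO a) :=
      isConj_iff.2 ⟨h⁻¹, by group⟩
    refine (isConj_val h1).trans ?_
    rw [← C.map_normTheta_diagGL, ht]
    exact C.map_isConj (htw a).isConj_normTheta
  have hgalE : ∀ (σ : AlgebraicClosure F ≃ₐ[F] AlgebraicClosure F)
      (t t' : conjSubgroup g (diagTorus n (AlgebraicClosure F))), t'.1 = galGL σ t.1 →
      (e (QuotientGroup.mk t')).1 = galSO σ (e (QuotientGroup.mk t)).1 := fun σ t t' ht' => by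
    obtain ⟨a, ha⟩ := hmem t
    obtain ⟨a', h1, h2⟩ := hgal σ a
    rw [he a t ha, h2]
    exact he a' t' (by rw [ht', ha, h1])
  have hcomm : ∀ t : conjSubgroup g (diagTorus n (AlgebraicClosure F)),
      StronglyRegular (thetaStar n (AlgebraicClosure F)) t.1 →
      ∀ Z, ConjClasses.mk Z ∈ normCorr m (t.1 * gTheta n (AlgebraicClosure F)) →
        IsConj Z (e (QuotientGroup.mk t)).1 := fun t hr Z hZ => by
    obtain ⟨a, ha⟩ := hmem t
    have h1 : t.1 * gTheta n (AlgebraicClosure F) * (gTheta n (AlgebraicClosure F))⁻¹ = t.1 := by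
      group
    have h2 := C.isConj_of_mem_normCorr (a := a) (by rwa [h1]) (by rw [h1, ha]; exact htw a) hZ
    rw [h1] at h2
    exact SO_isConj_of_isConj (h2.trans (hconj a t ha).symm)
  refine ⟨⟨⟨g, rfl⟩, ?_⟩, ?_, ⟨⟨g, h, ⟨?_, ?_⟩, rfl, rfl, ?_⟩, ?_⟩, ?_, ?_, ?_, ?_, ?_⟩
  · intro σ t ht
    obtain ⟨a, ha⟩ := hmem ⟨t, ht⟩
    have ha : t = _ := ha
    obtain ⟨a', h1, -⟩ := hgal σ a
    rw [ha, h1]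
    exact hmem' a'
  · exact map_conjSubgroup_eq thetaStar_thetaStar hg fun x => thetaStar_mem_diagTorus
  · exact map_conjSubgroup_eq thetaStar_thetaStar hg fun x => thetaStar_mem_upperBorel
  · exact map_conjSubgroup_eq thetaStar_thetaStar hg fun x => thetaStar_mem_diagTorus
  · intro a t ht
    rw [he a t ht, ← C.stdSO_val]
    congr 1
    group
  · exact hgalE
  · intro t
    obtain ⟨a, ha⟩ := hmem t
    exact exists_conj_eq_of_isConj (hconj a t ha)
  · intro t hr
    obtain ⟨a, ha⟩ := hmem t
    apply Set.Subset.antisymm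
    · intro c hc
      obtain ⟨Z, rfl⟩ := ConjClasses.exists_rep c
      exact ConjClasses.mk_eq_mk_iff_isConj.2 (hcomm t hr Z hc)
    · rintro _ rfl
      have h1 : TwistedConj (epsilon n (AlgebraicClosure F))
          (diagGL a * gTheta n (AlgebraicClosure F)) (t.1 * gTheta n (AlgebraicClosure F)) := by
        rw [twistedConj_epsilon_iff, mul_inv_cancel_right, mul_inv_cancel_right, ha]
        exact htw a
      -- All classes of the correspondence coincide with that of e(t); equality still needs one to
      -- exist, and the diagonal ε-conjugate has an explicit solution.
      obtain ⟨c, hc⟩ : (normCorr m (t.1 * gTheta n (AlgebraicClosure F))).Nonempty := by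
        rw [← normCorr_eq_of_twistedConj h1, gTheta, ← diagGL_mul]
        exact normCorr_nonempty (C.inN_diagGL _)
      obtain ⟨Z, rfl⟩ := ConjClasses.exists_rep c
      rwa [← ConjClasses.mk_eq_mk_iff_isConj.2 (hcomm t hr Z hc)]
  · intro δ t ht hr
    -- A rational t is Galois-fixed, so e(t) is too, and fixed points of the Galois group are
    -- rational.
    obtain ⟨γ, hγ⟩ := exists_barSO_eq (z := (e (QuotientGroup.mk t)).1) fun σ => by
      refine (hgalE σ t t ?_).symm
      rw [ht]
      apply Units.ext
      ext i j
      exact (σ.commutes _).symm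
    refine ⟨γ, hγ, fun γ₁ hγ₁ => ?_⟩
    have h1 := mem_normCorr_map (algebraMap F (AlgebraicClosure F)) hγ₁
    rw [_root_.map_mul, map_gTheta] at h1
    change IsConj (barSO γ) (barSO γ₁)
    rw [hγ]
    refine (hcomm t hr (barSO γ₁) ?_).symm
    rw [ht]
    exact h1
  · intro t
    obtain ⟨a, ha⟩ := hmem t
    exact C.imageMap_eq (a := a) (by rw [ha]; exact htw a) (hconj a t ha)
  · intro t hr
    obtain ⟨a, ha⟩ := hmem t
    have hr' : StronglyRegular (thetaStar n (AlgebraicClosure F)) (diagGL a) :=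
      hr.of_twistedConj (by rw [ha]; exact (htw a).symm)
    ext x
    constructor
    · intro hx
      have hx1 : x ∈ twistedCentralizer (thetaStar n (AlgebraicClosure F))
          (g * diagGL a * (thetaStar n (AlgebraicClosure F) g)⁻¹) := by rwa [hg, ← ha]
      rw [mem_twistedCentralizer_twist] at hx1
      -- Strong regularity makes the centralizer diagonal after conjugation; commuting diagonal
      -- factors then reduce the twisted equation to θ*(b) = b.
      obtain ⟨b, hb⟩ := hr'.exists_diagGL hx1
      have hxb : x = g * diagGL b * g⁻¹ := by rw [← hb]; group
      have hθb : thetaStar n (AlgebraicClosure F) (diagGL b) = diagGL b := by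
        rw [hb, mem_twistedCentralizer, ← diagGL_mul, mul_comm, diagGL_mul, mul_assoc,
          mul_eq_left, mul_inv_eq_one] at hx1
        exact hx1.symm
      refine ⟨hxb ▸ hmem' b, ?_⟩
      change thetaStar n (AlgebraicClosure F) x = x
      rw [hxb, _root_.map_mul, _root_.map_mul, map_inv, hg, hθb]
    · rintro ⟨hx, hxθ⟩
      have hxθ : thetaStar n (AlgebraicClosure F) x = x := hxθ
      obtain ⟨b, hb⟩ := hmem ⟨x, hx⟩
      have hb : x = g * diagGL b * g⁻¹ := hb
      rw [mem_twistedCentralizer, hxθ, mul_inv_eq_iff_eq_mul, hb, ha]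
      calc g * diagGL b * g⁻¹ * (g * diagGL a * g⁻¹) = g * (diagGL b * diagGL a) * g⁻¹ := by group
        _ = g * (diagGL a * diagGL b) * g⁻¹ := by rw [← diagGL_mul, mul_comm, diagGL_mul]
        _ = _ := by group

end NormDiagrams

/-! ### Galois descent for subspaces of matrices -/

section Descent

variable {F : Type*} [Field F] [CharZero F]

/-- Galois descent: a subspace that is stable under the Galois group is spanned by its rational
elements. -/
theorem mem_span_rational {p q : Type*} [Fintype p] [Fintype q]
    (W : Submodule (AlgebraicClosure F) (Matrix p q (AlgebraicClosure F)))
    (hW : ∀ (σ : AlgebraicClosure F ≃ₐ[F] AlgebraicClosure F), ∀ X ∈ W, X.map σ ∈ W)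
    {X : Matrix p q (AlgebraicClosure F)} (hX : X ∈ W) :
    X ∈ Submodule.span (AlgebraicClosure F)
      {Y | Y ∈ W ∧ ∃ Y₀ : Matrix p q F, Y₀.map (algebraMap F (AlgebraicClosure F)) = Y} := by
  classical
  let supp : Matrix p q (AlgebraicClosure F) → Finset (p × q) :=
    fun X => Finset.univ.filter fun z => X z.1 z.2 ≠ 0
  have hsupp : ∀ X z, z ∈ supp X ↔ X z.1 z.2 ≠ 0 := fun X z => by simp [supp]
  -- Induction on the number of non-zero entries: a non-rational X is written as a combination of
  -- elements of W with strictly smaller support.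
  induction hk : (supp X).card using Nat.strong_induction_on generalizing X with
  | _ k ih =>
  by_cases h0 : X = 0
  · rw [h0]; exact Submodule.zero_mem _
  obtain ⟨i, j, hij⟩ : ∃ i j, X i j ≠ 0 := by
    by_contra! h
    exact h0 (Matrix.ext h)
  -- One entry is normalized to 1, so that σ(X₁) - X₁ vanishes there and its support shrinks.
  set X₁ := (X i j)⁻¹ • X with hX₁
  have hX₁W : X₁ ∈ W := W.smul_mem _ hX
  have hs₁ : supp X₁ = supp X := by
    ext z
    rw [hsupp, hsupp, hX₁, Matrix.smul_apply, smul_eq_mul]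
    simp [hij]
  suffices X₁ ∈ Submodule.span (AlgebraicClosure F)
      {Y | Y ∈ W ∧ ∃ Y₀ : Matrix p q F, Y₀.map (algebraMap F (AlgebraicClosure F)) = Y} by
    have h1 : X = X i j • X₁ := by rw [hX₁, smul_smul, mul_inv_cancel₀ hij, one_smul]
    rw [h1]
    exact Submodule.smul_mem _ _ this
  by_cases hσ : ∀ σ : AlgebraicClosure F ≃ₐ[F] AlgebraicClosure F, X₁.map σ = X₁
  · exact Submodule.subset_span ⟨hX₁W, exists_matrix_of_galois_fixed hσ⟩
  push Not at hσ
  obtain ⟨σ, hσ⟩ := hσ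
  set D := X₁.map σ - X₁ with hD
  have hDW : D ∈ W := W.sub_mem (hW σ _ hX₁W) hX₁W
  have hDX : ∀ z : p × q, X₁ z.1 z.2 = 0 → D z.1 z.2 = 0 := fun z hz => by
    rw [hD, Matrix.sub_apply, Matrix.map_apply, hz, map_zero, sub_zero]
  have hDsub : supp D ⊆ supp X := by
    intro z hz
    rw [← hs₁, hsupp]
    exact fun h => (hsupp D z).1 hz (hDX z h)
  obtain ⟨a, b, hab⟩ : ∃ a b, D a b ≠ 0 := by
    by_contra! h
    exact hσ (sub_eq_zero.1 (Matrix.ext h))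
  have hDspan := ih _ (hk ▸ Finset.card_lt_card (Finset.ssubset_iff_subset_ne.2 ⟨hDsub, fun h => by
    have h1 : (i, j) ∈ supp D := by rw [h, hsupp]; exact hij
    rw [hsupp] at h1
    apply h1
    simp [hD, hX₁, hij]⟩)) hDW rfl
  -- The multiple of D is chosen to cancel the entry at (a, b).
  set X₂ := X₁ - (X₁ a b / D a b) • D with hX₂
  have hX₂span := ih (supp X₂).card (hk ▸ Finset.card_lt_card (Finset.ssubset_iff_subset_ne.2
    ⟨fun z hz => by
      rw [← hs₁, hsupp]
      intro h
      rw [hsupp] at hz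
      apply hz
      rw [hX₂, Matrix.sub_apply, Matrix.smul_apply, hDX z h, h, smul_zero, sub_zero],
    fun h => by
      have h1 : (a, b) ∈ supp X₂ := by rw [h]; exact hDsub ((hsupp D (a, b)).2 hab)
      rw [hsupp] at h1
      apply h1
      simp [hX₂, hab]⟩)) (W.sub_mem hX₁W (W.smul_mem _ hDW)) rfl
  have h1 : X₁ = X₂ + (X₁ a b / D a b) • D := by rw [hX₂, sub_add_cancel]
  rw [h1]
  exact Submodule.add_mem _ hX₂span (Submodule.smul_mem _ _ hDspan)

end Descent

/-! ### Skew matrices as pull-backs of u_{2m} -/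

section Alternating

variable {F : Type*} [Field F] [CharZero F]

/-- A skew-symmetric matrix of rank at most `2m` is a sum of `m` elementary ones. -/
theorem exists_sum_vecMulVec_of_skew {ι : Type*} [Fintype ι] [DecidableEq ι] (m : ℕ)
    (S : Matrix ι ι F) (hS : Sᵀ = -S)
    (hr : Fintype.card ι ≤ Module.finrank F (LinearMap.ker S.mulVecLin) + 2 * m) :
    ∃ f g : Fin m → ι → F,
      S = ∑ i, (vecMulVec (f i) (g i) - vecMulVec (g i) (f i)) := by
  have hskew : ∀ {S : Matrix ι ι F}, Sᵀ = -S → ∀ a b, S a b = -S b a := fun h a b => by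
    have := congrFun (congrFun h b) a
    rwa [transpose_apply, Matrix.neg_apply] at this
  have hdiag : ∀ {S : Matrix ι ι F}, Sᵀ = -S → ∀ a, S a a = 0 := fun h a =>
    self_eq_neg.1 (hskew h a a)
  have hcol : ∀ (S : Matrix ι ι F) a p, (S *ᵥ Pi.single a 1) p = S p a := fun S a p => by
    rw [mulVec_single_one]; rfl
  induction m generalizing S with
  | zero =>
    refine ⟨fun _ => 0, fun _ => 0, ?_⟩
    have h1 : LinearMap.ker S.mulVecLin = ⊤ := by
      apply Submodule.eq_top_of_finrank_eq
      rw [Module.finrank_fintype_fun_eq_card]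
      refine le_antisymm ?_ (by simpa using hr)
      simpa using Submodule.finrank_le (LinearMap.ker S.mulVecLin)
    ext p a
    have h2 : S.mulVecLin (Pi.single a 1) = 0 := by
      rw [← LinearMap.mem_ker, h1]; trivial
    have h3 := congrFun h2 p
    rw [mulVecLin_apply, hcol] at h3
    simpa using h3
  | succ m ih =>
    by_cases h0 : S = 0
    · exact ⟨fun _ => 0, fun _ => 0, by ext; simp [h0]⟩
    obtain ⟨a, b, hab⟩ : ∃ a b, S a b ≠ 0 := by
      by_contra! h
      exact h0 (Matrix.ext h)
    let ca : ι → F := fun p => S p a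
    let cb : ι → F := fun p => S p b
    let f₀ : ι → F := (S a b)⁻¹ • ca
    -- E is the skew matrix of rank two that agrees with S in columns a and b; subtracting it is
    -- symplectic elimination.
    set E := vecMulVec f₀ cb - vecMulVec cb f₀ with hE
    have hEapply : ∀ p q, E p q = (S a b)⁻¹ * (S p a * S q b - S p b * S q a) := fun p q => by
      simp only [hE, f₀, ca, cb, Matrix.sub_apply, vecMulVec_apply, Pi.smul_apply, smul_eq_mul]
      ring
    set S' := S - E with hS'
    have hS'skew : S'ᵀ = -S' := by
      ext p q
      rw [transpose_apply, Matrix.neg_apply, hS', Matrix.sub_apply, Matrix.sub_apply, hEapply,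
        hEapply, hskew hS q p]
      ring
    have hSb : S b a = -S a b := hskew hS b a
    have hea : S' *ᵥ Pi.single a 1 = 0 := by
      ext p
      rw [hcol, hS', Matrix.sub_apply, hEapply, hdiag hS a]
      simp only [Pi.zero_apply]
      field_simp
      ring
    have heb : S' *ᵥ Pi.single b 1 = 0 := by
      ext p
      rw [hcol, hS', Matrix.sub_apply, hEapply, hdiag hS b, hSb]
      simp only [Pi.zero_apply]
      field_simp
      ring
    -- The chain ker S < K₁ < ker S' is strict at both steps, the vectors e_a and e_b being new in
    -- turn, so the kernel gains at least two dimensions.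
    let K₁ : Submodule F (ι → F) :=
      LinearMap.ker S'.mulVecLin ⊓ LinearMap.ker ((LinearMap.proj a).comp S.mulVecLin)
    have hrow : ∀ v, S *ᵥ v = 0 → ∀ c, ∑ q, S q c * v q = 0 := fun v hv c => by
      have h1 := congrFun hv c
      rw [mulVec, dotProduct] at h1
      rw [← neg_eq_zero, ← Finset.sum_neg_distrib]
      rw [Pi.zero_apply] at h1
      rw [← h1]
      exact Finset.sum_congr rfl fun q _ => by rw [hskew hS c q, neg_mul]
    have hlt₁ : LinearMap.ker S.mulVecLin < K₁ := by
      refine lt_of_le_of_ne (fun v hv => ?_) fun h => ?_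
      · have hv : S *ᵥ v = 0 := hv
        refine ⟨?_, ?_⟩
        · change S' *ᵥ v = 0
          have hEv : E *ᵥ v = 0 := by
            ext p
            have h1 : (E *ᵥ v) p = (S a b)⁻¹ * (S p a * ∑ q, S q b * v q -
                S p b * ∑ q, S q a * v q) := by
              rw [Finset.mul_sum, Finset.mul_sum, ← Finset.sum_sub_distrib, Finset.mul_sum]
              refine Finset.sum_congr rfl fun q _ => ?_
              change E p q * v q = _
              rw [hEapply]
              ring
            rw [h1, hrow v hv, hrow v hv]
            simp
          rw [hS', Matrix.sub_mulVec, hv, hEv, sub_zero]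
        · change (S *ᵥ v) a = 0
          rw [hv]; rfl
      · have h1 : Pi.single a 1 ∈ K₁ := by
          refine ⟨hea, ?_⟩
          change (S *ᵥ Pi.single a 1) a = 0
          rw [hcol, hdiag hS]
        rw [← h] at h1
        have h2 := congrFun (show S *ᵥ Pi.single a 1 = 0 from h1) b
        rw [hcol, hSb] at h2
        exact hab (neg_eq_zero.1 h2)
    have hlt₂ : K₁ < LinearMap.ker S'.mulVecLin := by
      refine lt_of_le_of_ne inf_le_left fun h => ?_
      have h1 : Pi.single b 1 ∈ LinearMap.ker S'.mulVecLin := heb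
      rw [← h] at h1
      have h2 : (S *ᵥ Pi.single b 1) a = 0 := h1.2
      rw [hcol] at h2
      exact hab h2
    have h1 := Submodule.finrank_lt_finrank_of_lt hlt₁
    have h2 := Submodule.finrank_lt_finrank_of_lt hlt₂
    obtain ⟨f, g, hfg⟩ := ih S' hS'skew (by omega)
    refine ⟨Fin.cons f₀ f, Fin.cons cb g, ?_⟩
    rw [Fin.sum_univ_succ]
    simp only [Fin.cons_zero, Fin.cons_succ]
    rw [← hfg, hS', hE, add_sub_cancel]

/-- A skew-symmetric matrix of rank at most `2m` is a pull-back of the form `u_{2m}`. -/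
theorem exists_pullback_uGL {ι : Type*} [Fintype ι] [DecidableEq ι] (m : ℕ)
    (S : Matrix ι ι F) (hS : Sᵀ = -S)
    (hr : Fintype.card ι ≤ Module.finrank F (LinearMap.ker S.mulVecLin) + 2 * m) :
    ∃ r : Matrix (Fin (2 * m)) ι F, rᵀ * (uGL (2 * m) F).val * r = S := by
  obtain ⟨f, g, rfl⟩ := exists_sum_vecMulVec_of_skew m S hS hr
  let e : Fin m ⊕ Fin m ≃ Fin (2 * m) := finSumFinEquiv.trans (finCongr (two_mul m).symm)
  have he : ∀ k, (e (Sum.inl k)).rev = e (Sum.inr k.rev) := fun k => by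
    apply Fin.ext
    simp [e, Fin.val_rev]
    omega
  -- The rows at an index and its reversal form a hyperbolic pair for u_{2m}. The sign on the f-row
  -- absorbs that of u_{2m}; in even size the reversed sign is opposite, which produces the skew
  -- difference.
  let r : Matrix (Fin (2 * m)) ι F := of fun i p =>
    Sum.elim (fun k => signTheta F (e (Sum.inl k)) * f k p) (fun k => g k.rev p) (e.symm i)
  have hrl : ∀ k p, r (e (Sum.inl k)) p = signTheta F (e (Sum.inl k)) * f k p := fun k p => by
    simp [r]
  have hrr : ∀ k p, r (e (Sum.inl k)).rev p = g k p := fun k p => by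
    rw [he]; simp [r]
  refine ⟨r, ?_⟩
  ext p q
  have h1 : (rᵀ * (uGL (2 * m) F).val * r) p q =
      ∑ i, r i p * signTheta F i * r i.rev q := by
    rw [uGL_val, ← Matrix.mul_assoc, Matrix.mul_assoc, mul_apply]
    refine Finset.sum_congr rfl fun i _ => ?_
    rw [mul_diagonal, wMat_mul_apply, transpose_apply]
  have h2 : ∀ G : Fin (2 * m) → F, ∑ i, G i =
      ∑ k, (G (e (Sum.inl k)) + G (e (Sum.inl k)).rev) := fun G => by
    rw [← e.sum_comp, Fintype.sum_sum_type, Finset.sum_add_distrib]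
    congr 1
    rw [← Equiv.sum_comp Fin.revPerm]
    exact Finset.sum_congr rfl fun k _ => by rw [he]; rfl
  rw [h1, h2, Matrix.sum_apply]
  refine Finset.sum_congr rfl fun k _ => ?_
  rw [Fin.rev_rev, hrl, hrl, hrr, hrr, signTheta_rev, Matrix.sub_apply, vecMulVec_apply,
    vecMulVec_apply, pow_succ, pow_mul]
  have h3 := signTheta_mul_self (K := F) (e (Sum.inl k))
  simp only [even_two, Even.neg_pow, one_pow]
  linear_combination (f k p * g k q - g k p * f k q) * h3

end Alternating

/-! ### Making a basis change θ*-fixed -/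

section Antidiagonal

variable {n : ℕ} {K : Type*} [Field K] [IsAlgClosed K]

/-- If `u_n` is antidiagonal in the basis given by `g`, then `g` can be made `θ*`-fixed by a
diagonal matrix. -/
theorem exists_thetaStar_fixed {g : GL (Fin n) K}
    (h : ∀ i j, j ≠ i.rev → (g.valᵀ * (uGL n K).val * g.val) i j = 0) :
    ∃ b, thetaStar n K (g * diagGL b) = g * diagGL b := by
  -- The discrepancy θ*(g)⁻¹ g is u_n ᵗg u_n g up to sign, so antidiagonality of the form makes it
  -- diagonal.
  obtain ⟨s, hs⟩ : ∃ s, (thetaStar n K g)⁻¹ * g = diagGL s := by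
    refine exists_diagGL_of_isDiag fun i j hij => ?_
    have h1 : ((thetaStar n K g)⁻¹).val * (uGL n K).val * ((uGL n K).val * g.val) =
        (uGL n K).val * (g.valᵀ * (uGL n K).val * g.val) := by
      rw [thetaStar_inv_mul_uGL]; simp only [Matrix.mul_assoc]
    have h2 : ((thetaStar n K g)⁻¹).val * (uGL n K).val * ((uGL n K).val * g.val) =
        (-1 : K) ^ (n + 1) • ((thetaStar n K g)⁻¹ * g).val := by
      rw [Matrix.mul_assoc, ← Matrix.mul_assoc (uGL n K).val, uGL_mul_self, Matrix.smul_mul,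
        Matrix.one_mul, Matrix.mul_smul, Units.val_mul]
    rw [h2, uGL_val, Matrix.mul_assoc] at h1
    have h3 := congrFun (congrFun h1 i) j
    rw [Matrix.smul_apply, diagonal_mul, wMat_mul_apply, ← uGL_val, h _ _ (by
      rw [Fin.rev_rev]; exact fun e => hij e.symm), mul_zero, smul_eq_mul] at h3
    exact (mul_eq_zero.1 h3).resolve_left (pow_ne_zero _ (neg_ne_zero.2 one_ne_zero))
  -- Applying θ* inverts the discrepancy, hence s is invariant under reversal and b = s^(-1/2)
  -- satisfies θ*(b) = s b, which absorbs it.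
  have hsym : ∀ i, s i.rev = s i := by
    have h1 : thetaStar n K (diagGL s) = (diagGL s)⁻¹ := by
      rw [← hs, map_mul, map_inv, thetaStar_thetaStar]; group
    rw [thetaStar_diagGL, ← diagGL_inv, diagGL_injective.eq_iff, funext_iff] at h1
    exact fun i => _root_.inv_injective (h1 i)
  obtain ⟨sq, hsq⟩ := exists_units_sqrt (K := K)
  refine ⟨fun i => sq (s i)⁻¹, ?_⟩
  have h1 : thetaStar n K (diagGL fun i => sq (s i)⁻¹) =
      diagGL s * diagGL fun i => sq (s i)⁻¹ := by
    rw [thetaStar_diagGL, ← diagGL_mul]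
    congr 1
    funext i
    rw [hsym, Pi.mul_apply, inv_eq_iff_mul_eq_one, mul_left_comm, hsq, mul_inv_cancel]
  rw [map_mul, h1, ← mul_assoc, ← hs]
  group

end Antidiagonal

/-! ### Cartan subgroups and rational intertwiners -/

section Cartan

variable {F : Type*} [Field F] {m n : ℕ}

theorem regularDiag_mem_SO {K : Type*} [Field K] [CharZero K] :
    diagGL (regularDiag (2 * m + 1) K) ∈ SO m K := by
  rw [diagGL_mem_SO_iff]
  refine ⟨fun i => by rw [regularDiag_rev, mul_inv_cancel], ?_⟩
  simp [regularDiag, mid]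

theorem galGL_eq (σ : AlgebraicClosure F ≃ₐ[F] AlgebraicClosure F)
    (g : GL (Fin n) (AlgebraicClosure F)) :
    galGL σ g = GeneralLinearGroup.map (σ : AlgebraicClosure F →+* AlgebraicClosure F) g := rfl

theorem galSO_mul (σ : AlgebraicClosure F ≃ₐ[F] AlgebraicClosure F)
    (x y : SO m (AlgebraicClosure F)) : galSO σ (x * y) = galSO σ x * galSO σ y :=
  Subtype.ext (map_mul (GeneralLinearGroup.map (σ : AlgebraicClosure F →+* AlgebraicClosure F))
    x.1 y.1)

theorem map_rational (σ : AlgebraicClosure F ≃ₐ[F] AlgebraicClosure F) {p q : Type*}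
    (A : Matrix p q F) : (A.map (algebraMap F (AlgebraicClosure F))).map σ =
      A.map (algebraMap F (AlgebraicClosure F)) := by
  ext i j
  exact σ.commutes _

variable [CharZero F]

/-- The cocycle of a maximal torus `h T₀ h⁻¹` defined over `F` consists of monomial matrices. -/
theorem isRowMonomial_cocycle {h : SO m (AlgebraicClosure F)}
    (hT : ∀ σ : AlgebraicClosure F ≃ₐ[F] AlgebraicClosure F,
      ∀ t ∈ conjSubgroup h (soDiagTorus m (AlgebraicClosure F)),
        galSO σ t ∈ conjSubgroup h (soDiagTorus m (AlgebraicClosure F)))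
    (σ : AlgebraicClosure F ≃ₐ[F] AlgebraicClosure F) :
    IsRowMonomial (h⁻¹ * galSO σ h).1.val := by
  -- The test element is rational and has distinct eigenvalues, so conjugating it by the cocycle
  -- already shows that the cocycle permutes the coordinate lines.
  let t : SO m (AlgebraicClosure F) := ⟨_, regularDiag_mem_SO⟩
  have ht : galSO σ t = t := Subtype.ext (map_regularDiag _)
  have h1 := hT σ (h * t * h⁻¹) ⟨t, ⟨regularDiag _ _, rfl⟩, rfl⟩
  rw [mem_conjSubgroup] at h1
  obtain ⟨y, hy⟩ := h1
  have hy : diagGL y = (h⁻¹ * galSO σ (h * t * h⁻¹) * h).1 := hy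
  have h2 : h⁻¹ * galSO σ h * t = h⁻¹ * galSO σ (h * t * h⁻¹) * h * (h⁻¹ * galSO σ h) := by
    have h3 : galSO σ (h * t * h⁻¹) * galSO σ h = galSO σ h * t := by
      rw [← galSO_mul, inv_mul_cancel_right, galSO_mul, ht]
    calc h⁻¹ * galSO σ h * t = h⁻¹ * (galSO σ (h * t * h⁻¹) * galSO σ h) := by rw [h3, mul_assoc]
      _ = _ := by group
  refine isRowMonomial_of_mul_diagonal (t' := fun i => (y i : AlgebraicClosure F)) ?_
    regularDiag_injective
  have h4 := congrArg (fun z : SO m (AlgebraicClosure F) => z.1.val) h2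
  have h5 : (h⁻¹ * galSO σ (h * t * h⁻¹) * h * (h⁻¹ * galSO σ h)).1.val =
      (h⁻¹ * galSO σ (h * t * h⁻¹) * h).1.val * (h⁻¹ * galSO σ h).1.val := rfl
  beta_reduce at h4
  rw [h5, ← hy] at h4
  exact h4

variable {hn : 2 * m ≤ n}
  {ψ : Matrix (Fin n) (Fin n) (AlgebraicClosure F) →
    Matrix (Fin (2 * m + 1)) (Fin (2 * m + 1)) (AlgebraicClosure F)}
  {ι : Fin n → Fin (2 * m + 1)}

/-- A rational matrix `r` that takes the eigenvectors of `T` to a basis in which `u_n` is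
antidiagonal (and the invariant vector to `0` if `n = 2m`) gives a norm diagram. -/
theorem Comparison.exists_normDiagram_of_rational (C : Comparison hn ψ ι)
    {h : SO m (AlgebraicClosure F)}
    (hT : ∀ σ : AlgebraicClosure F ≃ₐ[F] AlgebraicClosure F,
      ∀ t ∈ conjSubgroup h (soDiagTorus m (AlgebraicClosure F)),
        galSO σ t ∈ conjSubgroup h (soDiagTorus m (AlgebraicClosure F)))
    (r : Matrix (Fin n) (Fin (2 * m + 1)) F) (g : GL (Fin n) (AlgebraicClosure F))
    (hg : ∀ i k, g.val i k = (r.map (algebraMap F (AlgebraicClosure F)) * h.1.val) i (ι k))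
    (hr : ∀ i j, (∀ k, ι k ≠ j) →
      (r.map (algebraMap F (AlgebraicClosure F)) * h.1.val) i j = 0)
    (hu : ∀ i j, j ≠ i.rev →
      (g.valᵀ * (uGL n (AlgebraicClosure F)).val * g.val) i j = 0) :
    ∃ (T' : Subgroup (GL (Fin n) (AlgebraicClosure F)))
      (e : Coinvariants (thetaStar n (AlgebraicClosure F)) T' ≃*
        conjSubgroup h (soDiagTorus m (AlgebraicClosure F))),
      NormDiagram hn ψ (conjSubgroup h (soDiagTorus m (AlgebraicClosure F))) T' e := by
  obtain ⟨b, hb⟩ := exists_thetaStar_fixed hu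
  refine C.exists_normDiagram hb h fun σ a => ?_
  set R := r.map (algebraMap F (AlgebraicClosure F)) with hR
  have hRσ : R.map σ = R := map_rational σ r
  -- p is the projection onto the coordinates in the image of ι; the hypotheses on r say R h = g p.
  let p : Matrix (Fin n) (Fin (2 * m + 1)) (AlgebraicClosure F) :=
    of fun i j => if j = ι i then 1 else 0
  have hp : ∀ (A : Matrix (Fin (2 * m + 1)) (Fin (2 * m + 1)) (AlgebraicClosure F)) i j,
      (p * A) i j = A (ι i) j := fun A i j => by simp [p, mul_apply]
  have hRp : R * h.1.val = g.val * p := by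
    ext i j
    by_cases hj : ∃ k, ι k = j
    · obtain ⟨k, rfl⟩ := hj
      rw [← hg, mul_apply, Finset.sum_eq_single k]
      · simp [p]
      · intro l _ hl
        simp [p, C.inj.ne hl.symm]
      · simp
    · push Not at hj
      rw [hr i j hj, mul_apply, Finset.sum_eq_zero]
      intro l _
      simp [p, (hj l).symm]
  have hconj : ∀ a, g * diagGL b * diagGL a * (g * diagGL b)⁻¹ = g * diagGL a * g⁻¹ := fun a => by
    calc g * diagGL b * diagGL a * (g * diagGL b)⁻¹
        = g * (diagGL b * diagGL a) * (diagGL b)⁻¹ * g⁻¹ := by group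
      _ = g * (diagGL a * diagGL b) * (diagGL b)⁻¹ * g⁻¹ := by
          rw [← diagGL_mul, mul_comm, diagGL_mul]
      _ = _ := by group
  set z := h⁻¹ * galSO σ h with hz
  have hzmono : IsRowMonomial z.1.val := isRowMonomial_cocycle hT σ
  have hσh : (galSO σ h).1.val = h.1.val * z.1.val := by
    have : galSO σ h = h * z := by rw [hz]; group
    rw [this]; rfl
  -- Rationality of R makes the cocycle of g a block of the cocycle of h. It is therefore monomial,
  -- and g T'₀ g⁻¹ is Galois-stable.
  have hx : (g⁻¹ * galGL σ g).val = z.1.val.submatrix ι ι := by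
    apply g.isUnit.mul_left_cancel
    rw [← Units.val_mul, mul_inv_cancel_left]
    ext i k
    have h1 : (galGL σ g).val i k = (R * (galSO σ h).1.val) i (ι k) := by
      change σ (g.val i k) = _
      rw [hg, ← Matrix.map_apply (f := σ) (M := R * h.1.val), Matrix.map_mul, hRσ]
      rfl
    rw [h1, hσh, ← Matrix.mul_assoc, hRp, Matrix.mul_assoc, mul_apply, mul_apply]
    simp only [hp, submatrix_apply]
  have hxmono : IsRowMonomial (g⁻¹ * galGL σ g).val := by
    rw [hx]
    exact fun i j k hj hk => C.inj (hzmono _ _ _ hj hk)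
  have hgal₁ : ∃ a', galGL σ (g * diagGL a * g⁻¹) = g * diagGL a' * g⁻¹ := by
    obtain ⟨a', ha'⟩ := hxmono.exists_mul_diagGL
      fun i => Units.map (σ : AlgebraicClosure F →+* AlgebraicClosure F).toMonoidHom (a i)
    refine ⟨a', ?_⟩
    rw [← ha', galGL_eq, _root_.map_mul, _root_.map_mul, map_inv, map_diagGL, galGL_eq]
    group
  obtain ⟨a', ha'⟩ := hgal₁
  refine ⟨a', by rw [hconj, hconj, ha'], ?_⟩
  have hnorm : ∀ a, (normTheta (g * diagGL a * g⁻¹)).val =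
      g.val * (diagonal fun i => ((a i / a i.rev : (AlgebraicClosure F)ˣ) : AlgebraicClosure F)) *
        (g⁻¹).val := fun a => by
    have h1 : g * diagGL a * g⁻¹ = g * diagGL b * diagGL a *
        (thetaStar n (AlgebraicClosure F) (g * diagGL b))⁻¹ := by rw [hb, hconj]
    rw [h1, normTheta_mul_twist, normTheta_diagGL, hconj]
    rfl
  have hpstd : ∀ a, p * (diagGL (stdTorusMap hn a)).val =
      (diagonal fun i => ((a i / a i.rev : (AlgebraicClosure F)ˣ) : AlgebraicClosure F)) * p :=
    fun a => by
      ext i j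
      rw [diagGL_val, mul_diagonal, diagonal_mul]
      simp only [p, of_apply]
      split_ifs with hj
      · rw [hj, C.std, one_mul, mul_one]
      · rw [zero_mul, mul_zero]
  have hcancel : ∀ A B : Matrix (Fin n) (Fin (2 * m + 1)) (AlgebraicClosure F),
      A * h.1.val = B * h.1.val → A = B := fun A B hAB => by
    have h1 := congrArg (· * (h.1⁻¹).val) hAB
    beta_reduce at h1
    rwa [Matrix.mul_assoc, Matrix.mul_assoc, h.1.mul_inv, Matrix.mul_one, Matrix.mul_one] at h1
  -- R intertwines e(t) with N(t). Applying σ to this rational relation compares σ(e(t)) with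
  -- e(σ(t)).
  have hkey : ∀ a, R * (h * C.stdSO a * h⁻¹).1.val =
      (normTheta (g * diagGL a * g⁻¹)).val * R := fun a => by
    apply hcancel
    have h1 : (h * C.stdSO a * h⁻¹).1.val * h.1.val =
        h.1.val * (diagGL (stdTorusMap hn a)).val := by
      have : h * C.stdSO a * h⁻¹ * h = h * C.stdSO a := by group
      exact congrArg (fun z : SO m (AlgebraicClosure F) => z.1.val) this
    rw [Matrix.mul_assoc, h1, ← Matrix.mul_assoc, hRp, Matrix.mul_assoc, hpstd, hnorm,
      Matrix.mul_assoc _ R, hRp]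
    calc _ = g.val * (diagonal fun i => ((a i / a i.rev : (AlgebraicClosure F)ˣ) :
          AlgebraicClosure F)) * (((g⁻¹).val * g.val) * p) := by
          rw [g.inv_mul, Matrix.one_mul, Matrix.mul_assoc]
      _ = _ := by simp only [Matrix.mul_assoc]
  have hσkey : R * (galSO σ (h * C.stdSO a * h⁻¹)).1.val = R * (h * C.stdSO a' * h⁻¹).1.val := by
    have h1 := congrArg (fun A => A.map σ) (hkey a)
    beta_reduce at h1
    rw [Matrix.map_mul, Matrix.map_mul, hRσ] at h1
    rw [hkey, ← ha', galGL_eq, ← map_normTheta]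
    exact h1
  -- R may have a kernel, so R cannot simply be cancelled. Both elements lie in T, however, and are
  -- determined there by their non-middle eigenvalues, which R detects.
  have hmem := hT σ (h * C.stdSO a * h⁻¹) ⟨C.stdSO a, ⟨_, rfl⟩, rfl⟩
  rw [mem_conjSubgroup] at hmem
  obtain ⟨a'', ha''⟩ := C.exists_stdSO_eq hmem
  have hfin : galSO σ (h * C.stdSO a * h⁻¹) = h * C.stdSO a'' * h⁻¹ := by rw [ha'']; group
  rw [hfin]
  have h2 : p * (diagGL (stdTorusMap hn a'')).val = p * (diagGL (stdTorusMap hn a')).val := by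
    have h1 : ∀ a, R * (h * C.stdSO a * h⁻¹).1.val * h.1.val =
        g.val * (p * (diagGL (stdTorusMap hn a)).val) := fun a => by
      have : h * C.stdSO a * h⁻¹ * h = h * C.stdSO a := by group
      have := congrArg (fun z : SO m (AlgebraicClosure F) => z.1.val) this
      rw [Matrix.mul_assoc, ← Matrix.mul_assoc g.val, ← hRp, Matrix.mul_assoc]
      exact congrArg (R * ·) this
    have h3 := h1 a''
    rw [← hfin, hσkey, h1] at h3
    have h4 := congrArg ((g⁻¹).val * ·) h3
    beta_reduce at h4
    rw [← Matrix.mul_assoc, ← Matrix.mul_assoc (g⁻¹).val g.val, g.inv_mul, Matrix.one_mul,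
      Matrix.one_mul] at h4
    exact h4.symm
  have h3 : stdTorusMap hn a'' = stdTorusMap hn a' := by
    funext j
    by_cases hj : j.val = m
    · rw [stdTorusMap_mid hn _ hj, stdTorusMap_mid hn _ hj]
    · obtain ⟨k, rfl⟩ := C.range j hj
      have h4 := congrFun (congrFun h2 k) (ι k)
      rw [hp, hp, diagGL_val, diagGL_val, diagonal_apply_eq, diagonal_apply_eq] at h4
      exact Units.ext h4
  have h4 : C.stdSO a'' = C.stdSO a' := Subtype.ext (by rw [C.stdSO_val, C.stdSO_val, h3])
  rw [h4]

end Cartan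

/-! ### Rational elements of Lie(T) and the two norm diagrams -/

section RegularElements

variable {F : Type*} [Field F] [CharZero F] {m : ℕ}

/-- The Lie algebra of a maximal torus of `SO_{2m+1}` defined over `F` contains a rational element
whose eigenvalues are non-zero, except for the middle one. -/
theorem exists_regular_skew {h : SO m (AlgebraicClosure F)}
    (hT : ∀ σ : AlgebraicClosure F ≃ₐ[F] AlgebraicClosure F,
      ∀ t ∈ conjSubgroup h (soDiagTorus m (AlgebraicClosure F)),
        galSO σ t ∈ conjSubgroup h (soDiagTorus m (AlgebraicClosure F))) :
    ∃ (x : Matrix (Fin (2 * m + 1)) (Fin (2 * m + 1)) F)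
      (y : Fin (2 * m + 1) → AlgebraicClosure F),
      xᵀ * wMat (2 * m + 1) F + wMat (2 * m + 1) F * x = 0 ∧
      x.map (algebraMap F (AlgebraicClosure F)) * h.1.val = h.1.val * diagonal y ∧
      y (mid m) = 0 ∧ ∀ i, i ≠ mid m → y i ≠ 0 := by
  set K := AlgebraicClosure F
  have hh : h.1.valᵀ * wMat (2 * m + 1) K * h.1.val = wMat (2 * m + 1) K := h.2.1
  have hi : (h.1⁻¹).val * h.1.val = 1 := h.1.inv_mul
  have hi' : h.1.val * (h.1⁻¹).val = 1 := h.1.mul_inv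
  -- W is the Lie algebra of T: elements skew for w and diagonal in the basis h.
  let W : Submodule K (Matrix (Fin (2 * m + 1)) (Fin (2 * m + 1)) K) :=
    { carrier := {X | Xᵀ * wMat (2 * m + 1) K + wMat (2 * m + 1) K * X = 0 ∧
        ∃ y, X * h.1.val = h.1.val * diagonal y}
      zero_mem' := ⟨by simp, 0, by simp⟩
      add_mem' := by
        rintro X X' ⟨h1, y, h2⟩ ⟨h1', y', h2'⟩
        refine ⟨?_, y + y', ?_⟩
        · rw [transpose_add, Matrix.add_mul, Matrix.mul_add, add_add_add_comm, h1, h1', add_zero]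
        · rw [Matrix.add_mul, h2, h2', ← Matrix.mul_add, diagonal_add]; rfl
      smul_mem' := by
        rintro c X ⟨h1, y, h2⟩
        refine ⟨?_, c • y, ?_⟩
        · rw [transpose_smul, Matrix.smul_mul, Matrix.mul_smul, ← smul_add, h1, smul_zero]
        · rw [Matrix.smul_mul, h2, ← Matrix.mul_smul, diagonal_smul] }
  have hW : ∀ (σ : K ≃ₐ[F] K), ∀ X ∈ W, X.map σ ∈ W := by
    rintro σ X ⟨h1, y, h2⟩
    have hσh : (galSO σ h).1.val = h.1.val * (h⁻¹ * galSO σ h).1.val := by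
      have : galSO σ h = h * (h⁻¹ * galSO σ h) := by group
      exact congrArg (fun z : SO m K => z.1.val) this
    obtain ⟨τ, -, hτ⟩ := (isRowMonomial_cocycle hT σ).exists_perm
    refine ⟨?_, fun i => σ (y (τ i)), ?_⟩
    · have h3 := congrArg (fun A => A.map (σ : K →+* K)) h1
      beta_reduce at h3
      rw [Matrix.map_add _ (map_add _), Matrix.map_mul, Matrix.map_mul, map_wMat,
        Matrix.map_zero _ (map_zero _), transpose_map] at h3
      exact h3
    · have h3 := congrArg (fun A => A.map (σ : K →+* K)) h2
      beta_reduce at h3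
      rw [Matrix.map_mul, Matrix.map_mul, diagonal_map (map_zero _)] at h3
      have h4 : X.map σ * (galSO σ h).1.val =
          (galSO σ h).1.val * diagonal (fun i => σ (y i)) := h3
      rw [hσh, Matrix.mul_assoc h.1.val, hτ, ← Matrix.mul_assoc, ← Matrix.mul_assoc] at h4
      exact (h⁻¹ * galSO σ h).1.isUnit.mul_right_cancel h4
  let φ : Fin (2 * m + 1) → Matrix (Fin (2 * m + 1)) (Fin (2 * m + 1)) K →ₗ[K] K := fun i =>
    { toFun := fun X => ((h.1⁻¹).val * X * h.1.val) i i
      map_add' := fun X X' => by rw [Matrix.mul_add, Matrix.add_mul, Matrix.add_apply]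
      map_smul' := fun c X => by rw [Matrix.mul_smul, Matrix.smul_mul, Matrix.smul_apply]; rfl }
  have hφ : ∀ i X y, X * h.1.val = h.1.val * diagonal y → φ i X = y i := fun i X y hX => by
    change ((h.1⁻¹).val * X * h.1.val) i i = y i
    rw [Matrix.mul_assoc, hX, ← Matrix.mul_assoc, hi, Matrix.one_mul, diagonal_apply_eq]
  have hskew : ∀ (y : Fin (2 * m + 1) → K) X, X * h.1.val = h.1.val * diagonal y →
      (Xᵀ * wMat (2 * m + 1) K + wMat (2 * m + 1) K * X = 0 ↔ ∀ i, y i + y i.rev = 0) := by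
    intro y X hX
    have h1 : h.1.valᵀ * (Xᵀ * wMat (2 * m + 1) K + wMat (2 * m + 1) K * X) * h.1.val =
        diagonal (fun i => y i + y i.rev) * wMat (2 * m + 1) K := by
      calc _ = (X * h.1.val)ᵀ * wMat (2 * m + 1) K * h.1.val +
            h.1.valᵀ * wMat (2 * m + 1) K * (X * h.1.val) := by
              rw [transpose_mul X]; simp only [Matrix.mul_add, Matrix.add_mul, Matrix.mul_assoc]
        _ = diagonal y * (h.1.valᵀ * wMat (2 * m + 1) K * h.1.val) +
            (h.1.valᵀ * wMat (2 * m + 1) K * h.1.val) * diagonal y := by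
              rw [hX, transpose_mul, diagonal_transpose]; simp only [Matrix.mul_assoc]
        _ = _ := by
              rw [hh]
              ext i j
              rw [Matrix.add_apply, diagonal_mul_wMat_apply, diagonal_mul_wMat_apply, mul_diagonal,
                wMat, of_apply]
              split_ifs with hij
              · rw [hij, one_mul]
              · rw [zero_mul, add_zero]
    constructor
    · intro h0 i
      rw [h0, Matrix.mul_zero, Matrix.zero_mul] at h1
      have h2 := congrFun (congrFun h1 i) i.rev
      rw [diagonal_mul_wMat_apply, if_pos rfl] at h2
      exact h2.symm
    · intro h0
      have h2 : (diagonal fun i => y i + y i.rev) = 0 := by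
        simp [h0]
      rw [h2, Matrix.zero_mul] at h1
      have hu : IsUnit h.1.valᵀ := by rw [Matrix.isUnit_transpose]; exact h.1.isUnit
      exact hu.mul_right_eq_zero.1 (h.1.isUnit.mul_left_eq_zero.1 h1)
  -- the `F`-rational elements, and those with a non-zero `i`-th eigenvalue
  let M : Matrix (Fin (2 * m + 1)) (Fin (2 * m + 1)) F →ₗ[F]
      Matrix (Fin (2 * m + 1)) (Fin (2 * m + 1)) K := (Algebra.linearMap F K).mapMatrix
  have hM : ∀ A, M A = A.map (algebraMap F K) := fun A => rfl
  let V : Submodule F (Matrix (Fin (2 * m + 1)) (Fin (2 * m + 1)) F) :=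
    (W.restrictScalars F).comap M
  let P : {i : Fin (2 * m + 1) // i ≠ mid m} → Submodule F V := fun i =>
    LinearMap.ker ((((φ i.1).restrictScalars F).comp M).comp V.subtype)
  -- If the i-th eigenvalue vanished on all rational elements it would vanish on their span W, which
  -- contains the element with eigenvalues 1 at i and -1 at its reversal.
  have hP : ∀ i, P i ≠ ⊤ := by
    rintro ⟨i, him⟩ htop
    have hri : i.rev ≠ i := fun he => him (eq_mid_of_rev_eq he)
    let y : Fin (2 * m + 1) → K := Pi.single i 1 - Pi.single i.rev 1
    let X : Matrix (Fin (2 * m + 1)) (Fin (2 * m + 1)) K := h.1.val * diagonal y * (h.1⁻¹).val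
    have hX : X * h.1.val = h.1.val * diagonal y := by
      rw [Matrix.mul_assoc, hi, Matrix.mul_one]
    have hXW : X ∈ W := by
      refine ⟨(hskew y X hX).2 fun j => ?_, y, hX⟩
      simp only [y, Pi.sub_apply, Pi.single_apply, Fin.rev_inj]
      by_cases h1 : j = i
      · simp [h1, hri, hri.symm]
      · by_cases h2 : j = i.rev
        · simp [h2, hri]
        · have h3 : j.rev ≠ i := fun h => h2 (by rw [← h, Fin.rev_rev])
          simp [h1, h2, h3]
    have hspan := mem_span_rational W hW hXW
    have hle : Submodule.span K {Y | Y ∈ W ∧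
        ∃ Y₀ : Matrix (Fin (2 * m + 1)) (Fin (2 * m + 1)) F, Y₀.map (algebraMap F K) = Y} ≤
        LinearMap.ker (φ i) := by
      rw [Submodule.span_le]
      rintro _ ⟨hY, Y₀, rfl⟩
      have h1 : (⟨Y₀, hY⟩ : V) ∈ P ⟨i, him⟩ := htop ▸ Submodule.mem_top
      exact h1
    have h1 : φ i X = 0 := hle hspan
    rw [hφ i X y hX] at h1
    simp [y, hri.symm] at h1
  -- Over an infinite field finitely many proper subspaces do not cover the whole space.
  obtain ⟨⟨x, y_mem⟩, hx⟩ := Submodule.exists_forall_notMem_of_forall_ne_top P hP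
  obtain ⟨h1, y, h2⟩ : M x ∈ W := y_mem
  refine ⟨x, y, ?_, h2, ?_, ?_⟩
  · apply Matrix.map_injective (algebraMap F K).injective
    beta_reduce
    rw [Matrix.map_add _ (map_add _), Matrix.map_mul, Matrix.map_mul, map_wMat,
      Matrix.map_zero _ (map_zero _), transpose_map]
    exact h1
  · have h3 := (hskew y _ h2).1 h1 (mid m)
    rw [rev_mid, ← two_mul] at h3
    exact (mul_eq_zero.1 h3).resolve_left two_ne_zero
  · intro i him h0
    apply hx ⟨i, him⟩
    change φ i (M x) = 0
    rw [hφ i _ y h2, h0]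

/-- For rational x in Lie(T), w x is skew and, in the eigenbasis h, equals w diag(y). A rational r
pulling u_{2m} back to w x therefore makes u_{2m} antidiagonal on the columns of r h. -/
theorem exists_normDiagram_even {h : SO m (AlgebraicClosure F)}
    (hT : ∀ σ : AlgebraicClosure F ≃ₐ[F] AlgebraicClosure F,
      ∀ t ∈ conjSubgroup h (soDiagTorus m (AlgebraicClosure F)),
        galSO σ t ∈ conjSubgroup h (soDiagTorus m (AlgebraicClosure F))) :
    ∃ (T' : Subgroup (GL (Fin (2 * m)) (AlgebraicClosure F)))
      (e : Coinvariants (thetaStar (2 * m) (AlgebraicClosure F)) T' ≃*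
        conjSubgroup h (soDiagTorus m (AlgebraicClosure F))),
      NormDiagram (le_refl (2 * m)) phi
        (conjSubgroup h (soDiagTorus m (AlgebraicClosure F))) T' e := by
  obtain ⟨x, y, hx, hxy, hy0, hy⟩ := exists_regular_skew hT
  have hh : h.1.valᵀ * wMat (2 * m + 1) (AlgebraicClosure F) * h.1.val = wMat (2 * m + 1)
      (AlgebraicClosure F) := h.2.1
  have hS : (wMat (2 * m + 1) F * x)ᵀ = -(wMat (2 * m + 1) F * x) := by
    rw [transpose_mul, wMat_transpose]
    exact eq_neg_of_add_eq_zero_left hx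
  have hker : LinearMap.ker (wMat (2 * m + 1) F * x).mulVecLin ≠ ⊥ := by
    have h1 : x.det = 0 := by
      apply (algebraMap F (AlgebraicClosure F)).injective
      have h2 := congrArg det hxy
      rw [det_mul, det_mul, det_diagonal, Finset.prod_eq_zero (Finset.mem_univ (mid m)) hy0,
        mul_zero] at h2
      rw [RingHom.map_det, map_zero]
      refine (mul_eq_zero.1 h2).resolve_right ?_
      rw [show h.1.val.det = 1 from h.2.2]
      exact one_ne_zero
    obtain ⟨v, hv0, hv⟩ := Matrix.exists_mulVec_eq_zero_iff.2 h1
    intro hbot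
    apply hv0
    rw [← Submodule.mem_bot F, ← hbot, LinearMap.mem_ker, mulVecLin_apply, ← mulVec_mulVec, hv,
      mulVec_zero]
  obtain ⟨r, hr⟩ := exists_pullback_uGL m _ hS (by
    rw [Fintype.card_fin]
    have h1 := Submodule.one_le_finrank_iff.2 hker
    omega)
  set R := r.map (algebraMap F (AlgebraicClosure F)) with hR
  have hRu : (R * h.1.val)ᵀ * (uGL (2 * m) (AlgebraicClosure F)).val * (R * h.1.val) =
      wMat (2 * m + 1) (AlgebraicClosure F) * diagonal y := by
    have h1 := congrArg (fun A => A.map (algebraMap F (AlgebraicClosure F))) hr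
    beta_reduce at h1
    rw [Matrix.map_mul, Matrix.map_mul, Matrix.map_mul, map_wMat, transpose_map, ← hR,
      ← mapGL_val, map_uGL] at h1
    calc _ = h.1.valᵀ * (Rᵀ * (uGL (2 * m) (AlgebraicClosure F)).val * R) * h.1.val := by
          rw [transpose_mul]; simp only [Matrix.mul_assoc]
      _ = h.1.valᵀ * wMat (2 * m + 1) (AlgebraicClosure F) * (x.map (algebraMap F
          (AlgebraicClosure F)) * h.1.val) := by
          rw [h1]; simp only [Matrix.mul_assoc]
      _ = _ := by rw [hxy, ← Matrix.mul_assoc, hh]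
  let ι := (mid m).succAbove
  let g₀ : Matrix (Fin (2 * m)) (Fin (2 * m)) (AlgebraicClosure F) := (R * h.1.val).submatrix id ι
  have hg₀ : g₀ᵀ * (uGL (2 * m) (AlgebraicClosure F)).val * g₀ =
      wMat (2 * m) (AlgebraicClosure F) * diagonal fun i => y (ι i) := by
    have h1 : g₀ᵀ * (uGL (2 * m) (AlgebraicClosure F)).val * g₀ =
        (((R * h.1.val)ᵀ * (uGL (2 * m) (AlgebraicClosure F)).val) *
            (R * h.1.val)).submatrix ι ι := rfl
    rw [h1, hRu]
    ext i j
    rw [submatrix_apply, mul_diagonal, mul_diagonal]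
    congr 1
    simp only [wMat, of_apply, ι]
    rw [← succAbove_mid_rev]
    simp only [Fin.succAbove_right_inj]
  -- Only here are the non-zero eigenvalues needed: the pulled-back form is nondegenerate off the
  -- middle.
  have hdet : g₀.det ≠ 0 := by
    intro h0
    have h1 := congrArg det hg₀
    rw [det_mul, h0, mul_zero, det_mul, det_diagonal] at h1
    rcases mul_eq_zero.1 h1.symm with h2 | h2
    · have h3 : (wMat (2 * m) (AlgebraicClosure F)).det * (wMat (2 * m)
          (AlgebraicClosure F)).det = 1 := by
        rw [← det_mul, wMat_mul_self, det_one]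
      rw [h2, mul_zero] at h3
      exact zero_ne_one h3
    · obtain ⟨i, -, hi⟩ := Finset.prod_eq_zero_iff.1 h2
      exact hy _ (Fin.succAbove_ne _ _) hi
  let g : GL (Fin (2 * m)) (AlgebraicClosure F) := GeneralLinearGroup.mkOfDetNeZero g₀ hdet
  refine (comparison_phi m (AlgebraicClosure F)).exists_normDiagram_of_rational hT r g
      (fun i k => rfl) ?_ ?_
  · intro i j hj
    have hjm : j = mid m := by
      by_contra hne
      obtain ⟨k, hk⟩ := (comparison_phi m (AlgebraicClosure F)).range j fun h => hne (Fin.ext h)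
      exact hj k hk
    rw [hjm]
    -- The middle column of R h pairs to zero with the basis given by the other columns, as its
    -- eigenvalue is 0; nondegeneracy of u_{2m} makes it vanish.
    have h1 : (g₀ᵀ * (uGL (2 * m) (AlgebraicClosure F)).val) *ᵥ (fun i => (R * h.1.val) i
        (mid m)) = 0 := by
      ext k
      have h2 := congrFun (congrFun hRu (ι k)) (mid m)
      rw [mul_diagonal, hy0, mul_zero] at h2
      exact h2
    have h3 : IsUnit (g₀ᵀ * (uGL (2 * m) (AlgebraicClosure F)).val) := by
      refine IsUnit.mul ?_ (Units.isUnit _)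
      rw [Matrix.isUnit_transpose]
      exact g.isUnit
    have h4 := mulVec_injective_iff_isUnit.2 h3 (h1.trans (mulVec_zero _).symm)
    exact congrFun h4 i
  · intro i j hj
    have h1 := congrFun (congrFun hg₀ i) j
    rw [mul_diagonal, wMat, of_apply, if_neg hj, zero_mul] at h1
    exact h1

/-- Here u_{2m+1} is symmetric and a rational diagonal change of variables turns it into ±w_{2m+1},
for which h is already an isometry; no regular element is needed. -/
theorem exists_normDiagram_odd {h : SO m (AlgebraicClosure F)}
    (hT : ∀ σ : AlgebraicClosure F ≃ₐ[F] AlgebraicClosure F,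
      ∀ t ∈ conjSubgroup h (soDiagTorus m (AlgebraicClosure F)),
        galSO σ t ∈ conjSubgroup h (soDiagTorus m (AlgebraicClosure F))) :
    ∃ (T' : Subgroup (GL (Fin (2 * m + 1)) (AlgebraicClosure F)))
      (e : Coinvariants (thetaStar (2 * m + 1) (AlgebraicClosure F)) T' ≃*
        conjSubgroup h (soDiagTorus m (AlgebraicClosure F))),
      NormDiagram (Nat.le_succ (2 * m)) id
        (conjSubgroup h (soDiagTorus m (AlgebraicClosure F))) T' e := by
  set K := AlgebraicClosure F
  have hh : h.1.valᵀ * wMat (2 * m + 1) K * h.1.val = wMat (2 * m + 1) K := h.2.1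
  -- The middle index is fixed by reversal, so its sign (-1)^(m+1) is the target; the signs on the
  -- first half bring every other pair to the same value.
  let d : Fin (2 * m + 1) → Fˣ := fun i => if i.val < m then (-1) ^ (i.val + m) else 1
  have hd : ∀ i, (d i : F) * signTheta F i * d i.rev = (-1) ^ (m + 1) := by
    intro i
    have hr : i.rev.val = 2 * m - i.val := by rw [Fin.val_rev]; omega
    simp only [d, hr, signTheta]
    rcases lt_trichotomy i.val m with hi | hi | hi
    · rw [if_pos hi, if_neg (by omega), Units.val_one, mul_one, Units.val_pow_eq_pow_val,
        Units.val_neg, Units.val_one, ← pow_add,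
        show i.val + m + (i.val + 1) = 2 * i.val + (m + 1) by omega, pow_add, pow_mul]
      simp
    · rw [if_neg (by omega), if_neg (by omega), hi]
      simp
    · rw [if_neg (by omega), if_pos (by omega), Units.val_one, one_mul, Units.val_pow_eq_pow_val,
        Units.val_neg, Units.val_one, ← pow_add,
        show i.val + 1 + (2 * m - i.val + m) = 2 * m + (m + 1) by omega, pow_add, pow_mul]
      simp
  have hdu : (diagGL d).valᵀ * (uGL (2 * m + 1) F).val * (diagGL d).val =
      (-1 : F) ^ (m + 1) • wMat (2 * m + 1) F := by
    ext i j
    rw [diagGL_val, diagonal_transpose, mul_diagonal, diagonal_mul_uGL_apply, Matrix.smul_apply,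
      wMat, of_apply]
    split_ifs with hij
    · rw [hij, hd, smul_eq_mul, mul_one]
    · rw [zero_mul, smul_zero]
  have hdK := congrArg (fun A => A.map (algebraMap F K)) hdu
  beta_reduce at hdK
  rw [Matrix.map_mul, Matrix.map_mul, Matrix.map_smul' _ _ _ (map_mul _), map_wMat,
    transpose_map, ← mapGL_val, ← mapGL_val, map_uGL] at hdK
  refine (comparison_id m K).exists_normDiagram_of_rational hT (diagGL d).val
    (GeneralLinearGroup.map (algebraMap F K) (diagGL d) * h.1) (fun i k => rfl)
    (fun i j hj => absurd rfl (hj j)) ?_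
  intro i j hij
  have h1 : (GeneralLinearGroup.map (algebraMap F K) (diagGL d) * h.1).valᵀ *
      (uGL (2 * m + 1) K).val * (GeneralLinearGroup.map (algebraMap F K) (diagGL d) * h.1).val =
      algebraMap F K ((-1) ^ (m + 1)) • wMat (2 * m + 1) K := by
    rw [Units.val_mul, transpose_mul]
    calc _ = h.1.valᵀ * ((GeneralLinearGroup.map (algebraMap F K) (diagGL d)).valᵀ *
          (uGL (2 * m + 1) K).val * (GeneralLinearGroup.map (algebraMap F K) (diagGL d)).val) *
          h.1.val := by simp only [Matrix.mul_assoc]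
      _ = _ := by rw [hdK, Matrix.mul_smul, Matrix.smul_mul, hh]
  rw [h1, Matrix.smul_apply, wMat, of_apply, if_neg hij, smul_zero]

end RegularElements

/-! ### Kottwitz–Shelstad norms -/

section Main

theorem barGL_mul_gTheta_inv {F : Type*} [Field F] {n : ℕ} (γ : GL (Fin n) F) :
    barGL (γ * (gTheta n F)⁻¹) = barGL γ * (gTheta n (AlgebraicClosure F))⁻¹ := by
  rw [barGL, map_mul, map_inv, map_gTheta]
  rfl

variable {F : Type*} [Field F] [CharZero F] {m n : ℕ}

variable {hn : 2 * m ≤ n}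
  {ψ : Matrix (Fin n) (Fin n) (AlgebraicClosure F) →
    Matrix (Fin (2 * m + 1)) (Fin (2 * m + 1)) (AlgebraicClosure F)}
  {ι : Fin n → Fin (2 * m + 1)}

/-- The Kottwitz–Shelstad norms of a `θ*`-semisimple element are characterized by conjugacy over
the algebraic closure. -/
theorem Comparison.mem_ksNorm_iff (C : Comparison hn ψ ι) {δ : GL (Fin n) F}
    (hδ : TwistedSemisimple (thetaStar n (AlgebraicClosure F)) (barGL δ)) (γ : SO m F) :
    γ ∈ ksNorm hn δ ↔ IsConj (barSO γ).1.val (ψ (normTheta (barGL δ)).val) := by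
  obtain ⟨a, ha⟩ := exists_diagGL_of_twistedSemisimple hδ
  exact C.mem_imageMap_iff ha

/-- Both γ₁ and every Kottwitz–Shelstad norm become, over the algebraic closure, similar to the same
ψ(N(γ g_θ⁻¹)), and similarity there is stable conjugacy. -/
theorem Comparison.ksNormEpsilon_eq_stableClass (C : Comparison hn ψ ι) {γ : GL (Fin n) F}
    (hs : TwistedSemisimple (epsilon n (AlgebraicClosure F)) (barGL γ))
    (hr : StronglyRegular (epsilon n (AlgebraicClosure F)) (barGL γ)) {γ₁ : SO m F}
    (h : ConjClasses.mk γ₁ ∈ normCorr m γ) : ksNormEpsilon hn γ = stableClass γ₁ := by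
  rw [twistedSemisimple_epsilon_iff] at hs
  rw [stronglyRegular_epsilon_iff] at hr
  obtain ⟨a, ha⟩ := exists_diagGL_of_twistedSemisimple hs
  have h1 := C.isConj_of_mem_normCorr hr ha
    (mem_normCorr_map (algebraMap F (AlgebraicClosure F)) h)
  have h1 : IsConj (barSO γ₁).1.val _ := h1
  ext γ'
  rw [ksNormEpsilon, C.mem_ksNorm_iff (by rwa [barGL_mul_gTheta_inv]), barGL_mul_gTheta_inv]
  constructor
  · exact fun h2 => SO_isConj_of_isConj (h1.trans h2.symm)
  · intro h2
    have h2 : IsConj (barSO γ₁) (barSO γ') := h2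
    exact (isConj_val h2).symm.trans h1

theorem isConj_iff_exists_conj {K : Type*} [Field K] {k : ℕ} {A B : Matrix (Fin k) (Fin k) K} :
    IsConj A B ↔ ∃ P : GL (Fin k) K, P.val * A * (P⁻¹).val = B := by
  refine ⟨exists_conj_eq_of_isConj, ?_⟩
  rintro ⟨P, rfl⟩
  refine ⟨P, ?_⟩
  change P.val * A = P.val * A * (P⁻¹).val * P.val
  rw [mul_assoc _ (P⁻¹).val, P.inv_mul, mul_one]

end Main

end TwistedNorm

end

open TwistedNorm in
theorem proposition2p17 (F : Type*) [Field F] [ValuativeRel F] [TopologicalSpace F]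
    [IsNonarchimedeanLocalField F] [CharZero F] (m : ℕ) :
    -- `n = 2m + 1`: on strongly `ε`-regular `ε`-semisimple classes in `𝒩`
    (∀ γ' : GL (Fin (2 * m + 1)) F,
      InN m γ' →
      TwistedSemisimple (epsilon (2 * m + 1) (AlgebraicClosure F)) (barGL γ') →
      StronglyRegular (epsilon (2 * m + 1) (AlgebraicClosure F)) (barGL γ') →
      (normCorr m γ').Nonempty ∧
      ∀ γ₁ : SO m F, ConjClasses.mk γ₁ ∈ normCorr m γ' →
        ksNormEpsilon (m := m) (Nat.le_succ (2 * m)) γ' = stableClass γ₁) ∧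
    -- `n = 2m`: on `θ*`-semisimple classes
    (∀ δ : GL (Fin (2 * m)) F,
      TwistedSemisimple (thetaStar (2 * m) (AlgebraicClosure F)) (barGL δ) →
      ∀ γ : SO m F, γ ∈ ksNorm (m := m) (le_refl (2 * m)) δ ↔
        ∃ P : GL (Fin (2 * m + 1)) (AlgebraicClosure F),
          (P : Matrix _ _ (AlgebraicClosure F)) *
              ((barSO γ : SO m (AlgebraicClosure F)) : GL _ (AlgebraicClosure F)).val *
              ((P⁻¹ : GL _ (AlgebraicClosure F)) : Matrix _ _ (AlgebraicClosure F)) =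
            phi (barGL (δ * thetaStar (2 * m) F δ)).val) ∧
    -- Cartan subgroups
    (∀ T : Subgroup (SO m (AlgebraicClosure F)), IsCartanSO T →
      (∃ (T' : Subgroup (GL (Fin (2 * m)) (AlgebraicClosure F)))
        (e : Coinvariants (thetaStar (2 * m) (AlgebraicClosure F)) T' ≃* T),
        NormDiagram (le_refl (2 * m)) phi T T' e) ∧
      (∃ (T' : Subgroup (GL (Fin (2 * m + 1)) (AlgebraicClosure F)))
        (e : Coinvariants (thetaStar (2 * m + 1) (AlgebraicClosure F)) T' ≃* T),
        NormDiagram (Nat.le_succ (2 * m)) id T T' e)) := by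
  refine ⟨fun γ' hN hs hr => ⟨normCorr_nonempty hN, fun γ₁ hγ₁ =>
    (comparison_id m _).ksNormEpsilon_eq_stableClass hs hr hγ₁⟩, fun δ hδ γ => ?_, ?_⟩
  · rw [(comparison_phi m _).mem_ksNorm_iff hδ, isConj_iff_exists_conj]
    have h1 : barGL (δ * thetaStar (2 * m) F δ) = normTheta (barGL δ) :=
      map_normTheta (algebraMap F (AlgebraicClosure F)) δ
    rw [h1]
  · rintro T ⟨⟨h, rfl⟩, hT⟩
    exact ⟨exists_normDiagram_even hT, exists_normDiagram_odd hT⟩
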